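/- Let $N\ge 1$, let $\Omega\subset\mathbb R^N$ be a nonempty bounded open set with $C^2$ boundary, $T>0$, $\alpha\in(\tfrac32,2)$ and $\mu\ge 0$. Let $(e_n)_{n\ge1}$ be an orthonormal basis of $L^2(\Omega)$ consisting of eigenfunctions of the Dirichlet Laplacian, $e_n\in H^1_0(\Omega)$, $-\Delta e_n=\lambda_n e_n$ (such a basis exists, and $\lambda_n>0$). For $s\in\mathbb R$ and $v\in L^2(\Omega)$ put $\|v\|_{D((-\Delta)^s)}=\big(\sum_n\lambda_n^{2s}|\langle v,e_n\rangle|^2\big)^{1/2}$, and let $D((-\Delta)^s)$, for $s\ge0$, be the set of $v\in L^2(\Omega)$ for which this is finite. For $\theta>0$ let $D((-\Delta)^{-\theta})$ be the dual of $D((-\Delta)^{\theta})$, with the norm $\big(\sum_n\lambda_n^{-2\theta}|\langle\varphi,e_n\rangle_{-\theta,\theta}|^2\big)^{1/2}$. For $v\in H^1_0(\Omega)$ the gradient $\nabla v$ is expanded in the orthonormal fields $\lambda_n^{-1/2}\nabla e_n$: we put $$\|\nabla v\|_{D((-\Delta)^s)}=\Big(\sum_n\lambda_n^{2s}\Big|\int_\Omega\nabla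 v\cdot\lambda_n^{-1/2}\nabla e_n\,dx\Big|^2\Big)^{1/2}=\Big(\sum_n\lambda_n^{1+2s}|\langle v,e_n\rangle|^2\Big)^{1/2}$$ and write $\nabla v\in D((-\Delta)^s)$ if this is finite. Let $I^{\beta}_{0+}f(t)=\frac1{\Gamma(\beta)}\int_0^t(t-s)^{\beta-1}f(s)\,ds$, $D^{\alpha-2}_{0+}u=I^{2-\alpha}_{0+}u$, $D^{\alpha-1}_{0+}u=\frac{d}{dt}I^{2-\alpha}_{0+}u$ and $D^{\alpha}_{0+}u=\frac{d}{dt}D^{\alpha-1}_{0+}u$, the time derivatives being weak derivatives on $(0,T)$. A weak solution of $$D^\alpha_{0+}u=\Delta u\ \text{ in }(0,T)\times\Omega,\qquad u=0\ \text{ on }(0,T)\times\partial\Omega$$ is a function $u\in L^2(0,T;H^1_0(\Omega))$ with $D^{\alpha-1}_{0+}u\in L^2(0,T;L^2(\Omega))$ such that for every $\varphi\in H^1_0(\Omega)$ one has $\int_\Omega D^{\alpha-1}_{0+}u(t,x)\varphi(x)\,dx\in W^{1,1}(0,T)$ and $$\frac{d}{dt}\int_\Omega D^{\alpha-1}_{0+}u\,\varphi\,dx+\int_\Omega\nabla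 u\cdot\nabla\varphi\,dx=0\quad\text{for a.e. }t\in(0,T).$$ It has initial data $D^{\alpha-1}_{0+}u(0,\cdot)=u_1$, $D^{\alpha-2}_{0+}u(0,\cdot)=u_2$ if, as $t\to0+$ through almost all $t$, $\langle D^{\alpha-1}_{0+}u(t),\varphi\rangle\to\langle u_1,\varphi\rangle$ for every $\varphi\in H^1_0(\Omega)$ and $I^{2-\alpha}_{0+}u(t)\to u_2$ in $L^2(\Omega)$. Let $u_1\in D((-\Delta)^{\mu})$ and $u_2\in H^1_0(\Omega)$ with $\nabla u_2\in D((-\Delta)^{\mu})$. Then there is a unique weak solution $u$ with initial data $u_1,u_2$. It is given, for a.e. $t\in(0,T)$, by the series, convergent in $L^2(\Omega)$, $$u(t)=\sum_{n}\big[\langle u_1,e_n\rangle t^{\alpha-1}E_{\alpha,\alpha}(-\lambda_nt^\alpha)+\langle u_2,e_n\rangle t^{\alpha-2}E_{\alpha,\alpha-1}(-\lambda_nt^\alpha)\big]e_n,\qquad E_{\alpha,\beta}(z)=\sum_{k\ge0}\frac{z^k}{\Gamma(\alpha k+\beta)},$$ and it satisfies the following. (i) For every $\theta\in\big(\mu,\frac{2\alpha-3}{2\alpha}+\mu\big)$,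 $$\|\nabla u\|_{L^2(0,T;D((-\Delta)^{\theta}))}\le C\big(\|u_1\|_{D((-\Delta)^{\mu})}+\|\nabla u_2\|_{D((-\Delta)^{\mu})}\big).$$ (ii) For every $\theta\in\big(\frac{3-\alpha}{2\alpha}-\mu,\frac12-\mu\big)$, $D^\alpha_{0+}u$ exists as an element of $L^2(0,T;D((-\Delta)^{-\theta}))$ and $$\|D^\alpha_{0+}u\|_{L^2(0,T;D((-\Delta)^{-\theta}))}\le C\big(\|u_1\|_{D((-\Delta)^{\mu})}+\|\nabla u_2\|_{D((-\Delta)^{\mu})}\big).$$ Here $C>0$ does not depend on $u_1,u_2$. -/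

import Mathlib

open MeasureTheory Filter Topology Set
open scoped ENNReal InnerProductSpace ContDiff

noncomputable section

namespace RLWave

/-- `L²(Ω)`, real valued. -/
abbrev L2 {N : ℕ} (Ω : Set (EuclideanSpace ℝ (Fin N))) : Type :=
  Lp ℝ 2 (volume.restrict Ω)

/-- `L²(Ω; ℝᴺ)`, square integrable vector fields. -/
abbrev L2Vec {N : ℕ} (Ω : Set (EuclideanSpace ℝ (Fin N))) : Type :=
  Lp (EuclideanSpace ℝ (Fin N)) 2 (volume.restrict Ω)

/-- The pairs `(φ, ∇φ)` with `φ ∈ C_c^∞(Ω)`. -/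
def testPairs {N : ℕ} (Ω : Set (EuclideanSpace ℝ (Fin N))) : Set (L2 Ω × L2Vec Ω) :=
  {p | ∃ φ : EuclideanSpace ℝ (Fin N) → ℝ,
    ContDiff ℝ ∞ φ ∧ HasCompactSupport φ ∧ tsupport φ ⊆ Ω ∧
    p.1 =ᵐ[volume.restrict Ω] φ ∧ p.2 =ᵐ[volume.restrict Ω] gradient φ}

/-- `H¹₀(Ω)`, the closure of `C_c^∞(Ω)` in the `H¹` norm. An element is stored together with its
weak gradient, as the pair `(v, ∇v)`; the norm is equivalent to the `H¹` norm. -/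
def H10Sub {N : ℕ} (Ω : Set (EuclideanSpace ℝ (Fin N))) : Submodule ℝ (L2 Ω × L2Vec Ω) :=
  (Submodule.span ℝ (testPairs Ω)).topologicalClosure

/-- The space `H¹₀(Ω)` as a type. -/
abbrev H10 {N : ℕ} (Ω : Set (EuclideanSpace ℝ (Fin N))) : Type :=
  H10Sub Ω

/-- The function `v ∈ L²(Ω)` underlying an element of `H¹₀(Ω)`. -/
def H10.fn {N : ℕ} {Ω : Set (EuclideanSpace ℝ (Fin N))} (v : H10 Ω) : L2 Ω :=
  (v : L2 Ω × L2Vec Ω).1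

/-- The weak gradient `∇v ∈ L²(Ω; ℝᴺ)` of an element of `H¹₀(Ω)`. -/
def H10.grad {N : ℕ} {Ω : Set (EuclideanSpace ℝ (Fin N))} (v : H10 Ω) : L2Vec Ω :=
  (v : L2 Ω × L2Vec Ω).2

/-- `(e n)` is an orthonormal basis of `L²(Ω)` made of eigenfunctions of the Dirichlet Laplacian,
`-Δ e_n = λ_n e_n` with `e_n ∈ H¹₀(Ω)`, the equation being read weakly. -/
structure IsDirichletEigenbasis {N : ℕ} (Ω : Set (EuclideanSpace ℝ (Fin N)))
    (e : ℕ → H10 Ω) (lam : ℕ → ℝ) : Prop where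
  orthonormal : Orthonormal ℝ (fun n => (e n).fn)
  complete : (Submodule.span ℝ (range fun n => (e n).fn)).topologicalClosure = ⊤
  eigen : ∀ (n : ℕ) (φ : H10 Ω), ⟪(e n).grad, φ.grad⟫_ℝ = lam n * ⟪(e n).fn, φ.fn⟫_ℝ

section FractionalPowers

variable {N : ℕ} {Ω : Set (EuclideanSpace ℝ (Fin N))}

/-- The domain `D((-Δ)^s)`: the `v ∈ L²(Ω)` with `∑ λ_n^{2s} |⟨v, e_n⟩|² < ∞`. -/
def fracDomain (e : ℕ → H10 Ω) (lam : ℕ → ℝ) (s : ℝ) : Submodule ℝ (L2 Ω) where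
  carrier := {v | Summable fun n => (lam n ^ s * ⟪v, (e n).fn⟫_ℝ) ^ 2}
  zero_mem' := by simp [summable_zero]
  add_mem' := by
    intro a b ha hb
    simp only [mem_ofPred_eq] at ha hb ⊢
    refine Summable.of_nonneg_of_le (fun n => sq_nonneg _) (fun n => ?_)
      ((ha.add hb).mul_left 2)
    rw [inner_add_left]
    nlinarith [sq_nonneg (lam n ^ s * ⟪a, (e n).fn⟫_ℝ - lam n ^ s * ⟪b, (e n).fn⟫_ℝ)]
  smul_mem' := by
    intro c a ha
    simp only [mem_ofPred_eq] at ha ⊢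
    refine (ha.mul_left (c ^ 2)).congr (fun n => ?_)
    rw [real_inner_smul_left]
    ring

/-- The norm of `D((-Δ)^s)`, `(∑ λ_n^{2s} |⟨v, e_n⟩|²)^{1/2}`, with value `∞` off the domain. -/
def fracNorm (e : ℕ → H10 Ω) (lam : ℕ → ℝ) (s : ℝ) (v : L2 Ω) : ℝ≥0∞ :=
  (∑' n, ENNReal.ofReal ((lam n ^ s * ⟪v, (e n).fn⟫_ℝ) ^ 2)) ^ (1 / 2 : ℝ)

/-- Eigenfunctions lie in the domain of every power. -/
theorem eigen_mem_fracDomain {e : ℕ → H10 Ω} {lam : ℕ → ℝ} (h : IsDirichletEigenbasis Ω e lam)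
    (s : ℝ) (n : ℕ) : (e n).fn ∈ fracDomain e lam s := by
  change Summable _
  refine summable_of_ne_finset_zero (s := {n}) (fun m hm => ?_)
  have hne : n ≠ m := fun hnm => hm (by simp [hnm])
  simp [h.orthonormal.2 hne]

/-- `ℓ` is a bounded linear functional on `D((-Δ)^s)`, that is an element of `D((-Δ)^{-s})`.
For `s < 0` the space `fracDomain e lam s` is `L²(Ω)` with the weaker norm of order `s`, and the
bounded functionals are those represented by the elements of `D((-Δ)^{|s|})`. -/
def IsBoundedFunctional (e : ℕ → H10 Ω) (lam : ℕ → ℝ) (s : ℝ)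
    (ℓ : fracDomain e lam s →ₗ[ℝ] ℝ) : Prop :=
  ∃ M : ℝ, ∀ φ : fracDomain e lam s,
    ENNReal.ofReal |ℓ φ| ≤ ENNReal.ofReal M * fracNorm e lam s (φ : L2 Ω)

/-- The norm of `D((-Δ)^{-s})`, `(∑ λ_n^{-2s} |⟨ℓ, e_n⟩_{-s,s}|²)^{1/2}`. -/
def fracDualNorm {e : ℕ → H10 Ω} {lam : ℕ → ℝ} (h : IsDirichletEigenbasis Ω e lam) (s : ℝ)
    (ℓ : fracDomain e lam s →ₗ[ℝ] ℝ) : ℝ≥0∞ :=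
  (∑' n, ENNReal.ofReal
    ((lam n ^ (-s) * ℓ ⟨(e n).fn, eigen_mem_fracDomain h s n⟩) ^ 2)) ^ (1 / 2 : ℝ)

/-- The norm of `∇v` in `D((-Δ)^s)` for `v ∈ H¹₀(Ω)`. The Laplacian acts on gradient fields by
`-Δ∇v = ∇(-Δv)`, with the orthonormal eigenfields `λ_n^{-1/2} ∇e_n`; the norm is
`(∑ λ_n^{2s} |⟨∇v, λ_n^{-1/2} ∇e_n⟩|²)^{1/2}`, with value `∞` when `∇v ∉ D((-Δ)^s)`. -/
def gradFracNorm (e : ℕ → H10 Ω) (lam : ℕ → ℝ) (s : ℝ) (v : H10 Ω) : ℝ≥0∞ :=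
  (∑' n, ENNReal.ofReal
    ((lam n ^ s * (lam n ^ (-(1 / 2) : ℝ) * ⟪v.grad, (e n).grad⟫_ℝ)) ^ 2)) ^ (1 / 2 : ℝ)

/-- The norm of `∇v` in `D((-Δ)^s)` is `(∑ λ_n^{1+2s} |⟨v, e_n⟩|²)^{1/2}`. -/
theorem gradFracNorm_eq {e : ℕ → H10 Ω} {lam : ℕ → ℝ} (h : IsDirichletEigenbasis Ω e lam)
    (hpos : ∀ n, 0 < lam n) (s : ℝ) (v : H10 Ω) :
    gradFracNorm e lam s v =
      (∑' n, ENNReal.ofReal (lam n ^ (1 + 2 * s) * ⟪v.fn, (e n).fn⟫_ℝ ^ 2)) ^ (1 / 2 : ℝ) := by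
  unfold gradFracNorm
  congr 1
  refine tsum_congr (fun n => ?_)
  congr 1
  rw [real_inner_comm, h.eigen n v, real_inner_comm]
  have h1 : lam n ^ (1 + 2 * s) = (lam n ^ s) ^ 2 * (lam n ^ (-(1 / 2) : ℝ)) ^ 2 * lam n ^ 2 := by
    rw [← Real.rpow_natCast (lam n ^ s), ← Real.rpow_natCast (lam n ^ (-(1 / 2) : ℝ)),
      ← Real.rpow_natCast (lam n) 2, ← Real.rpow_mul (hpos n).le, ← Real.rpow_mul (hpos n).le,
      ← Real.rpow_add (hpos n), ← Real.rpow_add (hpos n)]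
    congr 1
    push_cast
    ring
  rw [h1]
  ring

end FractionalPowers

/-- The norm of `L²(0,T; X)` computed from the pointwise norm `t ↦ ‖f(t)‖_X`. -/
def timeL2Norm (T : ℝ) (f : ℝ → ℝ≥0∞) : ℝ≥0∞ :=
  (∫⁻ t in Ioo 0 T, f t ^ 2) ^ (1 / 2 : ℝ)

/-- `g` is the weak derivative of `f` on `(0,T)`, both being integrable (so `f ∈ W^{1,1}(0,T)`). -/
def HasWeakDeriv {F : Type*} [NormedAddCommGroup F] [NormedSpace ℝ F] (T : ℝ) (f g : ℝ → F) :
    Prop :=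
  IntegrableOn f (Ioo 0 T) ∧ IntegrableOn g (Ioo 0 T) ∧
  ∀ ψ : ℝ → ℝ, ContDiff ℝ ∞ ψ → HasCompactSupport ψ → tsupport ψ ⊆ Ioo 0 T →
    ∫ t in Ioo 0 T, deriv ψ t • f t = - ∫ t in Ioo 0 T, ψ t • g t

/-- The Riemann–Liouville integral `I_{0+}^β f(t) = Γ(β)⁻¹ ∫₀ᵗ (t-s)^{β-1} f(s) ds`. -/
def rlIntegral {F : Type*} [NormedAddCommGroup F] [NormedSpace ℝ F] (β : ℝ) (f : ℝ → F) (t : ℝ) :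
    F :=
  (Real.Gamma β)⁻¹ • ∫ s in Ioo 0 t, (t - s) ^ (β - 1) • f s

/-- The Mittag-Leffler function `E_{α,β}` on the real line. -/
def mittagLeffler (α β z : ℝ) : ℝ :=
  ∑' k : ℕ, z ^ k / Real.Gamma (α * k + β)

/-- `u` is a weak solution on `(0,T)` of `D_{0+}^α u = Δu` with Dirichlet boundary condition, and
`v = D_{0+}^{α-1} u = d/dt I_{0+}^{2-α} u`. -/
structure IsWeakSolution {N : ℕ} (Ω : Set (EuclideanSpace ℝ (Fin N))) (α T : ℝ)
    (u : ℝ → H10 Ω) (v : ℝ → L2 Ω) : Prop where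
  memLp : MemLp u 2 (volume.restrict (Ioo 0 T))
  memLp_deriv : MemLp v 2 (volume.restrict (Ioo 0 T))
  hasDeriv : HasWeakDeriv T (rlIntegral (2 - α) fun s => (u s).fn) v
  weak : ∀ φ : H10 Ω, ∃ g : ℝ → ℝ, HasWeakDeriv T (fun t => ⟪v t, φ.fn⟫_ℝ) g ∧
    ∀ᵐ t ∂(volume.restrict (Ioo 0 T)), g t + ⟪(u t).grad, φ.grad⟫_ℝ = 0

/-- The initial conditions `D_{0+}^{α-1} u(0) = u₁`, `D_{0+}^{α-2} u(0) = u₂`, where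
`v = D_{0+}^{α-1} u` and `D_{0+}^{α-2} u = I_{0+}^{2-α} u`. Limits are taken as `t → 0+` through
almost all points. The second one is in `L²(Ω)`, the first one is tested against `H¹₀(Ω)`. -/
def HasInitialData {N : ℕ} {Ω : Set (EuclideanSpace ℝ (Fin N))} (α : ℝ)
    (u : ℝ → H10 Ω) (v : ℝ → L2 Ω) (u₁ : L2 Ω) (u₂ : H10 Ω) : Prop :=
  (∀ φ : H10 Ω, Tendsto (fun t => ⟪v t, φ.fn⟫_ℝ) (𝓝[>] 0 ⊓ ae volume) (𝓝 ⟪u₁, φ.fn⟫_ℝ)) ∧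
  Tendsto (rlIntegral (2 - α) fun s => (u s).fn) (𝓝[>] 0 ⊓ ae volume) (𝓝 u₂.fn)

/-- The `n`-th coefficient
`⟨u₁,e_n⟩ t^{α-1} E_{α,α}(-λ_n t^α) + ⟨u₂,e_n⟩ t^{α-2} E_{α,α-1}(-λ_n t^α)` of the solution. -/
def seriesCoeff {N : ℕ} {Ω : Set (EuclideanSpace ℝ (Fin N))} (e : ℕ → H10 Ω) (lam : ℕ → ℝ)
    (α : ℝ) (u₁ : L2 Ω) (u₂ : H10 Ω) (t : ℝ) (n : ℕ) : ℝ :=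
  ⟪u₁, (e n).fn⟫_ℝ * t ^ (α - 1) * mittagLeffler α α (-lam n * t ^ α) +
  ⟪u₂.fn, (e n).fn⟫_ℝ * t ^ (α - 2) * mittagLeffler α (α - 1) (-lam n * t ^ α)

/-- `w = D_{0+}^α u = d/dt v`, where `v = D_{0+}^{α-1} u`, as a function on `(0,T)` with values in
`D((-Δ)^{-θ})`, the dual of `D((-Δ)^θ)`. -/
def IsRLDerivInDual {N : ℕ} {Ω : Set (EuclideanSpace ℝ (Fin N))} (e : ℕ → H10 Ω) (lam : ℕ → ℝ)
    (T θ : ℝ) (v : ℝ → L2 Ω) (w : ℝ → (fracDomain e lam θ →ₗ[ℝ] ℝ)) : Prop :=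
  (∀ᵐ t ∂(volume.restrict (Ioo 0 T)), IsBoundedFunctional e lam θ (w t)) ∧
  ∀ φ : fracDomain e lam θ, HasWeakDeriv T (fun t => ⟪v t, (φ : L2 Ω)⟫_ℝ) (fun t => w t φ)

end RLWave

end

noncomputable section

namespace RLWave

/-! ### Riemann–Liouville integrals of powers and of Mittag-Leffler functions -/

/-! Expansion in eigenfunctions reduces the equation to the scalar problems D^α y = -λy with data a,
b. Their unique solution is a f_α + b f_{α-1}, where f_β(t) = t^{β-1} E_{α,β}(-λt^α) is `mlFun`.
What remains is to bound f_β in L² in time with explicit dependence on λ. By homogeneity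
(`mlFun_scale`), once f_β with λ = 1 lies in L²(0,∞), its L² norm squared for general λ is at most C
λ^{(1-2β)/α}. For β = α-1 this gains λ^{-(2α-3)/α}, which is exactly the width of the range of θ in
(i); for β = α the gain is larger than needed. Estimate (ii) is the same estimate with 1/2 - θ in
place of θ, because D^α u = Δu.

The core is the square integrability of f_1, f_α, f_{α-1} on the half line (`memLp_mlFun`), proved
by an energy argument instead of asymptotics. Put β = α-1, y₀ = f_1, y₁ = f_α; then y₀' = -y₁ and y₁
= I^β y₀, so ∫₀^X y₀ I^β y₀ = (1 - y₀(X)²)/2 ≤ 1/2. The kernel t^{β-1} is a superposition of the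
exponentials e^{-rt} with weight r^{-β}; with w_r = e^{-r·} * y₀ the energy bound becomes ∫₀^∞
r^{1-β} ‖w_r‖² dr < ∞ (`lintegral_relaxation_energy_lt_top`). The resolvent identity and integration
by parts extract from it y₀, y₁ ∈ L² (`memLp_relaxation`) and, when β > 1/2, also y₁' ∈ L²
(`memLp_relaxation_deriv`). The last condition is α > 3/2.

The eigenbasis comes from the compactness of H¹₀(Ω) → L²(Ω), which follows from an estimate on
translations (`exists_rellich`), and from the spectral theorem (`exists_eigenbasis`). Poincaré's
inequality bounds the eigenvalues below by some λ₀ > 0, so that nonpositive powers of λ are bounded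
by the same powers of λ₀.

Testing a weak solution with e_n gives two integral equations for its coefficient. The difference z
of two solutions satisfies I^{2-α} z = -λ I¹I¹z; applying I^{α-1} gives a Volterra equation for I¹z,
and Gronwall gives z = 0. So every weak solution is the stated series. Conversely, the series for u
and for D^{α-1}u converge in L²(0,T;H¹₀) and L²(0,T;L²), and satisfy the time-integrated equations,
which are checked through eigenfunction expansions. -/

theorem betaIntegral_ofReal (a b : ℝ) :
    Complex.betaIntegral a b = ((∫ x in (0:ℝ)..1, x ^ (a - 1) * (1 - x) ^ (b - 1) : ℝ) : ℂ) := by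
  rw [Complex.betaIntegral, ← intervalIntegral.integral_ofReal]
  refine intervalIntegral.integral_congr fun x hx => ?_
  rw [uIcc_of_le zero_le_one] at hx
  simp only [Complex.ofReal_mul]
  rw [Complex.ofReal_cpow hx.1, Complex.ofReal_cpow (sub_nonneg.2 hx.2)]
  push_cast
  rfl

theorem integrableOn_rpow_mul_sub_rpow {β γ : ℝ} (hβ : 0 < β) (hγ : 0 < γ) {t : ℝ} (ht : 0 < t) :
    IntegrableOn (fun s => (t - s) ^ (β - 1) * s ^ (γ - 1)) (Ioo 0 t) := by
  -- Cutting at t/2 leaves one singular endpoint in each half; the right half is the reflection of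
  -- the left one with exponents exchanged.
  have key : ∀ a b : ℝ, 0 < a → 0 < b →
      IntegrableOn (fun s => (t - s) ^ (a - 1) * s ^ (b - 1)) (Ioo 0 (t / 2)) := by
    intro a b ha hb
    have hI : IntegrableOn (fun s : ℝ => s ^ (b - 1)) (Ioo 0 (t / 2)) := by
      have := (intervalIntegral.intervalIntegrable_rpow' (a := 0) (b := t / 2) (r := b - 1)
        (by linarith))
      rwa [intervalIntegrable_iff_integrableOn_Ioo_of_le (by linarith)] at this
    have hc : ContinuousOn (fun s : ℝ => (t - s) ^ (a - 1)) (Icc 0 (t / 2)) := by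
      refine ContinuousOn.rpow_const (by fun_prop) fun s hs => Or.inl ?_
      have := hs.2
      have : t - s > 0 := by linarith
      exact this.ne'
    obtain ⟨C, hC⟩ := isCompact_Icc.exists_bound_of_continuousOn hc
    refine Integrable.bdd_mul (c := C) hI ?_ ?_
    · exact (hc.mono Ioo_subset_Icc_self).aestronglyMeasurable measurableSet_Ioo
    · filter_upwards [ae_restrict_mem measurableSet_Ioo] with s hs
      exact hC s (Ioo_subset_Icc_self hs)
  have h1 := key β γ hβ hγ
  have h2 : IntegrableOn (fun s => (t - s) ^ (β - 1) * s ^ (γ - 1)) (Ioo (t / 2) t) := by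
    have h3 := key γ β hγ hβ
    rw [← intervalIntegrable_iff_integrableOn_Ioo_of_le (by linarith)] at h3 ⊢
    have := (h3.comp_sub_left t).symm
    convert this using 2
    · ring_nf
    · ring
    · ring
  have h12 : Ioo 0 t = Ioo 0 (t / 2) ∪ Ioo (t / 2) t ∪ {t / 2} := by
    ext s
    simp only [mem_Ioo, mem_union, mem_singleton_iff]
    constructor
    · rintro ⟨h, h'⟩
      rcases lt_trichotomy s (t / 2) with h1 | h1 | h1 <;> simp_all
    · rintro ((⟨h, h'⟩ | ⟨h, h'⟩) | h) <;> constructor <;> linarith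
  rw [h12]
  exact (h1.union h2).union (integrableOn_singleton enorm_ne_top (by simp))

theorem integral_rpow_mul_sub_rpow {β γ : ℝ} (hβ : 0 < β) (hγ : 0 < γ) {t : ℝ} (ht : 0 < t) :
    ∫ s in Ioo 0 t, (t - s) ^ (β - 1) * s ^ (γ - 1) =
      t ^ (β + γ - 1) * (Real.Gamma β * Real.Gamma γ / Real.Gamma (β + γ)) := by
  have h1 := Complex.betaIntegral_scaled γ β ht
  have h2 : Complex.Gamma γ * Complex.Gamma β =
      Complex.Gamma (γ + β) * Complex.betaIntegral γ β :=
    Complex.Gamma_mul_Gamma_eq_betaIntegral (by simpa using hγ) (by simpa using hβ)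
  have h3 : ∫ x in (0:ℝ)..t, (x : ℂ) ^ ((γ : ℂ) - 1) * ((t : ℂ) - x) ^ ((β : ℂ) - 1) =
      ((∫ s in (0:ℝ)..t, (t - s) ^ (β - 1) * s ^ (γ - 1) : ℝ) : ℂ) := by
    rw [← intervalIntegral.integral_ofReal]
    refine intervalIntegral.integral_congr fun x hx => ?_
    rw [uIcc_of_le ht.le] at hx
    simp only [Complex.ofReal_mul]
    rw [Complex.ofReal_cpow hx.1, Complex.ofReal_cpow (sub_nonneg.2 hx.2)]
    push_cast
    ring
  rw [h3] at h1
  rw [betaIntegral_ofReal] at h1 h2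
  have h4 : (t : ℂ) ^ ((γ : ℂ) + β - 1) = ((t ^ (γ + β - 1) : ℝ) : ℂ) := by
    rw [Complex.ofReal_cpow ht.le]; push_cast; rfl
  rw [h4] at h1
  rw [← Complex.ofReal_add] at h2
  simp only [Complex.Gamma_ofReal] at h2
  have h1' := by exact_mod_cast h1
  have h2' := by exact_mod_cast h2
  rw [← integral_Ioc_eq_integral_Ioo, ← intervalIntegral.integral_of_le ht.le, h1']
  have hG : Real.Gamma (γ + β) ≠ 0 := (Real.Gamma_pos_of_pos (by linarith)).ne'
  rw [add_comm β γ, mul_comm (Real.Gamma β), h2', mul_div_cancel_left₀ _ hG]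

/-- `s ↦ s^{β-1} E_{α,β}(-λ s^α)`. -/
def mlFun (α β lam t : ℝ) : ℝ := t ^ (β - 1) * mittagLeffler α β (-lam * t ^ α)

theorem summable_mittagLeffler {α β : ℝ} (hα : 1 ≤ α) (hβ : 0 < β) (z : ℝ) :
    Summable fun k : ℕ => z ^ k / Real.Gamma (α * k + β) := by
  have h0 : Summable fun k : ℕ => |z| ^ 2 * (|z| ^ k / (k.factorial : ℝ)) * (k + 1) := by
    have h1 := (Real.summable_pow_div_factorial (2 * |z|)).mul_left (|z| ^ 2)
    refine Summable.of_nonneg_of_le (fun k => by positivity) (fun k => ?_) h1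
    rw [mul_pow, mul_assoc]
    have : (k + 1 : ℝ) ≤ 2 ^ k := by exact_mod_cast Nat.lt_two_pow_self (n := k)
    have h3 : |z| ^ k / (k.factorial : ℝ) * (k + 1) ≤ 2 ^ k * |z| ^ k / (k.factorial : ℝ) := by
      rw [mul_comm, mul_div_assoc]
      gcongr
    gcongr
  -- After two terms the argument of Γ is at least k + 2 ≥ 2, in the range where Γ increases, so the
  -- denominators dominate k!.
  rw [← summable_nat_add_iff 2]
  refine Summable.of_norm_bounded h0 fun k => ?_
  have hG : (k.factorial : ℝ) ≤ Real.Gamma (α * ((k + 2 : ℕ) : ℝ) + β) := by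
    have h2 : (2 : ℝ) ≤ ((k + 1 : ℕ) : ℝ) + 1 := by push_cast; linarith [k.cast_nonneg (α := ℝ)]
    have h3 : ((k + 1 : ℕ) : ℝ) + 1 ≤ α * ((k + 2 : ℕ) : ℝ) + β := by
      push_cast; nlinarith [k.cast_nonneg (α := ℝ)]
    have h4 := Real.Gamma_strictMonoOn_Ici.monotoneOn (mem_Ici.2 h2) (mem_Ici.2 (h2.trans h3)) h3
    rw [Real.Gamma_nat_eq_factorial] at h4
    refine le_trans ?_ h4
    exact_mod_cast Nat.factorial_le (Nat.le_succ k)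
  have hpos : (0 : ℝ) < k.factorial := by positivity
  rw [norm_div, norm_pow, Real.norm_eq_abs, Real.norm_of_nonneg (hpos.le.trans hG)]
  calc |z| ^ (k + 2) / Real.Gamma (α * ((k + 2 : ℕ) : ℝ) + β)
      ≤ |z| ^ (k + 2) / k.factorial := by gcongr
    _ = |z| ^ 2 * (|z| ^ k / (k.factorial : ℝ)) * 1 := by ring
    _ ≤ _ := by
        gcongr
        linarith [k.cast_nonneg (α := ℝ)]

theorem continuous_mittagLeffler {α β : ℝ} (hα : 1 ≤ α) (hβ : 0 < β) :
    Continuous (mittagLeffler α β) := by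
  rw [continuous_iff_continuousAt]
  intro z
  have hc : ContinuousOn (mittagLeffler α β) (Metric.ball 0 (|z| + 1)) := by
    refine continuousOn_tsum (u := fun k : ℕ => (|z| + 1) ^ k / Real.Gamma (α * k + β))
      (fun k => by fun_prop) (summable_mittagLeffler hα hβ _) fun k x hx => ?_
    have hG : 0 < Real.Gamma (α * k + β) := Real.Gamma_pos_of_pos (by positivity)
    rw [norm_div, norm_pow, Real.norm_of_nonneg hG.le]
    have : ‖x‖ ≤ |z| + 1 := (mem_ball_zero_iff.1 hx).le
    gcongr
  exact hc.continuousAt (Metric.isOpen_ball.mem_nhds (by simp))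

theorem mittagLeffler_eq_add {α β : ℝ} (hα : 1 ≤ α) (hβ : 0 < β) (z : ℝ) :
    mittagLeffler α β z = 1 / Real.Gamma β + z * mittagLeffler α (α + β) z := by
  unfold mittagLeffler
  rw [(summable_mittagLeffler hα hβ z).tsum_eq_zero_add, ← tsum_mul_left]
  congr 1
  · simp
  · refine tsum_congr fun k => ?_
    rw [pow_succ, show α * ((k + 1 : ℕ) : ℝ) + β = α * k + (α + β) by push_cast; ring]
    ring

theorem mlFun_eq_tsum {α β : ℝ} (lam : ℝ) {t : ℝ} (ht : 0 < t) :
    mlFun α β lam t =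
      ∑' k : ℕ, (-lam) ^ k / Real.Gamma (α * k + β) * t ^ (α * k + β - 1) := by
  unfold mlFun mittagLeffler
  rw [← tsum_mul_left]
  refine tsum_congr fun k => ?_
  rw [mul_pow, ← Real.rpow_natCast (t ^ α), ← Real.rpow_mul ht.le,
    show α * k + β - 1 = (β - 1) + α * k by ring, Real.rpow_add ht]
  ring

/-- The zeroth term of the series is split off. Since I^α raises the second index by α
(`rlIntegral_mlFun`), this is the integrated form of D^α y = -λy. -/
theorem mlFun_eq_add {α β : ℝ} (hα : 1 ≤ α) (hβ : 0 < β) (lam : ℝ) {t : ℝ} (ht : 0 < t) :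
    mlFun α β lam t = t ^ (β - 1) / Real.Gamma β - lam * mlFun α (α + β) lam t := by
  unfold mlFun
  rw [mittagLeffler_eq_add hα hβ, show α + β - 1 = (β - 1) + α by ring, Real.rpow_add ht]
  ring

theorem continuousOn_mlFun {α β : ℝ} (hα : 1 ≤ α) (hβ : 0 < β) (lam : ℝ) :
    ContinuousOn (mlFun α β lam) (Ioi 0) := by
  refine ContinuousOn.mul ?_ ?_
  · exact continuousOn_id.rpow_const fun t ht => Or.inl (ne_of_gt ht)
  · refine (continuous_mittagLeffler hα hβ).comp_continuousOn ?_
    exact continuousOn_const.mul (continuousOn_id.rpow_const fun t ht => Or.inl (ne_of_gt ht))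

theorem continuous_mlFun {α β : ℝ} (hα : 1 ≤ α) (hβ : 1 ≤ β) (lam : ℝ) :
    Continuous (mlFun α β lam) := by
  refine Continuous.mul ?_ ?_
  · exact continuous_id.rpow_const fun t => Or.inr (by linarith)
  · refine (continuous_mittagLeffler hα (by linarith)).comp ?_
    exact continuous_const.mul (continuous_id.rpow_const fun t => Or.inr (by linarith))

theorem exists_abs_mlFun_le {α β : ℝ} (hα : 1 ≤ α) (hβ : 0 < β) (lam T : ℝ) :
    ∃ C : ℝ, ∀ t ∈ Ioo 0 T, |mlFun α β lam t| ≤ C * t ^ (β - 1) := by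
  have hc : ContinuousOn (fun t : ℝ => mittagLeffler α β (-lam * t ^ α)) (Icc 0 T) :=
    ((continuous_mittagLeffler hα hβ).comp (continuous_const.mul
      (continuous_id.rpow_const fun t => Or.inr (by linarith)))).continuousOn
  obtain ⟨C, hC⟩ := isCompact_Icc.exists_bound_of_continuousOn hc
  refine ⟨C, fun t ht => ?_⟩
  have h0 : 0 ≤ t ^ (β - 1) := Real.rpow_nonneg ht.1.le _
  rw [mlFun, abs_mul, abs_of_nonneg h0, mul_comm]
  exact mul_le_mul_of_nonneg_right (hC t (Ioo_subset_Icc_self ht)) h0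

theorem integrableOn_sub_rpow_mul_mlFun {α β γ : ℝ} (hα : 1 ≤ α) (hβ : 0 < β) (hγ : 0 < γ)
    (lam : ℝ) {t : ℝ} (ht : 0 < t) :
    IntegrableOn (fun s => (t - s) ^ (β - 1) * mlFun α γ lam s) (Ioo 0 t) := by
  obtain ⟨C, hC⟩ := exists_abs_mlFun_le hα hγ lam t
  refine Integrable.mono' ((integrableOn_rpow_mul_sub_rpow hβ hγ ht).const_mul C) ?_ ?_
  · refine ContinuousOn.aestronglyMeasurable ?_ measurableSet_Ioo
    refine ContinuousOn.mul ?_ ((continuousOn_mlFun hα hγ lam).mono fun s hs => hs.1)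
    refine ContinuousOn.rpow_const (by fun_prop) fun s hs => Or.inl ?_
    exact (sub_pos.2 hs.2).ne'
  · filter_upwards [ae_restrict_mem measurableSet_Ioo] with s hs
    have h0 : 0 ≤ (t - s) ^ (β - 1) := Real.rpow_nonneg (sub_nonneg.2 hs.2.le) _
    rw [norm_mul, Real.norm_of_nonneg h0, Real.norm_eq_abs]
    calc (t - s) ^ (β - 1) * |mlFun α γ lam s| ≤ (t - s) ^ (β - 1) * (C * s ^ (γ - 1)) := by
          gcongr; exact hC s hs
      _ = _ := by ring

theorem integrableOn_mlFun {α γ : ℝ} (hα : 1 ≤ α) (hγ : 0 < γ) (lam : ℝ) (t : ℝ) :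
    IntegrableOn (mlFun α γ lam) (Ioo 0 t) := by
  rcases le_or_gt t 0 with ht | ht
  · simp [Ioo_eq_empty (not_lt.2 ht)]
  · simpa using integrableOn_sub_rpow_mul_mlFun hα one_pos hγ lam ht

/-- Termwise Beta integrals. The integrals of the absolute values form, up to a constant, the series
at |λ|, whose convergence justifies the exchange. -/
theorem rlIntegral_mlFun {α β γ : ℝ} (hα : 1 ≤ α) (hβ : 0 < β) (hγ : 0 < γ) (lam : ℝ)
    {t : ℝ} (ht : 0 < t) :
    rlIntegral β (mlFun α γ lam) t = mlFun α (β + γ) lam t := by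
  have hk : ∀ k : ℕ, 0 < α * k + γ := fun k => by positivity
  set F : ℕ → ℝ → ℝ := fun k s =>
    (-lam) ^ k / Real.Gamma (α * k + γ) * ((t - s) ^ (β - 1) * s ^ (α * k + γ - 1)) with hF
  have hintg : ∀ k, IntegrableOn (F k) (Ioo 0 t) := fun k =>
    (integrableOn_rpow_mul_sub_rpow hβ (hk k) ht).const_mul _
  have hval : ∀ (x : ℝ) (k : ℕ), x ^ k / Real.Gamma (α * k + γ) * ∫ s in Ioo 0 t,
      (t - s) ^ (β - 1) * s ^ (α * k + γ - 1) =
      Real.Gamma β * (x ^ k / Real.Gamma (α * k + (β + γ)) * t ^ (α * k + (β + γ) - 1)) := by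
    intro x k
    rw [integral_rpow_mul_sub_rpow hβ (hk k) ht]
    have := (Real.Gamma_pos_of_pos (hk k)).ne'
    rw [show β + (α * k + γ) = α * k + (β + γ) by ring]
    field_simp
  have hnorm : ∀ k, ∫ s in Ioo 0 t, ‖F k s‖ =
      Real.Gamma β * (|lam| ^ k / Real.Gamma (α * k + (β + γ)) * t ^ (α * k + (β + γ) - 1)) := by
    intro k
    rw [← hval, ← integral_const_mul]
    refine setIntegral_congr_fun measurableSet_Ioo fun s hs => ?_
    have h0 : 0 ≤ (t - s) ^ (β - 1) := Real.rpow_nonneg (sub_nonneg.2 hs.2.le) _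
    have h1 : 0 ≤ s ^ (α * k + γ - 1) := Real.rpow_nonneg hs.1.le _
    simp only [hF]
    rw [norm_mul, norm_div, norm_pow, Real.norm_of_nonneg (mul_nonneg h0 h1),
      Real.norm_of_nonneg (Real.Gamma_pos_of_pos (hk k)).le, norm_neg, Real.norm_eq_abs]
  have hsum : Summable fun k => ∫ s in Ioo 0 t, ‖F k s‖ := by
    simp_rw [hnorm]
    refine Summable.mul_left _ ?_
    have := (summable_mittagLeffler hα (add_pos hβ hγ) (|lam| * t ^ α)).mul_left (t ^ (β + γ - 1))
    refine this.congr fun k => ?_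
    rw [mul_pow, ← Real.rpow_natCast (t ^ α), ← Real.rpow_mul ht.le,
      show α * k + (β + γ) - 1 = (β + γ - 1) + α * k by ring, Real.rpow_add ht]
    ring
  have hmain := (hasSum_integral_of_summable_integral_norm hintg hsum).tsum_eq
  have hΓ := (Real.Gamma_pos_of_pos hβ).ne'
  have hL : ∫ s in Ioo 0 t, (t - s) ^ (β - 1) • mlFun α γ lam s =
      ∫ s in Ioo 0 t, ∑' k, F k s := by
    refine setIntegral_congr_fun measurableSet_Ioo fun s hs => ?_
    simp only [hF, smul_eq_mul]
    rw [mlFun_eq_tsum lam hs.1, ← tsum_mul_left]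
    exact tsum_congr fun k => by ring
  rw [rlIntegral, hL, ← hmain, mlFun_eq_tsum lam ht, smul_eq_mul, ← tsum_mul_left]
  refine tsum_congr fun k => ?_
  simp only [hF]
  rw [integral_const_mul, hval]
  field_simp

theorem rlIntegral_one {F : Type*} [NormedAddCommGroup F] [NormedSpace ℝ F] (f : ℝ → F) (t : ℝ) :
    rlIntegral 1 f t = ∫ s in Ioo 0 t, f s := by
  simp [rlIntegral]

theorem intervalIntegral_mlFun {α γ : ℝ} (hα : 1 ≤ α) (hγ : 0 < γ) (lam : ℝ) {t : ℝ}
    (ht : 0 < t) : ∫ s in (0:ℝ)..t, mlFun α γ lam s = mlFun α (γ + 1) lam t := by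
  rw [intervalIntegral.integral_of_le ht.le, integral_Ioc_eq_integral_Ioo, ← rlIntegral_one,
    rlIntegral_mlFun hα one_pos hγ lam ht, add_comm]

/-- `E_{α,1}(-λ t^α) = 1 - λ ∫₀ᵗ s^{α-1} E_{α,α}(-λ s^α) ds`. -/
theorem mlFun_one_eq {α : ℝ} (hα : 1 ≤ α) (lam : ℝ) {t : ℝ} (ht : 0 ≤ t) :
    mlFun α 1 lam t = 1 - lam * ∫ s in (0:ℝ)..t, mlFun α α lam s := by
  rcases ht.eq_or_lt with rfl | ht
  · have : (0 : ℝ) ^ α = 0 := Real.zero_rpow (by linarith)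
    rw [mlFun, mittagLeffler_eq_add hα one_pos, this]
    simp
  · rw [mlFun_eq_add hα one_pos lam ht, intervalIntegral_mlFun hα (by linarith) lam ht]
    simp

/-- Homogeneity, from λt^α = (λ^{1/α}t)^α. All dependence on the eigenvalue in the estimates comes
from here. -/
theorem mlFun_scale {α β lam t : ℝ} (hα : 0 < α) (hlam : 0 < lam) (ht : 0 < t) :
    mlFun α β lam t = lam ^ (-(β - 1) / α) * mlFun α β 1 (lam ^ (1 / α) * t) := by
  unfold mlFun
  have h0 : 0 ≤ lam ^ (1 / α) := Real.rpow_nonneg hlam.le _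
  rw [Real.mul_rpow h0 ht.le, Real.mul_rpow h0 ht.le, ← Real.rpow_mul hlam.le,
    ← Real.rpow_mul hlam.le, one_div_mul_cancel hα.ne', Real.rpow_one, ← mul_assoc, ← mul_assoc,
    ← Real.rpow_add hlam]
  rw [show -(β - 1) / α + 1 / α * (β - 1) = 0 by ring, Real.rpow_zero]
  ring_nf

end RLWave
end

noncomputable section

namespace RLWave

/-! ### Convolution with exponentials -/

/-- `∫₀ᵗ e^{-r(t-s)} f(s) ds`. -/
def expConv (r : ℝ) (f : ℝ → ℝ) (t : ℝ) : ℝ := ∫ s in (0:ℝ)..t, Real.exp (-(r * (t - s))) * f s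

theorem continuous_expConv_param {X : Type*} [TopologicalSpace X] {F : X → ℝ → ℝ} {ρ : X → ℝ}
    (hF : Continuous (Function.uncurry F)) (hρ : Continuous ρ) :
    Continuous fun p : X × ℝ => expConv (ρ p.1) (F p.1) p.2 := by
  unfold expConv
  refine intervalIntegral.continuous_parametric_intervalIntegral_of_continuous
    (f := fun p : X × ℝ => fun s => Real.exp (-(ρ p.1 * (p.2 - s))) * F p.1 s) ?_ continuous_snd
  have h1 : Continuous fun q : (X × ℝ) × ℝ => F q.1.1 q.2 :=
    hF.comp (by fun_prop : Continuous fun q : (X × ℝ) × ℝ => (q.1.1, q.2))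
  have h2 : Continuous fun q : (X × ℝ) × ℝ => ρ q.1.1 := hρ.comp (by fun_prop)
  simp only [Function.uncurry_def]
  fun_prop

theorem continuous_expConv_uncurry {f : ℝ → ℝ} (hf : Continuous f) :
    Continuous fun p : ℝ × ℝ => expConv p.1 f p.2 :=
  continuous_expConv_param (F := fun _ => f) (ρ := id) (by fun_prop) continuous_id

theorem continuous_expConv {f : ℝ → ℝ} (hf : Continuous f) (r : ℝ) : Continuous (expConv r f) :=
  (continuous_expConv_uncurry hf).comp (by fun_prop : Continuous fun t : ℝ => (r, t))

theorem expConv_eq (r : ℝ) (f : ℝ → ℝ) (t : ℝ) :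
    expConv r f t = Real.exp (-(r * t)) * ∫ s in (0:ℝ)..t, Real.exp (r * s) * f s := by
  rw [expConv, ← intervalIntegral.integral_const_mul]
  refine intervalIntegral.integral_congr fun s _ => ?_
  rw [← mul_assoc, ← Real.exp_add]
  ring_nf

theorem hasDerivAt_expConv {f : ℝ → ℝ} (hf : Continuous f) (r t : ℝ) :
    HasDerivAt (expConv r f) (f t - r * expConv r f t) t := by
  have h1 : HasDerivAt (fun t => ∫ s in (0:ℝ)..t, Real.exp (r * s) * f s)
      (Real.exp (r * t) * f t) t :=
    ((by fun_prop : Continuous fun s => Real.exp (r * s) * f s).integral_hasStrictDerivAt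
      0 t).hasDerivAt
  have h2 : HasDerivAt (fun t => Real.exp (-(r * t))) (Real.exp (-(r * t)) * -(r * 1)) t :=
    ((hasDerivAt_id t).const_mul r).neg.exp
  have h3 := h2.mul h1
  have h4 : expConv r f = (fun t => Real.exp (-(r * t))) *
      fun t => ∫ s in (0:ℝ)..t, Real.exp (r * s) * f s := by
    ext t; exact expConv_eq r f t
  rw [h4]
  refine h3.congr_deriv ?_
  simp only [Pi.mul_apply]
  have : Real.exp (-(r * t)) * Real.exp (r * t) = 1 := by rw [← Real.exp_add]; simp
  linear_combination (f t) * this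

@[simp] theorem expConv_zero_right (r : ℝ) (f : ℝ → ℝ) : expConv r f 0 = 0 := by simp [expConv]

theorem expConv_add {f g : ℝ → ℝ} (hf : Continuous f) (hg : Continuous g) (r t : ℝ) :
    expConv r (fun s => f s + g s) t = expConv r f t + expConv r g t := by
  unfold expConv
  rw [← intervalIntegral.integral_add (Continuous.intervalIntegrable (by fun_prop) _ _)
    (Continuous.intervalIntegrable (by fun_prop) _ _)]
  simp only [mul_add]

theorem expConv_const_mul (c : ℝ) (f : ℝ → ℝ) (r t : ℝ) :
    expConv r (fun s => c * f s) t = c * expConv r f t := by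
  unfold expConv
  rw [← intervalIntegral.integral_const_mul]
  congr 1; ext s; ring

theorem expConv_sub {f g : ℝ → ℝ} (hf : Continuous f) (hg : Continuous g) (r t : ℝ) :
    expConv r (fun s => f s - g s) t = expConv r f t - expConv r g t := by
  have h := expConv_add hf (g := fun s => -1 * g s) (by fun_prop) r t
  rw [expConv_const_mul] at h
  have h2 : (fun s => f s - g s) = fun s => f s + -1 * g s := by ext s; ring
  rw [h2, h]; ring

/-- Integration by parts. -/
theorem expConv_deriv {f f' : ℝ → ℝ} (hf' : Continuous f') {t : ℝ} (ht : 0 ≤ t) (r : ℝ)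
    (hd : ∀ s ∈ Icc 0 t, f s = f 0 + ∫ x in (0:ℝ)..s, f' x) :
    expConv r f' t = f t - f 0 * Real.exp (-(r * t)) - r * expConv r f t := by
  -- f is a primitive of f' on [0,t] only; F extends it to a function differentiable on the whole
  -- line.
  set F : ℝ → ℝ := fun s => f 0 + ∫ x in (0:ℝ)..s, f' x with hF
  have hFd : ∀ s, HasDerivAt F (f' s) s := fun s => by
    refine HasDerivAt.const_add _ ?_
    exact (hf'.integral_hasStrictDerivAt 0 s).hasDerivAt
  have hFc : Continuous F := continuous_iff_continuousAt.2 fun s => (hFd s).continuousAt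
  have h1 : expConv r f t = expConv r F t := by
    unfold expConv
    refine intervalIntegral.integral_congr fun s hs => ?_
    rw [uIcc_of_le ht] at hs
    simp only [hF, ← hd s hs]
  rw [h1, hd t ⟨ht, le_rfl⟩]
  have hE : ∀ s, HasDerivAt (fun s => Real.exp (-(r * (t - s))))
      (Real.exp (-(r * (t - s))) * r) s := fun s => by
    exact ((((hasDerivAt_id s).const_sub t).const_mul r).neg.exp).congr_deriv (by simp)
  have h2 := intervalIntegral.integral_mul_deriv_eq_deriv_mul (a := 0) (b := t)
    (u := fun s => Real.exp (-(r * (t - s)))) (u' := fun s => Real.exp (-(r * (t - s))) * r)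
    (v := F) (v' := f') (fun s _ => hE s) (fun s _ => hFd s)
    (Continuous.intervalIntegrable (by fun_prop) _ _) (hf'.intervalIntegrable _ _)
  have h3 : ∫ x in (0:ℝ)..t, Real.exp (-(r * (t - x))) * r * F x = r * expConv r F t := by
    rw [expConv, ← intervalIntegral.integral_const_mul]
    congr 1; ext s; ring
  rw [expConv, h2, h3]
  simp [hF]
  ring

/-- The resolvent identity for (d/dt + p)⁻¹ and (d/dt + r)⁻¹ with zero initial value: integrate w' =
f - rw by parts against the exponential of rate p. -/
theorem expConv_resolvent {f : ℝ → ℝ} (hf : Continuous f) (p r : ℝ) {t : ℝ} (ht : 0 ≤ t) :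
    expConv p f t = expConv r f t + (r - p) * expConv p (expConv r f) t := by
  have hc := continuous_expConv hf r
  have h := expConv_deriv (f := expConv r f) (f' := fun t => f t - r * expConv r f t)
    (by fun_prop) ht p (fun s _ => by
      rw [intervalIntegral.integral_eq_sub_of_hasDerivAt
        (fun x _ => hasDerivAt_expConv hf r x) (Continuous.intervalIntegrable (by fun_prop) _ _)]
      simp)
  rw [expConv_sub hf (by fun_prop), expConv_const_mul] at h
  simp only [expConv_zero_right] at h
  linarith

/-- Multiply w' + rw = f by w and integrate, with w(0) = 0. -/
theorem expConv_energy {f : ℝ → ℝ} (hf : Continuous f) (r X : ℝ) :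
    ∫ t in (0:ℝ)..X, f t * expConv r f t =
      expConv r f X ^ 2 / 2 + r * ∫ t in (0:ℝ)..X, expConv r f t ^ 2 := by
  have hc := continuous_expConv hf r
  have h1 : ∫ t in (0:ℝ)..X, expConv r f t * (f t - r * expConv r f t) =
      expConv r f X ^ 2 / 2 - expConv r f 0 ^ 2 / 2 := by
    refine intervalIntegral.integral_eq_sub_of_hasDerivAt (f := fun t => expConv r f t ^ 2 / 2)
      (fun t _ => ?_) (Continuous.intervalIntegrable (by fun_prop) _ _)
    refine (((hasDerivAt_expConv hf r t).pow 2).div_const 2).congr_deriv ?_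
    push_cast
    ring
  have h2 : ∫ t in (0:ℝ)..X, expConv r f t * (f t - r * expConv r f t) =
      (∫ t in (0:ℝ)..X, f t * expConv r f t) - r * ∫ t in (0:ℝ)..X, expConv r f t ^ 2 := by
    rw [← intervalIntegral.integral_const_mul, ← intervalIntegral.integral_sub
      (Continuous.intervalIntegrable (by fun_prop) _ _)
      (Continuous.intervalIntegrable (by fun_prop) _ _)]
    congr 1; ext t; ring
  simp only [expConv_zero_right] at h1
  linarith

/-- Young's inequality for a kernel of mass 1/r, obtained by expanding ∫(f - rw)² ≥ 0 and inserting
the energy identity for ∫ f w. -/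
theorem integral_sq_expConv_le {f : ℝ → ℝ} (hf : Continuous f) {r X : ℝ} (hr : 0 < r)
    (hX : 0 ≤ X) :
    ∫ t in (0:ℝ)..X, expConv r f t ^ 2 ≤ 1 / r ^ 2 * ∫ t in (0:ℝ)..X, f t ^ 2 := by
  have hc := continuous_expConv hf r
  have h1 := expConv_energy hf r X
  have h2 : 0 ≤ ∫ t in (0:ℝ)..X, (f t - r * expConv r f t) ^ 2 :=
    intervalIntegral.integral_nonneg hX fun t _ => sq_nonneg _
  have h3 : ∫ t in (0:ℝ)..X, (f t - r * expConv r f t) ^ 2 =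
      (∫ t in (0:ℝ)..X, f t ^ 2) - 2 * r * (∫ t in (0:ℝ)..X, f t * expConv r f t) +
        r ^ 2 * ∫ t in (0:ℝ)..X, expConv r f t ^ 2 := by
    rw [← intervalIntegral.integral_const_mul, ← intervalIntegral.integral_const_mul,
      ← intervalIntegral.integral_sub (Continuous.intervalIntegrable (by fun_prop) _ _)
      (Continuous.intervalIntegrable (by fun_prop) _ _), ← intervalIntegral.integral_add
      (Continuous.intervalIntegrable (by fun_prop) _ _)
      (Continuous.intervalIntegrable (by fun_prop) _ _)]
    congr 1; ext t; ring
  rw [h3, h1] at h2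
  rw [one_div, ← div_eq_inv_mul, le_div_iff₀ (by positivity)]
  nlinarith [mul_nonneg hr.le (sq_nonneg (expConv r f X))]

/-- The kernel has mass at most t and at most 1/r. The denominator 1 + r retains both bounds, so the
product with r^{-β} is integrable at 0 and at ∞ for 0 < β < 1. -/
theorem abs_expConv_le {f : ℝ → ℝ} (hf : Continuous f) {r X M t : ℝ} (hr : 0 < r)
    (hM : ∀ s ∈ Icc 0 X, |f s| ≤ M) (ht : t ∈ Icc 0 X) :
    |expConv r f t| ≤ M * (X + 1) / (1 + r) := by
  have hM0 : 0 ≤ M := (abs_nonneg _).trans (hM t ht)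
  have h1 : |expConv r f t| ≤ ∫ s in (0:ℝ)..t, Real.exp (-(r * (t - s))) * M := by
    refine (intervalIntegral.abs_integral_le_integral_abs ht.1).trans ?_
    refine intervalIntegral.integral_mono_on ht.1 (Continuous.intervalIntegrable (by fun_prop) _ _)
      (Continuous.intervalIntegrable (by fun_prop) _ _) fun s hs => ?_
    rw [abs_mul, abs_of_pos (Real.exp_pos _)]
    gcongr
    exact hM s ⟨hs.1, hs.2.trans ht.2⟩
  have h2 : ∫ s in (0:ℝ)..t, Real.exp (-(r * (t - s))) * M ≤ ∫ s in (0:ℝ)..t, M := by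
    refine intervalIntegral.integral_mono_on ht.1 (Continuous.intervalIntegrable (by fun_prop) _ _)
      (Continuous.intervalIntegrable (by fun_prop) _ _) fun s hs => ?_
    have : Real.exp (-(r * (t - s))) ≤ 1 :=
      Real.exp_le_one_iff.2 (neg_nonpos.2 (mul_nonneg hr.le (sub_nonneg.2 hs.2)))
    nlinarith
  have h3 : r * ∫ s in (0:ℝ)..t, Real.exp (-(r * (t - s))) * M ≤ M := by
    rw [← intervalIntegral.integral_const_mul,
      intervalIntegral.integral_eq_sub_of_hasDerivAt (f := fun s => Real.exp (-(r * (t - s))) * M)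
      (fun s _ => ?_) (Continuous.intervalIntegrable (by fun_prop) _ _)]
    · simp only [sub_self, mul_zero, neg_zero, Real.exp_zero, one_mul]
      have : 0 ≤ Real.exp (-(r * (t - 0))) * M := by positivity
      linarith
    · refine ((((((hasDerivAt_id s).const_sub t).const_mul r).neg).exp).mul_const M).congr_deriv ?_
      simp only [Pi.neg_apply, id]
      ring
  rw [intervalIntegral.integral_const, sub_zero, smul_eq_mul] at h2
  have h4 : t * M ≤ X * M := mul_le_mul_of_nonneg_right ht.2 hM0
  rw [le_div_iff₀ (by linarith)]
  nlinarith

/-! ### Square integrability on the half line -/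

/-- The squared `L²(0,∞)` norm. -/
def sqNorm (f : ℝ → ℝ) : ℝ≥0∞ := ∫⁻ t in Ioi (0:ℝ), ‖f t‖ₑ ^ 2

theorem memLp_two_of_sqNorm_lt_top {f : ℝ → ℝ}
    (hf : AEStronglyMeasurable f (volume.restrict (Ioi 0))) (h : sqNorm f < ⊤) :
    MemLp f 2 (volume.restrict (Ioi 0)) := by
  refine ⟨hf, ?_⟩
  rw [eLpNorm_lt_top_iff_lintegral_rpow_enorm_lt_top (by simp) (by simp)]
  simpa [sqNorm] using h

theorem sqNorm_lt_top {f : ℝ → ℝ} (hf : MemLp f 2 (volume.restrict (Ioi 0))) :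
    sqNorm f < ⊤ := by
  have := hf.2
  rw [eLpNorm_lt_top_iff_lintegral_rpow_enorm_lt_top (by simp) (by simp)] at this
  simpa [sqNorm] using this

theorem lintegral_Ioi_eq_iSup (F : ℝ → ℝ≥0∞) :
    ∫⁻ t in Ioi (0:ℝ), F t = ⨆ n : ℕ, ∫⁻ t in Ioo (0:ℝ) n, F t := by
  have h : Ioi (0:ℝ) = ⋃ n : ℕ, Ioo (0:ℝ) n := by
    ext t
    simp only [mem_Ioi, mem_iUnion, mem_Ioo]
    exact ⟨fun ht => (exists_nat_gt t).imp fun n hn => ⟨ht, hn⟩, fun ⟨n, hn⟩ => hn.1⟩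
  rw [h, setLIntegral_iUnion_of_directed]
  refine Monotone.directed_le fun m n hmn => Ioo_subset_Ioo_right (by exact_mod_cast hmn)

theorem lintegral_Ioo_enorm_sq {f : ℝ → ℝ} (hf : Continuous f) {X : ℝ} (hX : 0 ≤ X) :
    ∫⁻ t in Ioo (0:ℝ) X, ‖f t‖ₑ ^ 2 = ENNReal.ofReal (∫ t in (0:ℝ)..X, f t ^ 2) := by
  rw [intervalIntegral.integral_of_le hX, integral_Ioc_eq_integral_Ioo,
    ofReal_integral_eq_lintegral_ofReal]
  · refine lintegral_congr fun t => ?_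
    rw [← sq_abs, ENNReal.ofReal_pow (abs_nonneg _), ← Real.norm_eq_abs, ofReal_norm]
  · exact ((by fun_prop : Continuous fun t => f t ^ 2).integrableOn_Icc).mono_set Ioo_subset_Icc_self
  · exact ae_of_all _ fun t => sq_nonneg _

theorem sqNorm_add_le (f g : ℝ → ℝ)
    (hf : AEMeasurable f (volume.restrict (Ioi 0))) :
    sqNorm (fun t => f t + g t) ≤ 2 * sqNorm f + 2 * sqNorm g := by
  unfold sqNorm
  rw [← lintegral_const_mul' _ _ (by simp), ← lintegral_const_mul' _ _ (by simp),
    ← lintegral_add_left' (by fun_prop)]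
  refine lintegral_mono fun t => ?_
  calc ‖f t + g t‖ₑ ^ 2 ≤ (‖f t‖ₑ + ‖g t‖ₑ) ^ 2 := by gcongr; exact enorm_add_le _ _
    _ ≤ 2 * (‖f t‖ₑ ^ 2 + ‖g t‖ₑ ^ 2) := by
        have := ENNReal.rpow_add_le_mul_rpow_add_rpow ‖f t‖ₑ ‖g t‖ₑ (p := 2) (by norm_num)
        norm_num at this
        exact_mod_cast this
    _ = _ := by ring

theorem sqNorm_const_mul (c : ℝ) (f : ℝ → ℝ) :
    sqNorm (fun t => c * f t) = ENNReal.ofReal (c ^ 2) * sqNorm f := by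
  unfold sqNorm
  rw [← lintegral_const_mul' _ _ (by simp)]
  refine lintegral_congr fun t => ?_
  rw [enorm_mul, mul_pow]
  congr 1
  rw [← sq_abs, ENNReal.ofReal_pow (abs_nonneg _), ← Real.norm_eq_abs, ofReal_norm]

theorem sqNorm_expConv_le {f : ℝ → ℝ} (hf : Continuous f) {r : ℝ} (hr : 0 < r) :
    sqNorm (expConv r f) ≤ ENNReal.ofReal (1 / r ^ 2) * sqNorm f := by
  unfold sqNorm
  rw [lintegral_Ioi_eq_iSup, iSup_le_iff]
  intro n
  rw [lintegral_Ioo_enorm_sq (continuous_expConv hf r) n.cast_nonneg]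
  refine (ENNReal.ofReal_le_ofReal (integral_sq_expConv_le hf hr n.cast_nonneg)).trans ?_
  rw [ENNReal.ofReal_mul (by positivity), ← lintegral_Ioo_enorm_sq hf n.cast_nonneg]
  gcongr
  exact Ioo_subset_Ioi_self

theorem memLp_expConv {f : ℝ → ℝ} (hf : Continuous f) {r : ℝ} (hr : 0 < r)
    (h : MemLp f 2 (volume.restrict (Ioi 0))) :
    MemLp (expConv r f) 2 (volume.restrict (Ioi 0)) :=
  memLp_two_of_sqNorm_lt_top (continuous_expConv hf r).aestronglyMeasurable
    ((sqNorm_expConv_le hf hr).trans_lt (ENNReal.mul_lt_top ENNReal.ofReal_lt_top (sqNorm_lt_top h)))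

/-- Superpositions `∫_A r^{-β} H(r, ·) dr` are square integrable under a weighted bound. -/
theorem memLp_superposition {β : ℝ} {A : Set ℝ} {H : ℝ → ℝ → ℝ}
    (hA : MeasurableSet A) (hA0 : A ⊆ Ioi 0)
    (hH : Continuous (Function.uncurry H)) (q : ℝ)
    (h1 : ∫⁻ r in A, ENNReal.ofReal (r ^ (-(2 * β) - q)) < ⊤)
    (h2 : ∫⁻ r in A, ENNReal.ofReal (r ^ q) * sqNorm (H r) < ⊤) :
    MemLp (fun t => ∫ r in A, r ^ (-β) * H r t) 2 (volume.restrict (Ioi 0)) := by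
  have hmeas : Measurable fun p : ℝ × ℝ => p.2 ^ (-β) * H p.2 p.1 := by
    have h := (hH.comp (continuous_swap (X := ℝ) (Y := ℝ))).measurable
    have h' : Measurable fun p : ℝ × ℝ => p.2 ^ (-β) := measurable_snd.pow_const _
    exact h'.mul h
  refine memLp_two_of_sqNorm_lt_top ?_ ?_
  · exact (hmeas.stronglyMeasurable.integral_prod_right (ν := volume.restrict A)).aestronglyMeasurable
  · have hHm : Measurable fun p : ℝ × ℝ => ‖H p.2 p.1‖ₑ ^ 2 :=
      ((hH.comp (continuous_swap (X := ℝ) (Y := ℝ))).measurable.enorm).pow_const _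
    have hCS : ∀ t : ℝ, ‖∫ r in A, r ^ (-β) * H r t‖ₑ ^ 2 ≤
        (∫⁻ r in A, ENNReal.ofReal (r ^ (-(2 * β) - q))) *
          ∫⁻ r in A, ENNReal.ofReal (r ^ q) * ‖H r t‖ₑ ^ 2 := by
      intro t
      have hHt : Measurable fun r => H r t :=
        (hH.comp (by fun_prop : Continuous fun r : ℝ => (r, t))).measurable
      -- Cauchy–Schwarz in r with r^{-β} = r^{-β-q/2} r^{q/2}; Tonelli then moves the time integral
      -- inside. The parameter q is chosen separately for small and for large r.
      have e1 : ‖∫ r in A, r ^ (-β) * H r t‖ₑ ≤ ∫⁻ r in A,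
          ENNReal.ofReal (r ^ (-β - q / 2)) * (ENNReal.ofReal (r ^ (q / 2)) * ‖H r t‖ₑ) := by
        refine (enorm_integral_le_lintegral_enorm _).trans (le_of_eq ?_)
        refine setLIntegral_congr_fun hA fun r hr => ?_
        have hr0 : 0 < r := hA0 hr
        rw [enorm_mul, ← mul_assoc, ← ENNReal.ofReal_mul (by positivity), ← Real.rpow_add hr0,
          Real.enorm_of_nonneg (by positivity)]
        ring_nf
      have e2 := ENNReal.lintegral_mul_le_Lp_mul_Lq (volume.restrict A)
        (p := 2) (q := 2) (by constructor <;> norm_num)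
        (f := fun r => ENNReal.ofReal (r ^ (-β - q / 2)))
        (g := fun r => ENNReal.ofReal (r ^ (q / 2)) * ‖H r t‖ₑ)
        (by fun_prop) (by fun_prop)
      have e3 := e1.trans e2
      have e4 : ‖∫ r in A, r ^ (-β) * H r t‖ₑ ^ (2:ℝ) ≤ _ := ENNReal.rpow_le_rpow e3 (by norm_num)
      rw [ENNReal.mul_rpow_of_nonneg _ _ (by norm_num), ← ENNReal.rpow_mul, ← ENNReal.rpow_mul] at e4
      norm_num at e4
      refine (by exact_mod_cast e4 : _ ≤ _).trans (le_of_eq ?_)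
      congr 1
      · refine setLIntegral_congr_fun hA fun r hr => ?_
        have hr0 : 0 < r := hA0 hr
        rw [← ENNReal.ofReal_pow (by positivity), ← Real.rpow_natCast, ← Real.rpow_mul hr0.le]
        congr 2; push_cast; ring
      · refine setLIntegral_congr_fun hA fun r hr => ?_
        have hr0 : 0 < r := hA0 hr
        rw [mul_pow, ← ENNReal.ofReal_pow (by positivity), ← Real.rpow_natCast,
          ← Real.rpow_mul hr0.le]
        congr 3; push_cast; ring
    calc sqNorm (fun t => ∫ r in A, r ^ (-β) * H r t)
        ≤ ∫⁻ t in Ioi (0:ℝ), (∫⁻ r in A, ENNReal.ofReal (r ^ (-(2 * β) - q))) *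
          ∫⁻ r in A, ENNReal.ofReal (r ^ q) * ‖H r t‖ₑ ^ 2 := lintegral_mono fun t => hCS t
      _ = (∫⁻ r in A, ENNReal.ofReal (r ^ (-(2 * β) - q))) *
          ∫⁻ t in Ioi (0:ℝ), ∫⁻ r in A, ENNReal.ofReal (r ^ q) * ‖H r t‖ₑ ^ 2 :=
          lintegral_const_mul' _ _ h1.ne
      _ = (∫⁻ r in A, ENNReal.ofReal (r ^ (-(2 * β) - q))) *
          ∫⁻ r in A, ENNReal.ofReal (r ^ q) * sqNorm (H r) := by
          congr 1
          rw [lintegral_lintegral_swap]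
          · refine lintegral_congr fun r => ?_
            exact lintegral_const_mul' _ _ ENNReal.ofReal_ne_top
          · refine Measurable.aemeasurable ?_
            exact ((measurable_snd.pow_const q).ennreal_ofReal).mul hHm
      _ < ⊤ := ENNReal.mul_lt_top h1 h2

end RLWave
end

noncomputable section

namespace RLWave

/-! ### The diffusive representation of the Riemann–Liouville integral -/

theorem integrableOn_rpow_Ioc_zero_one {a : ℝ} (ha : -1 < a) :
    IntegrableOn (fun r : ℝ => r ^ a) (Ioc 0 1) := by
  have := intervalIntegral.intervalIntegrable_rpow' (a := 0) (b := 1) ha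
  rwa [intervalIntegrable_iff_integrableOn_Ioc_of_le zero_le_one] at this

theorem integrableOn_rpow_div_one_add {β : ℝ} (h0 : 0 < β) (h1 : β < 1) :
    IntegrableOn (fun r : ℝ => r ^ (-β) * (1 / (1 + r))) (Ioi 0) := by
  rw [← Ioc_union_Ioi_eq_Ioi zero_le_one]
  have hm : ∀ A : Set ℝ, AEStronglyMeasurable (fun r : ℝ => r ^ (-β) * (1 / (1 + r)))
      (volume.restrict A) := fun A => Measurable.aestronglyMeasurable (by fun_prop)
  refine IntegrableOn.union ?_ ?_
  · refine Integrable.mono' (integrableOn_rpow_Ioc_zero_one (a := -β) (by linarith)) (hm _) ?_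
    filter_upwards [ae_restrict_mem measurableSet_Ioc] with r hr
    have : 0 ≤ r ^ (-β) := Real.rpow_nonneg hr.1.le _
    have h2 : 1 / (1 + r) ≤ 1 := by
      rw [div_le_one (by linarith [hr.1])]; linarith [hr.1]
    have h3 : 0 ≤ 1 / (1 + r) := by have := hr.1; positivity
    rw [Real.norm_of_nonneg (mul_nonneg this h3)]
    nlinarith
  · refine Integrable.mono' (integrableOn_Ioi_rpow_of_lt (a := -β - 1) (by linarith) one_pos)
      (hm _) ?_
    filter_upwards [ae_restrict_mem measurableSet_Ioi] with r hr
    have hr0 : 0 < r := lt_trans one_pos hr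
    rw [Real.norm_of_nonneg (by positivity), Real.rpow_sub_one hr0.ne',
      div_eq_mul_inv (r ^ (-β)) r, one_div]
    gcongr
    linarith

theorem integrableOn_rpow_mul_of_le {β C : ℝ} (h0 : 0 < β) (h1 : β < 1) {G : ℝ → ℝ}
    (hG : Continuous G) (hC : ∀ r, 0 < r → |G r| ≤ C / (1 + r)) :
    IntegrableOn (fun r : ℝ => r ^ (-β) * G r) (Ioi 0) := by
  refine Integrable.mono' ((integrableOn_rpow_div_one_add h0 h1).const_mul C)
    (Measurable.aestronglyMeasurable (by fun_prop)) ?_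
  filter_upwards [ae_restrict_mem measurableSet_Ioi] with r hr
  have hr0 : 0 ≤ r ^ (-β) := Real.rpow_nonneg (le_of_lt hr) _
  rw [norm_mul, Real.norm_of_nonneg hr0, Real.norm_eq_abs]
  calc r ^ (-β) * |G r| ≤ r ^ (-β) * (C / (1 + r)) := by gcongr; exact hC r hr
    _ = _ := by ring

theorem integral_rpow_mul_swap {β C X : ℝ} (h0 : 0 < β) (h1 : β < 1) (hX : 0 ≤ X)
    {G : ℝ → ℝ → ℝ} (hG : Continuous (Function.uncurry G))
    (hC : ∀ r, 0 < r → ∀ s ∈ Icc 0 X, |G r s| ≤ C / (1 + r)) :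
    ∫ s in (0:ℝ)..X, ∫ r in Ioi (0:ℝ), r ^ (-β) * G r s =
      ∫ r in Ioi (0:ℝ), r ^ (-β) * ∫ s in (0:ℝ)..X, G r s := by
  simp_rw [intervalIntegral.integral_of_le hX]
  rw [integral_integral_swap]
  · simp_rw [integral_const_mul]
  · have hdom : Integrable (fun p : ℝ × ℝ => (1:ℝ) * (C * (p.2 ^ (-β) * (1 / (1 + p.2)))))
        ((volume.restrict (Ioc 0 X)).prod (volume.restrict (Ioi 0))) :=
      Integrable.mul_prod (f := fun _ : ℝ => (1:ℝ))
        (g := fun r : ℝ => C * (r ^ (-β) * (1 / (1 + r)))) (by simp)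
        ((integrableOn_rpow_div_one_add h0 h1).const_mul C)
    refine Integrable.mono' hdom ?_ ?_
    · have h := (hG.comp (continuous_swap (X := ℝ) (Y := ℝ))).measurable
      have h' : Measurable fun p : ℝ × ℝ => p.2 ^ (-β) := measurable_snd.pow_const _
      exact (h'.mul h).aestronglyMeasurable
    · rw [Measure.prod_restrict]
      filter_upwards [ae_restrict_mem (measurableSet_Ioc.prod measurableSet_Ioi)] with p hp
      have hr0 : 0 ≤ p.2 ^ (-β) := Real.rpow_nonneg (le_of_lt hp.2) _
      simp only [Function.uncurry_def]
      rw [norm_mul, Real.norm_of_nonneg hr0, Real.norm_eq_abs]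
      calc p.2 ^ (-β) * |G p.2 p.1| ≤ p.2 ^ (-β) * (C / (1 + p.2)) := by
            gcongr; exact hC p.2 hp.2 p.1 ⟨hp.1.1.le, hp.1.2⟩
        _ = _ := by ring

theorem integral_rpow_mul_exp {β a : ℝ} (h1 : β < 1) (ha : 0 < a) :
    ∫ r in Ioi (0:ℝ), r ^ (-β) * Real.exp (-(r * a)) = a ^ (β - 1) * Real.Gamma (1 - β) := by
  have h := Real.integral_rpow_mul_exp_neg_mul_Ioi (a := 1 - β) (r := a) (by linarith) ha
  rw [show (1 - β - 1 : ℝ) = -β by ring] at h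
  simp_rw [mul_comm a] at h
  rw [h, one_div, Real.inv_rpow ha.le, ← Real.rpow_neg ha.le, neg_sub]

theorem integrableOn_rpow_mul_exp {β a : ℝ} (h1 : β < 1) (ha : 0 < a) :
    IntegrableOn (fun r : ℝ => r ^ (-β) * Real.exp (-(r * a))) (Ioi 0) := by
  have := integrableOn_rpow_mul_exp_neg_mul_rpow (p := 1) (s := -β) (b := a) (by linarith)
    one_pos ha
  refine this.congr_fun (fun r _ => ?_) measurableSet_Ioi
  simp only [Real.rpow_one]
  ring_nf

/-- `Γ(1-β)⁻¹ Γ(β)⁻¹`. -/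
def diffusiveConst (β : ℝ) : ℝ := (Real.Gamma (1 - β))⁻¹ * (Real.Gamma β)⁻¹

theorem diffusiveConst_pos {β : ℝ} (h0 : 0 < β) (h1 : β < 1) : 0 < diffusiveConst β :=
  mul_pos (inv_pos.2 (Real.Gamma_pos_of_pos (by linarith)))
    (inv_pos.2 (Real.Gamma_pos_of_pos h0))

theorem rpow_div_Gamma_eq {β t : ℝ} (h1 : β < 1) (ht : 0 < t) :
    t ^ (β - 1) / Real.Gamma β =
      diffusiveConst β * ∫ r in Ioi (0:ℝ), r ^ (-β) * Real.exp (-(r * t)) := by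
  have := (Real.Gamma_pos_of_pos (sub_pos.2 h1)).ne'
  rw [integral_rpow_mul_exp h1 ht, diffusiveConst]
  field_simp

/-- (t-s)^{β-1} is, up to Γ(1-β), the Laplace transform of r^{-β} at t-s; Fubini makes the
fractional integral a superposition of exponential convolutions, each solving a first-order ODE. -/
theorem rlIntegral_eq_diffusive {β : ℝ} (h0 : 0 < β) (h1 : β < 1) {f : ℝ → ℝ}
    (hf : Continuous f) {t : ℝ} (ht : 0 < t) :
    rlIntegral β f t = diffusiveConst β * ∫ r in Ioi (0:ℝ), r ^ (-β) * expConv r f t := by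
  have hG := (Real.Gamma_pos_of_pos (sub_pos.2 h1)).ne'
  have e1 : ∫ s in Ioo 0 t, (t - s) ^ (β - 1) • f s = (Real.Gamma (1 - β))⁻¹ *
      ∫ s in Ioo 0 t, ∫ r in Ioi (0:ℝ), r ^ (-β) * Real.exp (-(r * (t - s))) * f s := by
    rw [← integral_const_mul]
    refine setIntegral_congr_fun measurableSet_Ioo fun s hs => ?_
    have hts : 0 < t - s := sub_pos.2 hs.2
    simp only [smul_eq_mul]
    rw [integral_mul_const, integral_rpow_mul_exp h1 hts]
    field_simp
  have e2 : ∫ s in Ioo 0 t, ∫ r in Ioi (0:ℝ), r ^ (-β) * Real.exp (-(r * (t - s))) * f s =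
      ∫ r in Ioi (0:ℝ), r ^ (-β) * expConv r f t := by
    rw [integral_integral_swap]
    · refine setIntegral_congr_fun measurableSet_Ioi fun r _ => ?_
      simp only [expConv]
      rw [intervalIntegral.integral_of_le ht.le, integral_Ioc_eq_integral_Ioo,
        ← integral_const_mul]
      simp only [mul_assoc]
    · have hm : Measurable fun p : ℝ × ℝ =>
          p.2 ^ (-β) * Real.exp (-(p.2 * (t - p.1))) * f p.1 := by
        have := hf.measurable
        fun_prop
      simp only [Function.uncurry_def]
      rw [integrable_prod_iff hm.aestronglyMeasurable]
      constructor
      · filter_upwards [ae_restrict_mem measurableSet_Ioo] with s hs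
        exact (integrableOn_rpow_mul_exp h1 (sub_pos.2 hs.2)).mul_const _
      · have hI : IntegrableOn (fun s => (t - s) ^ (β - 1) * s ^ ((1:ℝ) - 1)) (Ioo 0 t) :=
          integrableOn_rpow_mul_sub_rpow h0 one_pos ht
        obtain ⟨M, hM⟩ := (isCompact_Icc (a := (0:ℝ)) (b := t)).exists_bound_of_continuousOn
          hf.continuousOn
        refine Integrable.mono' (hI.const_mul (Real.Gamma (1 - β) * M)) ?_ ?_
        · exact (hm.norm.stronglyMeasurable.integral_prod_right
            (ν := volume.restrict (Ioi 0))).aestronglyMeasurable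
        · filter_upwards [ae_restrict_mem measurableSet_Ioo] with s hs
          have hts : 0 < t - s := sub_pos.2 hs.2
          have e3 : ∫ r in Ioi (0:ℝ), ‖r ^ (-β) * Real.exp (-(r * (t - s))) * f s‖ =
              (t - s) ^ (β - 1) * Real.Gamma (1 - β) * |f s| := by
            rw [← integral_rpow_mul_exp h1 hts, ← integral_mul_const]
            refine setIntegral_congr_fun measurableSet_Ioi fun r hr => ?_
            have hr0 : 0 ≤ r ^ (-β) := Real.rpow_nonneg (le_of_lt hr) _
            simp only [norm_mul, Real.norm_eq_abs]
            rw [abs_of_nonneg hr0, abs_of_pos (Real.exp_pos _)]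
          have hG0 : 0 ≤ Real.Gamma (1 - β) := (Real.Gamma_pos_of_pos (sub_pos.2 h1)).le
          rw [e3, Real.norm_of_nonneg (by positivity)]
          have hMs : |f s| ≤ M := hM s (Ioo_subset_Icc_self hs)
          simp only [sub_self, Real.rpow_zero, mul_one]
          calc (t - s) ^ (β - 1) * Real.Gamma (1 - β) * |f s|
              ≤ (t - s) ^ (β - 1) * Real.Gamma (1 - β) * M := by gcongr
            _ = _ := by ring
  rw [rlIntegral, e1, e2, smul_eq_mul, diffusiveConst]
  ring

theorem integrableOn_rpow_mul_expConv {β : ℝ} (h0 : 0 < β) (h1 : β < 1) {f : ℝ → ℝ}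
    (hf : Continuous f) {t : ℝ} (ht : 0 ≤ t) :
    IntegrableOn (fun r : ℝ => r ^ (-β) * expConv r f t) (Ioi 0) := by
  obtain ⟨M, hM⟩ := (isCompact_Icc (a := (0:ℝ)) (b := t)).exists_bound_of_continuousOn
    hf.continuousOn
  exact integrableOn_rpow_mul_of_le h0 h1
    ((continuous_expConv_uncurry hf).comp (by fun_prop : Continuous fun r : ℝ => (r, t)))
    fun r hr => abs_expConv_le hf hr hM ⟨ht, le_rfl⟩

/-- The energy identity for `∫ f · I^β f`, as an inequality. -/
theorem lintegral_rpow_mul_sqNorm_expConv_le {β : ℝ} (h0 : 0 < β) (h1 : β < 1) {f g : ℝ → ℝ}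
    (hf : Continuous f) (hg : ∀ t, 0 < t → g t = rlIntegral β f t) {K : ℝ}
    (hK : ∀ X, 0 ≤ X → ∫ t in (0:ℝ)..X, f t * g t ≤ K) :
    ∫⁻ r in Ioi (0:ℝ), ENNReal.ofReal (r ^ (1 - β)) * sqNorm (expConv r f) ≤
      ENNReal.ofReal (K / diffusiveConst β) := by
  have hcu := continuous_expConv_uncurry hf
  have hc := diffusiveConst_pos h0 h1
  have key : ∀ X : ℝ, 0 ≤ X → ∫⁻ r in Ioi (0:ℝ), ENNReal.ofReal (r ^ (1 - β)) *
      ∫⁻ t in Ioo (0:ℝ) X, ‖expConv r f t‖ₑ ^ 2 ≤ ENNReal.ofReal (K / diffusiveConst β) := by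
    intro X hX
    obtain ⟨M, hM⟩ := (isCompact_Icc (a := (0:ℝ)) (b := X)).exists_bound_of_continuousOn
      hf.continuousOn
    have hM0 : 0 ≤ M := (norm_nonneg _).trans (hM 0 ⟨le_rfl, hX⟩)
    have hGc : Continuous (Function.uncurry fun r t : ℝ => f t * expConv r f t) := by
      simp only [Function.uncurry_def]
      fun_prop
    have hGb : ∀ r, 0 < r → ∀ s ∈ Icc 0 X,
        |f s * expConv r f s| ≤ (M * (M * (X + 1))) / (1 + r) := by
      intro r hr s hs
      rw [abs_mul, mul_div_assoc]
      exact mul_le_mul (hM s hs) (abs_expConv_le hf hr hM hs) (abs_nonneg _) hM0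
    have e1 : ∫ t in (0:ℝ)..X, f t * g t = diffusiveConst β *
        ∫ t in (0:ℝ)..X, ∫ r in Ioi (0:ℝ), r ^ (-β) * (f t * expConv r f t) := by
      rw [← intervalIntegral.integral_const_mul, intervalIntegral.integral_of_le hX,
        intervalIntegral.integral_of_le hX]
      refine setIntegral_congr_fun measurableSet_Ioc fun t ht => ?_
      rw [hg t ht.1, rlIntegral_eq_diffusive h0 h1 hf ht.1]
      simp_rw [mul_left_comm _ (f t)]
      rw [integral_const_mul]
      ring
    rw [integral_rpow_mul_swap h0 h1 hX hGc hGb] at e1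
    have hI : IntegrableOn (fun r => r ^ (-β) * ∫ s in (0:ℝ)..X, f s * expConv r f s) (Ioi 0) := by
      refine integrableOn_rpow_mul_of_le h0 h1 (C := X * (M * (M * (X + 1)))) ?_ ?_
      · exact intervalIntegral.continuous_parametric_intervalIntegral_of_continuous hGc
          continuous_const
      · intro r hr
        have := intervalIntegral.norm_integral_le_of_norm_le_const (a := 0) (b := X)
          (f := fun s => f s * expConv r f s) (C := (M * (M * (X + 1))) / (1 + r)) (fun s hs => by
            rw [uIoc_of_le hX] at hs
            exact hGb r hr s ⟨hs.1.le, hs.2⟩)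
        rw [sub_zero, abs_of_nonneg hX, Real.norm_eq_abs] at this
        calc _ ≤ _ := this
          _ = _ := by ring
    have hW : ∀ r : ℝ, 0 ≤ ∫ t in (0:ℝ)..X, expConv r f t ^ 2 := fun r =>
      intervalIntegral.integral_nonneg hX fun t _ => sq_nonneg _
    -- By the energy identity the two sides differ by r^{-β} w_r(X)²/2, which is dropped.
    have hle : ∀ r ∈ Ioi (0:ℝ), r ^ (1 - β) * ∫ t in (0:ℝ)..X, expConv r f t ^ 2 ≤
        r ^ (-β) * ∫ s in (0:ℝ)..X, f s * expConv r f s := by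
      intro r hr
      have hr : 0 < r := hr
      rw [expConv_energy hf, show 1 - β = -β + 1 by ring, Real.rpow_add_one hr.ne', mul_assoc]
      have : 0 ≤ r ^ (-β) := Real.rpow_nonneg hr.le _
      gcongr
      linarith [sq_nonneg (expConv r f X)]
    have hWc : Continuous fun r => ∫ t in (0:ℝ)..X, expConv r f t ^ 2 := by
      refine intervalIntegral.continuous_parametric_intervalIntegral_of_continuous
        (f := fun r t => expConv r f t ^ 2) ?_ continuous_const
      simp only [Function.uncurry_def]
      fun_prop
    calc ∫⁻ r in Ioi (0:ℝ), ENNReal.ofReal (r ^ (1 - β)) *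
          ∫⁻ t in Ioo (0:ℝ) X, ‖expConv r f t‖ₑ ^ 2
        ≤ ∫⁻ r in Ioi (0:ℝ), ENNReal.ofReal (r ^ (-β) * ∫ s in (0:ℝ)..X, f s * expConv r f s) := by
          refine setLIntegral_mono' measurableSet_Ioi fun r hr => ?_
          have hr' : 0 ≤ r ^ (1 - β) := Real.rpow_nonneg (le_of_lt hr) _
          rw [lintegral_Ioo_enorm_sq (continuous_expConv hf r) hX, ← ENNReal.ofReal_mul hr']
          exact ENNReal.ofReal_le_ofReal (hle r hr)
      _ = ENNReal.ofReal (∫ r in Ioi (0:ℝ), r ^ (-β) * ∫ s in (0:ℝ)..X, f s * expConv r f s) := by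
          rw [ofReal_integral_eq_lintegral_ofReal hI]
          filter_upwards [ae_restrict_mem measurableSet_Ioi] with r hr
          exact (mul_nonneg (Real.rpow_nonneg (le_of_lt hr) _) (hW r)).trans (hle r hr)
      _ ≤ ENNReal.ofReal (K / diffusiveConst β) := by
          refine ENNReal.ofReal_le_ofReal ?_
          rw [le_div_iff₀ hc, mul_comm, ← e1]
          exact hK X hX
  have hmono : ∀ r : ℝ, ENNReal.ofReal (r ^ (1 - β)) * sqNorm (expConv r f) =
      ⨆ n : ℕ, ENNReal.ofReal (r ^ (1 - β)) * ∫⁻ t in Ioo (0:ℝ) n, ‖expConv r f t‖ₑ ^ 2 := by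
    intro r
    rw [sqNorm, lintegral_Ioi_eq_iSup, ENNReal.mul_iSup]
  simp_rw [hmono]
  rw [lintegral_iSup]
  · exact iSup_le fun n => key n n.cast_nonneg
  · intro n
    refine (by fun_prop : Measurable fun r : ℝ => ENNReal.ofReal (r ^ (1 - β))).mul ?_
    have : Measurable fun p : ℝ × ℝ => ‖expConv p.1 f p.2‖ₑ ^ 2 := (hcu.measurable.enorm).pow_const _
    exact this.lintegral_prod_right'
  · intro m n hmn r
    dsimp only
    gcongr

end RLWave
end

noncomputable section

namespace RLWave

/-! ### Square integrability of the relaxation functions -/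

theorem memLp_congr_Ioi {f g : ℝ → ℝ} (hf : MemLp f 2 (volume.restrict (Ioi 0)))
    (h : ∀ t, 0 < t → g t = f t) : MemLp g 2 (volume.restrict (Ioi 0)) := by
  refine hf.ae_eq ?_
  filter_upwards [ae_restrict_mem measurableSet_Ioi] with t ht
  exact (h t ht).symm

theorem sqNorm_exp_le {r : ℝ} (hr : 0 < r) :
    sqNorm (fun t => Real.exp (-(r * t))) ≤ ENNReal.ofReal (1 / r) := by
  have hI : IntegrableOn (fun t : ℝ => Real.exp (-(2 * r) * t)) (Ioi 0) :=
    integrableOn_exp_mul_Ioi (by linarith) 0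
  have h1 : sqNorm (fun t => Real.exp (-(r * t))) =
      ∫⁻ t in Ioi (0:ℝ), ENNReal.ofReal (Real.exp (-(2 * r) * t)) := by
    refine lintegral_congr fun t => ?_
    rw [Real.enorm_of_nonneg (Real.exp_pos _).le, ← ENNReal.ofReal_pow (Real.exp_pos _).le,
      ← Real.exp_nat_mul]
    congr 2; push_cast; ring
  rw [h1, ← ofReal_integral_eq_lintegral_ofReal hI (ae_of_all _ fun t => (Real.exp_pos _).le),
    integral_exp_mul_Ioi (by linarith)]
  refine ENNReal.ofReal_le_ofReal ?_
  simp only [mul_zero, Real.exp_zero]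
  rw [neg_div_neg_eq]
  exact one_div_le_one_div_of_le hr (by linarith)

theorem memLp_exp {r : ℝ} (hr : 0 < r) :
    MemLp (fun t => Real.exp (-(r * t))) 2 (volume.restrict (Ioi 0)) :=
  memLp_two_of_sqNorm_lt_top (by fun_prop : Continuous fun t : ℝ =>
    Real.exp (-(r * t))).aestronglyMeasurable ((sqNorm_exp_le hr).trans_lt ENNReal.ofReal_lt_top)

theorem sqNorm_sub_le (f g : ℝ → ℝ) (hf : AEMeasurable f (volume.restrict (Ioi 0))) :
    sqNorm (fun t => f t - g t) ≤ 2 * sqNorm f + 2 * sqNorm g := by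
  have h := sqNorm_add_le f (fun t => -1 * g t) hf
  rw [sqNorm_const_mul] at h
  simpa [sub_eq_add_neg] using h

theorem lintegral_rpow_lt_top {A : Set ℝ} {a : ℝ} (h : IntegrableOn (fun r : ℝ => r ^ a) A) :
    ∫⁻ r in A, ENNReal.ofReal (r ^ a) < ⊤ :=
  (lintegral_mono fun r => by
    rw [← ofReal_norm]; exact ENNReal.ofReal_le_ofReal (le_abs_self _)).trans_lt h.2

/-- Low frequency part of a superposition. -/
theorem memLp_superposition_low {β : ℝ} (h1 : β < 1) {H : ℝ → ℝ → ℝ}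
    (hH : Continuous (Function.uncurry H)) {S : ℝ → ℝ≥0∞} {D : ℝ≥0∞} (hD : D < ⊤)
    (hS : ∫⁻ r in Ioi (0:ℝ), ENNReal.ofReal (r ^ (1 - β)) * S r < ⊤)
    (hHS : ∀ r ∈ Ioc (0:ℝ) 1, sqNorm (H r) ≤ D + 2 * (ENNReal.ofReal (r ^ 2) * S r)) :
    MemLp (fun t => ∫ r in Ioc (0:ℝ) 1, r ^ (-β) * H r t) 2 (volume.restrict (Ioi 0)) := by
  have hb : ∫⁻ r in Ioc (0:ℝ) 1, ENNReal.ofReal (r ^ (-β)) < ⊤ :=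
    lintegral_rpow_lt_top (integrableOn_rpow_Ioc_zero_one (by linarith))
  -- With q = -β the first condition is integrability of r^{-β} near 0. In the second, r^{-β} r² ≤
  -- r^{1-β} on (0,1] brings in the energy bound.
  refine memLp_superposition measurableSet_Ioc Ioc_subset_Ioi_self hH (-β) ?_ ?_
  · convert hb using 4; ring_nf
  · calc ∫⁻ r in Ioc (0:ℝ) 1, ENNReal.ofReal (r ^ (-β)) * sqNorm (H r)
        ≤ ∫⁻ r in Ioc (0:ℝ) 1, (ENNReal.ofReal (r ^ (-β)) * D +
          2 * (ENNReal.ofReal (r ^ (1 - β)) * S r)) := by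
          refine setLIntegral_mono' measurableSet_Ioc fun r hr => ?_
          refine (mul_le_mul_right (hHS r hr) _).trans ?_
          rw [mul_add]
          gcongr _ + ?_
          rw [mul_left_comm, ← mul_assoc (ENNReal.ofReal _), ← ENNReal.ofReal_mul
            (Real.rpow_nonneg hr.1.le _)]
          gcongr
          rw [show 1 - β = -β + 1 by ring, Real.rpow_add_one hr.1.ne']
          have : 0 ≤ r ^ (-β) := Real.rpow_nonneg hr.1.le _
          gcongr
          nlinarith [hr.1, hr.2]
      _ = (∫⁻ r in Ioc (0:ℝ) 1, ENNReal.ofReal (r ^ (-β))) * D +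
          2 * ∫⁻ r in Ioc (0:ℝ) 1, (ENNReal.ofReal (r ^ (1 - β)) * S r) := by
          rw [lintegral_add_left (by fun_prop), lintegral_mul_const _ (by fun_prop),
            lintegral_const_mul' _ _ (by simp)]
      _ < ⊤ := by
          refine ENNReal.add_lt_top.2 ⟨ENNReal.mul_lt_top hb hD, ENNReal.mul_lt_top (by simp) ?_⟩
          exact (lintegral_mono_set Ioc_subset_Ioi_self).trans_lt hS

/-! ### The relaxation pair y₀' = -y₁, y₀(0) = 1, y₁ = I^β y₀. -/

section Relaxation

variable {β : ℝ} {y₀ y₁ : ℝ → ℝ}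

/-- Since y₁ = -y₀', the integral is (y₀(0)² - y₀(X)²)/2 with y₀(0) = 1. -/
theorem integral_relaxation_mul_le (hc₁ : Continuous y₁)
    (hd : ∀ t, 0 ≤ t → y₀ t = 1 - ∫ s in (0:ℝ)..t, y₁ s) {X : ℝ} (hX : 0 ≤ X) :
    ∫ t in (0:ℝ)..X, y₀ t * y₁ t ≤ 1 / 2 := by
  set Y : ℝ → ℝ := fun t => 1 - ∫ s in (0:ℝ)..t, y₁ s with hY
  have hYd : ∀ t, HasDerivAt Y (-y₁ t) t := fun t =>
    (hc₁.integral_hasStrictDerivAt 0 t).hasDerivAt.const_sub 1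
  have hYc : Continuous Y := continuous_iff_continuousAt.2 fun t => (hYd t).continuousAt
  have e1 : ∫ t in (0:ℝ)..X, y₀ t * y₁ t = ∫ t in (0:ℝ)..X, Y t * y₁ t := by
    refine intervalIntegral.integral_congr fun t ht => ?_
    rw [uIcc_of_le hX] at ht
    simp only [hd t ht.1, hY]
  have e2 : ∫ t in (0:ℝ)..X, Y t * y₁ t = -(Y X ^ 2 / 2) - -(Y 0 ^ 2 / 2) := by
    refine intervalIntegral.integral_eq_sub_of_hasDerivAt (f := fun t => -(Y t ^ 2 / 2))
      (fun t _ => ?_) (Continuous.intervalIntegrable (by fun_prop) _ _)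
    refine ((((hYd t).pow 2).div_const 2).neg).congr_deriv ?_
    push_cast
    ring
  have e3 : Y 0 = 1 := by simp [hY]
  rw [e1, e2, e3]
  nlinarith [sq_nonneg (Y X)]

/-- Integration by parts in the convolution of y₀' = -y₁. For small r the right side is the useful
one, because its second term carries a factor r. -/
theorem relaxation_by_parts (hc₁ : Continuous y₁)
    (hd : ∀ t, 0 ≤ t → y₀ t = 1 - ∫ s in (0:ℝ)..t, y₁ s) (r : ℝ) {t : ℝ} (ht : 0 ≤ t) :
    Real.exp (-(r * t)) - expConv r y₁ t = y₀ t - r * expConv r y₀ t := by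
  have h00 : y₀ 0 = 1 := by simpa using hd 0 le_rfl
  have h := expConv_deriv (f := y₀) (f' := fun s => -1 * y₁ s) (by fun_prop) ht r
    (fun s hs => by
      rw [intervalIntegral.integral_const_mul, h00, hd s hs.1]
      ring)
  rw [expConv_const_mul, h00] at h
  linarith

theorem lintegral_relaxation_energy_lt_top (h0 : 0 < β) (h1 : β < 1) (hc₀ : Continuous y₀)
    (hc₁ : Continuous y₁) (hd : ∀ t, 0 ≤ t → y₀ t = 1 - ∫ s in (0:ℝ)..t, y₁ s)
    (hI : ∀ t, 0 < t → y₁ t = rlIntegral β y₀ t) :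
    ∫⁻ r in Ioi (0:ℝ), ENNReal.ofReal (r ^ (1 - β)) * sqNorm (expConv r y₀) < ⊤ :=
  (lintegral_rpow_mul_sqNorm_expConv_le h0 h1 hc₀ hI fun _ hX =>
    integral_relaxation_mul_le hc₁ hd hX).trans_lt ENNReal.ofReal_lt_top

/-- A finite weighted integral forces ‖w_r‖ < ∞ for at least one r > 0, and the resolvent identity
carries this over to r = 1. -/
theorem memLp_expConv_one_relaxation (h0 : 0 < β) (h1 : β < 1) (hc₀ : Continuous y₀)
    (hc₁ : Continuous y₁) (hd : ∀ t, 0 ≤ t → y₀ t = 1 - ∫ s in (0:ℝ)..t, y₁ s)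
    (hI : ∀ t, 0 < t → y₁ t = rlIntegral β y₀ t) :
    MemLp (expConv 1 y₀) 2 (volume.restrict (Ioi 0)) := by
  have hE := lintegral_relaxation_energy_lt_top h0 h1 hc₀ hc₁ hd hI
  have hm : Measurable fun r => ENNReal.ofReal (r ^ (1 - β)) * sqNorm (expConv r y₀) := by
    refine (by fun_prop : Measurable fun r : ℝ => ENNReal.ofReal (r ^ (1 - β))).mul ?_
    have : Measurable fun p : ℝ × ℝ => ‖expConv p.1 y₀ p.2‖ₑ ^ 2 :=
      ((continuous_expConv_uncurry hc₀).measurable.enorm).pow_const _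
    exact this.lintegral_prod_right'
  have hae := ae_lt_top hm hE.ne
  have : NeBot (ae (volume.restrict (Ioi (0:ℝ)))) := by
    rw [ae_neBot, Ne, Measure.restrict_eq_zero]; simp
  obtain ⟨r, hr, hr0⟩ := (hae.and (ae_restrict_mem measurableSet_Ioi)).exists
  have hr0 : 0 < r := hr0
  have hwr : MemLp (expConv r y₀) 2 (volume.restrict (Ioi 0)) := by
    refine memLp_two_of_sqNorm_lt_top (continuous_expConv hc₀ r).aestronglyMeasurable ?_
    refine lt_of_le_of_ne le_top fun htop => ?_
    have hp : ENNReal.ofReal (r ^ (1 - β)) ≠ 0 := by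
      rw [Ne, ENNReal.ofReal_eq_zero, not_le]; positivity
    rw [htop, ENNReal.mul_top hp] at hr
    exact lt_irrefl _ hr
  have hR := (memLp_expConv (continuous_expConv hc₀ r) one_pos hwr).const_mul (r - 1)
  exact memLp_congr_Ioi (hwr.add hR) fun t ht => expConv_resolvent hc₀ 1 r ht.le

/-- Let R be convolution with e^{-t}, bounded on L². Integration by parts gives Ry₁ = e^{-t} + Ry₀ -
y₀, and one more R puts RRy₁ in L², as Ry₀ is. The difference y₁ - Ry₁ is a superposition of w_r -
Rw_r, controlled by the energy. Climbing back from RRy₁ through Ry₁ to y₁ costs only this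
difference. -/
theorem memLp_relaxation (h0 : 0 < β) (h1 : β < 1) (hc₀ : Continuous y₀)
    (hc₁ : Continuous y₁) (hd : ∀ t, 0 ≤ t → y₀ t = 1 - ∫ s in (0:ℝ)..t, y₁ s)
    (hI : ∀ t, 0 < t → y₁ t = rlIntegral β y₀ t) :
    MemLp y₀ 2 (volume.restrict (Ioi 0)) ∧ MemLp y₁ 2 (volume.restrict (Ioi 0)) := by
  have hE := lintegral_relaxation_energy_lt_top h0 h1 hc₀ hc₁ hd hI
  have hw1 := memLp_expConv_one_relaxation h0 h1 hc₀ hc₁ hd hI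
  have hcw1 := continuous_expConv hc₀ 1
  have hcR := continuous_expConv hc₁ 1
  have hρc : Continuous fun t : ℝ => Real.exp (-(1 * t)) := by fun_prop
  have hρ := memLp_exp one_pos
  have hRy : ∀ t, 0 ≤ t → expConv 1 y₁ t = Real.exp (-(1 * t)) + expConv 1 y₀ t - y₀ t := by
    intro t ht
    have := relaxation_by_parts hc₁ hd 1 ht
    linarith
  have hcu := continuous_expConv_uncurry hc₀
  have hcu2 : Continuous fun p : ℝ × ℝ => expConv 1 (expConv p.1 y₀) p.2 :=
    continuous_expConv_param (F := fun r => expConv r y₀) (ρ := fun _ => 1) hcu continuous_const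
  -- the twice smoothed function
  have hRR : MemLp (expConv 1 (expConv 1 y₁)) 2 (volume.restrict (Ioi 0)) := by
    have h := ((memLp_expConv hρc one_pos hρ).add (memLp_expConv hcw1 one_pos hw1)).sub hw1
    refine memLp_congr_Ioi h fun t ht => ?_
    have e : expConv 1 (expConv 1 y₁) t =
        expConv 1 (fun s => Real.exp (-(1 * s)) + expConv 1 y₀ s - y₀ s) t := by
      unfold expConv
      refine intervalIntegral.integral_congr fun s hs => ?_
      rw [uIcc_of_le ht.le] at hs
      have := hRy s hs.1
      unfold expConv at this
      simp only [this]
    rw [e, expConv_sub (by fun_prop) hc₀, expConv_add hρc hcw1]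
    rfl
  -- the difference `y₁ - R y₁` as a superposition
  set H : ℝ → ℝ → ℝ := fun r t => expConv r y₀ t - expConv 1 (expConv r y₀) t with hHdef
  have hHc : Continuous (Function.uncurry H) := by
    simp only [hHdef, Function.uncurry_def]
    fun_prop
  have hlow : MemLp (fun t => ∫ r in Ioc (0:ℝ) 1, r ^ (-β) * H r t) 2
      (volume.restrict (Ioi 0)) := by
    refine memLp_superposition_low h1 hHc (S := fun r => sqNorm (expConv r y₀))
      (D := 2 * sqNorm (expConv 1 y₀)) (ENNReal.mul_lt_top (by simp) (sqNorm_lt_top hw1)) hE ?_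
    intro r hr
    -- The resolvent identity in the form w_r - Rw_r = w_1 - rRw_r: the difference stays controlled
    -- for small r, although w_r by itself need not.
    have e : sqNorm (H r) = sqNorm (fun t => expConv 1 y₀ t - r * expConv 1 (expConv r y₀) t) := by
      unfold sqNorm
      refine setLIntegral_congr_fun measurableSet_Ioi fun t ht => ?_
      have := expConv_resolvent hc₀ 1 r (le_of_lt ht)
      simp only [hHdef]
      rw [this]; ring_nf
    rw [e]
    refine (sqNorm_sub_le _ _ hcw1.aemeasurable).trans ?_
    rw [sqNorm_const_mul]
    gcongr
    simpa using sqNorm_expConv_le (continuous_expConv hc₀ r) one_pos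
  have hhigh : MemLp (fun t => ∫ r in Ioi (1:ℝ), r ^ (-β) * H r t) 2
      (volume.restrict (Ioi 0)) := by
    -- q = 1 - β is the energy weight; the other exponent is -2β - (1-β) = -β - 1 < -1.
    refine memLp_superposition measurableSet_Ioi (Ioi_subset_Ioi zero_le_one) hHc (1 - β) ?_ ?_
    · exact lintegral_rpow_lt_top (integrableOn_Ioi_rpow_of_lt (by linarith) one_pos)
    · have : ∀ r, ENNReal.ofReal (r ^ (1 - β)) * sqNorm (H r) ≤
          4 * (ENNReal.ofReal (r ^ (1 - β)) * sqNorm (expConv r y₀)) := by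
        intro r
        rw [mul_left_comm]
        gcongr
        refine (sqNorm_sub_le _ _ (continuous_expConv hc₀ r).aemeasurable).trans ?_
        have h5 : sqNorm (expConv 1 (expConv r y₀)) ≤ sqNorm (expConv r y₀) := by
          simpa using sqNorm_expConv_le (continuous_expConv hc₀ r) one_pos
        calc _ ≤ 2 * sqNorm (expConv r y₀) + 2 * sqNorm (expConv r y₀) := by gcongr
          _ = _ := by rw [← add_mul]; norm_num
      calc _ ≤ ∫⁻ r in Ioi (1:ℝ), 4 * (ENNReal.ofReal (r ^ (1 - β)) * sqNorm (expConv r y₀)) :=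
            lintegral_mono fun r => this r
        _ = 4 * ∫⁻ r in Ioi (1:ℝ), (ENNReal.ofReal (r ^ (1 - β)) * sqNorm (expConv r y₀)) :=
            lintegral_const_mul' _ _ (by simp)
        _ < ⊤ := ENNReal.mul_lt_top (by simp)
            ((lintegral_mono_set (Ioi_subset_Ioi zero_le_one)).trans_lt hE)
  have hdiff : MemLp (fun t => y₁ t - expConv 1 y₁ t) 2 (volume.restrict (Ioi 0)) := by
    refine memLp_congr_Ioi ((hlow.add hhigh).const_mul (diffusiveConst β)) fun t ht => ?_
    obtain ⟨M, hM⟩ := (isCompact_Icc (a := (0:ℝ)) (b := t)).exists_bound_of_continuousOn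
      hc₀.continuousOn
    have hM0 : 0 ≤ M := (norm_nonneg _).trans (hM 0 ⟨le_rfl, ht.le⟩)
    have hGc : Continuous (Function.uncurry fun r s : ℝ =>
        Real.exp (-(1 * (t - s))) * expConv r y₀ s) := by
      simp only [Function.uncurry_def]; fun_prop
    have hGb : ∀ r, 0 < r → ∀ s ∈ Icc 0 t,
        |Real.exp (-(1 * (t - s))) * expConv r y₀ s| ≤ (M * (t + 1)) / (1 + r) := by
      intro r hr s hs
      rw [abs_mul, abs_of_pos (Real.exp_pos _)]
      have h2 : Real.exp (-(1 * (t - s))) ≤ 1 := Real.exp_le_one_iff.2 (by linarith [hs.2])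
      have h3 := abs_expConv_le hc₀ hr hM hs
      nlinarith [abs_nonneg (expConv r y₀ s), Real.exp_pos (-(1 * (t - s)))]
    have e1 : y₁ t = diffusiveConst β * ∫ r in Ioi (0:ℝ), r ^ (-β) * expConv r y₀ t := by
      rw [hI t ht, rlIntegral_eq_diffusive h0 h1 hc₀ ht]
    have e2 : expConv 1 y₁ t =
        diffusiveConst β * ∫ r in Ioi (0:ℝ), r ^ (-β) * expConv 1 (expConv r y₀) t := by
      have := integral_rpow_mul_swap h0 h1 ht.le hGc hGb
      simp only [expConv] at this ⊢
      rw [← this, ← intervalIntegral.integral_const_mul, intervalIntegral.integral_of_le ht.le,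
        intervalIntegral.integral_of_le ht.le]
      refine setIntegral_congr_fun measurableSet_Ioc fun s hs => ?_
      rw [hI s hs.1, rlIntegral_eq_diffusive h0 h1 hc₀ hs.1]
      simp_rw [mul_left_comm _ (Real.exp (-(1 * (t - s))))]
      rw [integral_const_mul]
      simp only [expConv]
      ring
    have i1 := integrableOn_rpow_mul_expConv h0 h1 hc₀ ht.le
    have i2 : IntegrableOn (fun r : ℝ => r ^ (-β) * expConv 1 (expConv r y₀) t) (Ioi 0) := by
      refine integrableOn_rpow_mul_of_le h0 h1 (C := t * (M * (t + 1)))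
        (hcu2.comp (by fun_prop : Continuous fun r : ℝ => (r, t))) fun r hr => ?_
      have := intervalIntegral.norm_integral_le_of_norm_le_const (a := 0) (b := t)
        (f := fun s => Real.exp (-(1 * (t - s))) * expConv r y₀ s)
        (C := (M * (t + 1)) / (1 + r)) (fun s hs => by
          rw [uIoc_of_le ht.le] at hs
          exact hGb r hr s ⟨hs.1.le, hs.2⟩)
      rw [sub_zero, abs_of_nonneg ht.le, Real.norm_eq_abs] at this
      calc _ ≤ _ := this
        _ = _ := by ring
    have i3 : IntegrableOn (fun r : ℝ => r ^ (-β) * H r t) (Ioi 0) := by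
      refine (i1.sub i2).congr (ae_of_all _ fun r => ?_)
      simp only [hHdef, Pi.sub_apply]; ring
    simp only [Pi.add_apply]
    rw [e1, e2, ← mul_sub, ← integral_sub i1 i2, ← setIntegral_union (by
      rw [Set.disjoint_left]; intro r hr hr'; exact absurd hr.2 (not_le.2 hr')) measurableSet_Ioi
      (i3.mono_set Ioc_subset_Ioi_self) (i3.mono_set (Ioi_subset_Ioi zero_le_one)),
      Ioc_union_Ioi_eq_Ioi zero_le_one]
    simp only [hHdef, mul_sub]
  -- Ry₁ = R(y₁ - Ry₁) + RRy₁.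
  have hR1 : MemLp (expConv 1 y₁) 2 (volume.restrict (Ioi 0)) := by
    refine memLp_congr_Ioi ((memLp_expConv (by fun_prop) one_pos hdiff).add hRR) fun t ht => ?_
    simp only [Pi.add_apply]
    rw [expConv_sub hc₁ hcR]; ring
  have hy1 : MemLp y₁ 2 (volume.restrict (Ioi 0)) :=
    memLp_congr_Ioi (hdiff.add hR1) fun t _ => by simp
  refine ⟨memLp_congr_Ioi ((hρ.add hw1).sub hR1) fun t ht => ?_, hy1⟩
  simp only [Pi.add_apply, Pi.sub_apply]
  rw [hRy t ht.le]; ring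

/-- The function is formally y₁', the superposition of e^{-rt} - e^{-r·} * y₁. For r ≤ 1 this equals
y₀ - rw_r. For r > 1 its squared norm is O(1/r), from ‖e^{-r·}‖² ≤ 1/r and Young's inequality. The
condition β > 1/2 is that of t^{β-1} being square integrable at 0. -/
theorem memLp_relaxation_deriv (h0 : 1 / 2 < β) (h1 : β < 1) (hc₀ : Continuous y₀)
    (hc₁ : Continuous y₁) (hd : ∀ t, 0 ≤ t → y₀ t = 1 - ∫ s in (0:ℝ)..t, y₁ s)
    (hI : ∀ t, 0 < t → y₁ t = rlIntegral β y₀ t) :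
    MemLp (fun t => t ^ (β - 1) / Real.Gamma β - rlIntegral β y₁ t) 2
      (volume.restrict (Ioi 0)) := by
  have hβ : 0 < β := by linarith
  have hE := lintegral_relaxation_energy_lt_top hβ h1 hc₀ hc₁ hd hI
  obtain ⟨hy0, hy1⟩ := memLp_relaxation hβ h1 hc₀ hc₁ hd hI
  have hcu := continuous_expConv_uncurry hc₁
  set H : ℝ → ℝ → ℝ := fun r t => Real.exp (-(r * t)) - expConv r y₁ t with hHdef
  have hHc : Continuous (Function.uncurry H) := by
    simp only [hHdef, Function.uncurry_def]; fun_prop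
  have hlow : MemLp (fun t => ∫ r in Ioc (0:ℝ) 1, r ^ (-β) * H r t) 2
      (volume.restrict (Ioi 0)) := by
    refine memLp_superposition_low h1 hHc (S := fun r => sqNorm (expConv r y₀))
      (D := 2 * sqNorm y₀) (ENNReal.mul_lt_top (by simp) (sqNorm_lt_top hy0)) hE ?_
    intro r hr
    have e : sqNorm (H r) = sqNorm (fun t => y₀ t - r * expConv r y₀ t) := by
      unfold sqNorm
      refine setLIntegral_congr_fun measurableSet_Ioi fun t ht => ?_
      simp only [hHdef]
      rw [relaxation_by_parts hc₁ hd r (le_of_lt ht)]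
    rw [e]
    refine (sqNorm_sub_le _ _ hc₀.aemeasurable).trans ?_
    rw [sqNorm_const_mul]
  have hhigh : MemLp (fun t => ∫ r in Ioi (1:ℝ), r ^ (-β) * H r t) 2
      (volume.restrict (Ioi 0)) := by
    -- The exponents to be integrated at infinity are -2β - q and q - 1. With q = (1-2β)/2 both are
    -- below -1 precisely when β > 1/2.
    refine memLp_superposition measurableSet_Ioi (Ioi_subset_Ioi zero_le_one) hHc
      ((1 - 2 * β) / 2) ?_ ?_
    · exact lintegral_rpow_lt_top (integrableOn_Ioi_rpow_of_lt (by linarith) one_pos)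
    · have hb : ∫⁻ r in Ioi (1:ℝ), ENNReal.ofReal (r ^ ((1 - 2 * β) / 2 - 1)) < ⊤ :=
        lintegral_rpow_lt_top (integrableOn_Ioi_rpow_of_lt (by linarith) one_pos)
      calc ∫⁻ r in Ioi (1:ℝ), ENNReal.ofReal (r ^ ((1 - 2 * β) / 2)) * sqNorm (H r)
          ≤ ∫⁻ r in Ioi (1:ℝ), ENNReal.ofReal (r ^ ((1 - 2 * β) / 2 - 1)) *
            (2 + 2 * sqNorm y₁) := by
            refine setLIntegral_mono' measurableSet_Ioi fun r hr => ?_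
            have hr0 : 0 < r := lt_trans one_pos hr
            have hr1 : 1 < r := hr
            rw [Real.rpow_sub_one hr0.ne', div_eq_mul_one_div (r ^ _) r, ENNReal.ofReal_mul (by positivity),
              mul_assoc]
            gcongr
            refine (sqNorm_sub_le _ _ (by fun_prop)).trans ?_
            rw [mul_add, mul_comm _ (2 : ℝ≥0∞), mul_left_comm _ (2 : ℝ≥0∞)]
            gcongr
            · exact sqNorm_exp_le hr0
            · refine (sqNorm_expConv_le hc₁ hr0).trans ?_
              gcongr
              nlinarith
        _ = (∫⁻ r in Ioi (1:ℝ), ENNReal.ofReal (r ^ ((1 - 2 * β) / 2 - 1))) *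
            (2 + 2 * sqNorm y₁) := lintegral_mul_const _ (by fun_prop)
        _ < ⊤ := ENNReal.mul_lt_top hb (ENNReal.add_lt_top.2 ⟨by simp,
            ENNReal.mul_lt_top (by simp) (sqNorm_lt_top hy1)⟩)
  refine memLp_congr_Ioi ((hlow.add hhigh).const_mul (diffusiveConst β)) fun t ht => ?_
  have i1 := integrableOn_rpow_mul_exp h1 ht
  have i2 := integrableOn_rpow_mul_expConv hβ h1 hc₁ ht.le
  have i3 : IntegrableOn (fun r : ℝ => r ^ (-β) * H r t) (Ioi 0) := by
    refine (i1.sub i2).congr (ae_of_all _ fun r => ?_)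
    simp only [hHdef, Pi.sub_apply]; ring
  simp only [Pi.add_apply]
  rw [rpow_div_Gamma_eq h1 ht, rlIntegral_eq_diffusive hβ h1 hc₁ ht, ← mul_sub,
    ← integral_sub i1 i2, ← setIntegral_union (by
    rw [Set.disjoint_left]; intro r hr hr'; exact absurd hr.2 (not_le.2 hr')) measurableSet_Ioi
    (i3.mono_set Ioc_subset_Ioi_self) (i3.mono_set (Ioi_subset_Ioi zero_le_one)),
    Ioc_union_Ioi_eq_Ioi zero_le_one]
  simp only [hHdef, mul_sub]

end Relaxation

/-- The relaxation results with β = α - 1, which lies in (1/2, 1). The third function is f_{α-1} =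
t^{β-1}/Γ(β) - I^β f_α. -/
theorem memLp_mlFun {α : ℝ} (hα : 3 / 2 < α) (hα' : α < 2) :
    MemLp (mlFun α 1 1) 2 (volume.restrict (Ioi 0)) ∧
    MemLp (mlFun α α 1) 2 (volume.restrict (Ioi 0)) ∧
    MemLp (mlFun α (α - 1) 1) 2 (volume.restrict (Ioi 0)) := by
  have h1 : 1 ≤ α := by linarith
  have hc₀ := continuous_mlFun h1 le_rfl 1
  have hc₁ := continuous_mlFun h1 h1 1
  have hd : ∀ t, 0 ≤ t → mlFun α 1 1 t = 1 - ∫ s in (0:ℝ)..t, mlFun α α 1 s := fun t ht => by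
    simpa using mlFun_one_eq h1 1 ht
  have hI : ∀ t, 0 < t → mlFun α α 1 t = rlIntegral (α - 1) (mlFun α 1 1) t := fun t ht => by
    rw [rlIntegral_mlFun h1 (by linarith) one_pos 1 ht, sub_add_cancel]
  obtain ⟨h3, h4⟩ := memLp_relaxation (by linarith) (by linarith) hc₀ hc₁ hd hI
  refine ⟨h3, h4, ?_⟩
  refine memLp_congr_Ioi (memLp_relaxation_deriv (β := α - 1) (by linarith) (by linarith)
    hc₀ hc₁ hd hI) fun t ht => ?_
  rw [mlFun_eq_add h1 (by linarith) 1 ht, rlIntegral_mlFun h1 (by linarith) (by linarith) 1 ht,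
    show α + (α - 1) = α - 1 + α by ring, one_mul]

end RLWave
end

noncomputable section

namespace RLWave

/-! ### Estimates of the solution of the scalar problem, uniform in the eigenvalue -/

theorem sqNorm_comp_mul_left (f : ℝ → ℝ) {k : ℝ} (hk : 0 < k) :
    sqNorm (fun t => f (k * t)) = ENNReal.ofReal k⁻¹ * sqNorm f := by
  unfold sqNorm
  rw [← lintegral_indicator measurableSet_Ioi, ← lintegral_indicator measurableSet_Ioi]
  have h1 : ∀ t : ℝ, (Ioi (0:ℝ)).indicator (fun t => ‖f (k * t)‖ₑ ^ 2) t =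
      (Ioi (0:ℝ)).indicator (fun t => ‖f t‖ₑ ^ 2) ((Homeomorph.mulLeft₀ k hk.ne').toMeasurableEquiv t) := by
    intro t
    simp only [Homeomorph.toMeasurableEquiv_coe, Homeomorph.coe_mulLeft₀, indicator, mem_Ioi]
    simp only [mul_pos_iff_of_pos_left hk]
  simp_rw [h1]
  rw [← lintegral_map_equiv (μ := volume) ((Ioi (0:ℝ)).indicator (fun t => ‖f t‖ₑ ^ 2))]
  have h2 : Measure.map ((Homeomorph.mulLeft₀ k hk.ne').toMeasurableEquiv) volume =
      ENNReal.ofReal |k⁻¹| • (volume : Measure ℝ) := by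
    rw [← Real.map_volume_mul_left hk.ne']
    rfl
  rw [h2, lintegral_smul_measure, abs_of_pos (inv_pos.2 hk), smul_eq_mul]

/-- Scaling: the prefactor contributes λ^{-2(β-1)/α} and the change of variables λ^{-1/α}.
Integrating over the whole half line makes the constant independent of T. -/
theorem exists_lintegral_mlFun_sq_le {α β : ℝ} (hα : 0 < α)
    (h : MemLp (mlFun α β 1) 2 (volume.restrict (Ioi 0))) :
    ∃ C : ℝ, 0 < C ∧ ∀ lam T : ℝ, 0 < lam →
      ∫⁻ t in Ioo 0 T, ENNReal.ofReal (mlFun α β lam t ^ 2) ≤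
        ENNReal.ofReal (C * lam ^ ((1 - 2 * β) / α)) := by
  have hS := sqNorm_lt_top h
  refine ⟨(sqNorm (mlFun α β 1)).toReal + 1, by positivity, fun lam T hlam => ?_⟩
  calc ∫⁻ t in Ioo 0 T, ENNReal.ofReal (mlFun α β lam t ^ 2)
      ≤ ∫⁻ t in Ioi 0, ENNReal.ofReal (mlFun α β lam t ^ 2) :=
        lintegral_mono_set Ioo_subset_Ioi_self
    _ = sqNorm (fun t => lam ^ (-(β - 1) / α) * mlFun α β 1 (lam ^ (1 / α) * t)) := by
        refine setLIntegral_congr_fun measurableSet_Ioi fun t ht => ?_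
        beta_reduce
        rw [← mlFun_scale hα hlam ht, ← sq_abs, ENNReal.ofReal_pow (abs_nonneg _),
          ← Real.norm_eq_abs, ofReal_norm]
    _ = ENNReal.ofReal (lam ^ ((1 - 2 * β) / α)) * sqNorm (mlFun α β 1) := by
        rw [sqNorm_const_mul, sqNorm_comp_mul_left _ (by positivity), ← mul_assoc,
          ← ENNReal.ofReal_mul (by positivity), ← Real.rpow_neg hlam.le, ← Real.rpow_natCast,
          ← Real.rpow_mul hlam.le, ← Real.rpow_add hlam]
        congr 3
        push_cast
        field_simp
        ring
    _ ≤ ENNReal.ofReal (lam ^ ((1 - 2 * β) / α)) *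
          ENNReal.ofReal ((sqNorm (mlFun α β 1)).toReal + 1) := by
        gcongr
        rw [← ENNReal.ofReal_toReal hS.ne]
        exact ENNReal.ofReal_le_ofReal (by simp)
    _ = _ := by rw [← ENNReal.ofReal_mul (by positivity), mul_comm]

theorem lintegral_sq_add_le {ν : Measure ℝ} {f g : ℝ → ℝ} {A B : ℝ} (hA : 0 ≤ A) (hB : 0 ≤ B)
    (hfm : AEMeasurable f ν)
    (hf : ∫⁻ t, ENNReal.ofReal (f t ^ 2) ∂ν ≤ ENNReal.ofReal A)
    (hg : ∫⁻ t, ENNReal.ofReal (g t ^ 2) ∂ν ≤ ENNReal.ofReal B) (a b c : ℝ) (hc : 0 ≤ c) :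
    ∫⁻ t, ENNReal.ofReal (c * (a * f t + b * g t) ^ 2) ∂ν ≤
      ENNReal.ofReal (2 * (c * A * a ^ 2 + c * B * b ^ 2)) := by
  have h1 : ∀ t, ENNReal.ofReal (c * (a * f t + b * g t) ^ 2) ≤
      ENNReal.ofReal (2 * (c * a ^ 2)) * ENNReal.ofReal (f t ^ 2) +
      ENNReal.ofReal (2 * (c * b ^ 2)) * ENNReal.ofReal (g t ^ 2) := by
    intro t
    rw [← ENNReal.ofReal_mul (by positivity), ← ENNReal.ofReal_mul (by positivity),
      ← ENNReal.ofReal_add (by positivity) (by positivity)]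
    refine ENNReal.ofReal_le_ofReal ?_
    have : (a * f t + b * g t) ^ 2 ≤ 2 * ((a * f t) ^ 2 + (b * g t) ^ 2) := by
      nlinarith [sq_nonneg (a * f t - b * g t)]
    calc _ ≤ c * (2 * ((a * f t) ^ 2 + (b * g t) ^ 2)) := by gcongr
      _ = _ := by ring
  refine (lintegral_mono h1).trans ?_
  rw [lintegral_add_left' (by fun_prop), lintegral_const_mul' _ _ ENNReal.ofReal_ne_top,
    lintegral_const_mul' _ _ ENNReal.ofReal_ne_top]
  refine (add_le_add (mul_le_mul_right hf _) (mul_le_mul_right hg _)).trans ?_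
  rw [← ENNReal.ofReal_mul (by positivity), ← ENNReal.ofReal_mul (by positivity),
    ← ENNReal.ofReal_add (by positivity) (by positivity)]
  refine ENNReal.ofReal_le_ofReal (le_of_eq ?_)
  ring

theorem aemeasurable_mlFun {α β : ℝ} (hα : 1 ≤ α) (hβ : 0 < β) (lam T : ℝ) :
    AEMeasurable (mlFun α β lam) (volume.restrict (Ioo 0 T)) :=
  ((continuousOn_mlFun hα hβ lam).mono Ioo_subset_Ioi_self).aemeasurable measurableSet_Ioo

/-- Estimate of the solution of `D^α y = -λ y` with data `a`, `b`. -/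
theorem exists_lintegral_solution_sq_le {α θ μ lam₀ : ℝ} (hα : 3 / 2 < α) (hα' : α < 2)
    (h₀ : 0 < lam₀) (hθ : 2 * (θ - μ) ≤ (2 * α - 3) / α) :
    ∃ C : ℝ, 0 < C ∧ ∀ lam T a b : ℝ, lam₀ ≤ lam →
      ∫⁻ t in Ioo 0 T, ENNReal.ofReal (lam ^ (1 + 2 * θ) *
          (a * mlFun α α lam t + b * mlFun α (α - 1) lam t) ^ 2) ≤
        ENNReal.ofReal (C * (lam ^ (2 * μ) * a ^ 2 + lam ^ (1 + 2 * μ) * b ^ 2)) := by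
  have hα0 : 0 < α := by linarith
  obtain ⟨-, hm1, hm2⟩ := memLp_mlFun hα hα'
  obtain ⟨C1, hC1, hb1⟩ := exists_lintegral_mlFun_sq_le hα0 hm1
  obtain ⟨C2, hC2, hb2⟩ := exists_lintegral_mlFun_sq_le hα0 hm2
  -- The powers of λ left once λ^{2μ} a² and λ^{1+2μ} b² are factored out. The hypothesis on θ says
  -- exactly that `e2` ≤ 0, and then `e1` ≤ (α-2)/α ≤ 0; hence λ may be replaced by λ₀.
  set e1 : ℝ := 2 * (θ - μ) + (1 + (1 - 2 * α) / α) with he1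
  set e2 : ℝ := 2 * (θ - μ) + (1 - 2 * (α - 1)) / α with he2
  have he1' : e1 ≤ 0 := by
    have : (2 * α - 3) / α + (1 + (1 - 2 * α) / α) = (α - 2) / α := by field_simp; ring
    have h2 : (α - 2) / α ≤ 0 := div_nonpos_of_nonpos_of_nonneg (by linarith) hα0.le
    linarith
  have he2' : e2 ≤ 0 := by
    have : (2 * α - 3) / α + (1 - 2 * (α - 1)) / α = 0 := by field_simp; ring
    linarith
  refine ⟨2 * (C1 * lam₀ ^ e1 + C2 * lam₀ ^ e2), by positivity, fun lam T a b hl => ?_⟩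
  have hlam : 0 < lam := h₀.trans_le hl
  refine (lintegral_sq_add_le (by positivity) (by positivity)
    (aemeasurable_mlFun (by linarith) hα0 lam T) (hb1 lam T hlam) (hb2 lam T hlam) a b
    (lam ^ (1 + 2 * θ)) (by positivity)).trans ?_
  refine ENNReal.ofReal_le_ofReal ?_
  have k1 : lam ^ (1 + 2 * θ) * (C1 * lam ^ ((1 - 2 * α) / α)) =
      C1 * lam ^ e1 * lam ^ (2 * μ) := by
    rw [mul_left_comm, ← Real.rpow_add hlam, mul_assoc, ← Real.rpow_add hlam, he1]
    ring_nf
  have k2 : lam ^ (1 + 2 * θ) * (C2 * lam ^ ((1 - 2 * (α - 1)) / α)) =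
      C2 * lam ^ e2 * lam ^ (1 + 2 * μ) := by
    rw [mul_left_comm, ← Real.rpow_add hlam, mul_assoc, ← Real.rpow_add hlam, he2]
    ring_nf
  have l1 : lam ^ e1 ≤ lam₀ ^ e1 := Real.rpow_le_rpow_of_nonpos h₀ hl he1'
  have l2 : lam ^ e2 ≤ lam₀ ^ e2 := Real.rpow_le_rpow_of_nonpos h₀ hl he2'
  rw [k1, k2, mul_assoc 2]
  have p1 : 0 ≤ C1 * lam₀ ^ e1 := by positivity
  have p2 : 0 ≤ C2 * lam₀ ^ e2 := by positivity
  have q1 : 0 ≤ lam ^ (2 * μ) * a ^ 2 := by positivity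
  have q2 : 0 ≤ lam ^ (1 + 2 * μ) * b ^ 2 := by positivity
  have r1 : C1 * lam ^ e1 * lam ^ (2 * μ) * a ^ 2 ≤
      C1 * lam₀ ^ e1 * (lam ^ (2 * μ) * a ^ 2) := by
    rw [mul_assoc]; gcongr
  have r2 : C2 * lam ^ e2 * lam ^ (1 + 2 * μ) * b ^ 2 ≤
      C2 * lam₀ ^ e2 * (lam ^ (1 + 2 * μ) * b ^ 2) := by
    rw [mul_assoc]; gcongr
  nlinarith [mul_nonneg p1 q2, mul_nonneg p2 q1]

/-- Estimate of the derivative of order `α - 1` of the solution. -/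
theorem exists_lintegral_solution_deriv_sq_le {α lam₀ : ℝ} (hα : 3 / 2 < α) (hα' : α < 2)
    (h₀ : 0 < lam₀) :
    ∃ C : ℝ, 0 < C ∧ ∀ lam T a b : ℝ, lam₀ ≤ lam →
      ∫⁻ t in Ioo 0 T, ENNReal.ofReal
          ((a * mlFun α 1 lam t - b * (lam * mlFun α α lam t)) ^ 2) ≤
        ENNReal.ofReal (C * (a ^ 2 + lam * b ^ 2)) := by
  have hα0 : 0 < α := by linarith
  obtain ⟨hm0, hm1, -⟩ := memLp_mlFun hα hα'
  obtain ⟨C0, hC0, hb0⟩ := exists_lintegral_mlFun_sq_le hα0 hm0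
  obtain ⟨C1, hC1, hb1⟩ := exists_lintegral_mlFun_sq_le hα0 hm1
  -- Here no power of λ is to be gained: f_1 contributes λ^{-1/α}, and λ² ∫ f_α² contributes λ ·
  -- λ^{(1-α)/α}, whose factor λ goes to b².
  set e0 : ℝ := (1 - 2 * 1) / α with he0
  set e1 : ℝ := 1 + (1 - 2 * α) / α with he1
  have he0' : e0 ≤ 0 := div_nonpos_of_nonpos_of_nonneg (by linarith) hα0.le
  have he1' : e1 ≤ 0 := by
    have : 1 + (1 - 2 * α) / α = (1 - α) / α := by field_simp; ring
    rw [he1, this]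
    exact div_nonpos_of_nonpos_of_nonneg (by linarith) hα0.le
  refine ⟨2 * (C0 * lam₀ ^ e0 + C1 * lam₀ ^ e1), by positivity, fun lam T a b hl => ?_⟩
  have hlam : 0 < lam := h₀.trans_le hl
  have hmain := (lintegral_sq_add_le (by positivity) (by positivity)
    (aemeasurable_mlFun (by linarith) one_pos lam T) (hb0 lam T hlam) (hb1 lam T hlam) a
    (-(b * lam)) 1 zero_le_one)
  have e : ∀ t, 1 * (a * mlFun α 1 lam t + -(b * lam) * mlFun α α lam t) ^ 2 =
      (a * mlFun α 1 lam t - b * (lam * mlFun α α lam t)) ^ 2 := fun t => by ring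
  simp_rw [e] at hmain
  refine hmain.trans (ENNReal.ofReal_le_ofReal ?_)
  have k1 : 1 * (C1 * lam ^ ((1 - 2 * α) / α)) * (-(b * lam)) ^ 2 =
      C1 * lam ^ e1 * (lam * b ^ 2) := by
    rw [he1, Real.rpow_add hlam, Real.rpow_one]; ring
  have l0 : lam ^ e0 ≤ lam₀ ^ e0 := Real.rpow_le_rpow_of_nonpos h₀ hl he0'
  have l1 : lam ^ e1 ≤ lam₀ ^ e1 := Real.rpow_le_rpow_of_nonpos h₀ hl he1'
  rw [k1, mul_assoc 2]
  have p1 : 0 ≤ C0 * lam₀ ^ e0 := by positivity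
  have p2 : 0 ≤ C1 * lam₀ ^ e1 := by positivity
  have q1 : 0 ≤ a ^ 2 := by positivity
  have q2 : 0 ≤ lam * b ^ 2 := by positivity
  have r1 : 1 * (C0 * lam ^ e0) * a ^ 2 ≤ C0 * lam₀ ^ e0 * a ^ 2 := by
    rw [one_mul]; gcongr
  have r2 : C1 * lam ^ e1 * (lam * b ^ 2) ≤ C1 * lam₀ ^ e1 * (lam * b ^ 2) := by
    gcongr
  nlinarith [mul_nonneg p1 q2, mul_nonneg p2 q1]

end RLWave
end

noncomputable section

namespace RLWave

/-! ### Poincaré and Rellich inequalities on `H¹₀(Ω)` -/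

theorem sq_lintegral_le {X : Type*} [MeasurableSpace X] (ν : Measure X) {f : X → ℝ≥0∞}
    (hf : AEMeasurable f ν) : (∫⁻ x, f x ∂ν) ^ 2 ≤ ν univ * ∫⁻ x, f x ^ 2 ∂ν := by
  have e2 := ENNReal.lintegral_mul_le_Lp_mul_Lq ν (p := 2) (q := 2) (by constructor <;> norm_num)
    (f := fun _ => 1) (g := f) (by fun_prop) hf
  have e4 := ENNReal.rpow_le_rpow e2 (z := 2) (by norm_num)
  rw [ENNReal.mul_rpow_of_nonneg _ _ (by norm_num), ← ENNReal.rpow_mul, ← ENNReal.rpow_mul] at e4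
  norm_num at e4
  exact_mod_cast e4

/-! ### L² estimates for translates and ball averages of smooth functions. -/

section Translation

variable {N : ℕ}

local notation "𝔼" => EuclideanSpace ℝ (Fin N)

theorem continuous_gradient {φ : 𝔼 → ℝ} (hφ : ContDiff ℝ ∞ φ) : Continuous (gradient φ) :=
  (InnerProductSpace.toDual ℝ 𝔼).symm.continuous.comp (hφ.continuous_fderiv (by simp))

theorem sub_eq_integral_gradient {φ : 𝔼 → ℝ} (hφ : ContDiff ℝ ∞ φ) (x z : 𝔼) :
    φ (x + z) - φ x = ∫ t in (0:ℝ)..1, ⟪gradient φ (x + t • z), z⟫_ℝ := by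
  have hg := continuous_gradient hφ
  have hd : ∀ t : ℝ, HasDerivAt (fun t : ℝ => φ (x + t • z)) ⟪gradient φ (x + t • z), z⟫_ℝ t := by
    intro t
    have h1 : HasFDerivAt φ (fderiv ℝ φ (x + t • z)) (x + t • z) :=
      ((hφ.differentiable (by simp)) _).hasFDerivAt
    have h2 : HasDerivAt (fun t : ℝ => x + t • z) z t := by
      simpa using ((hasDerivAt_id t).smul_const z).const_add x
    have h3 := h1.comp_hasDerivAt t h2
    refine h3.congr_deriv ?_
    rw [gradient, InnerProductSpace.toDual_symm_apply]
  rw [intervalIntegral.integral_eq_sub_of_hasDerivAt (fun t _ => hd t)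
    (Continuous.intervalIntegrable (by fun_prop) _ _)]
  simp

/-- Cauchy–Schwarz along the segment from x to x + z, then Tonelli and translation invariance. Both
the Poincaré and the Rellich inequality rest on this. -/
theorem lintegral_translation_sub_sq_le {φ : 𝔼 → ℝ} (hφ : ContDiff ℝ ∞ φ) (z : 𝔼) :
    ∫⁻ x, ‖φ (x + z) - φ x‖ₑ ^ 2 ≤ ‖z‖ₑ ^ 2 * ∫⁻ x, ‖gradient φ x‖ₑ ^ 2 := by
  have hg := continuous_gradient hφ
  have h1 : ∀ x, ‖φ (x + z) - φ x‖ₑ ^ 2 ≤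
      ‖z‖ₑ ^ 2 * ∫⁻ t in Ioc (0:ℝ) 1, ‖gradient φ (x + t • z)‖ₑ ^ 2 := by
    intro x
    have h2 : ‖φ (x + z) - φ x‖ₑ ≤ ∫⁻ t in Ioc (0:ℝ) 1, ‖z‖ₑ * ‖gradient φ (x + t • z)‖ₑ := by
      rw [sub_eq_integral_gradient hφ, intervalIntegral.integral_of_le zero_le_one]
      refine (enorm_integral_le_lintegral_enorm _).trans (lintegral_mono fun t => ?_)
      rw [mul_comm, ← ofReal_norm, ← ofReal_norm, ← ofReal_norm,
        ← ENNReal.ofReal_mul (norm_nonneg _)]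
      exact ENNReal.ofReal_le_ofReal (norm_inner_le_norm _ _)
    rw [lintegral_const_mul' _ _ enorm_ne_top] at h2
    calc _ ≤ (‖z‖ₑ * ∫⁻ t in Ioc (0:ℝ) 1, ‖gradient φ (x + t • z)‖ₑ) ^ 2 := by gcongr
      _ = ‖z‖ₑ ^ 2 * (∫⁻ t in Ioc (0:ℝ) 1, ‖gradient φ (x + t • z)‖ₑ) ^ 2 := mul_pow _ _ _
      _ ≤ _ := by
        gcongr
        refine (sq_lintegral_le _ (by fun_prop)).trans ?_
        simp
  refine (lintegral_mono h1).trans ?_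
  rw [lintegral_const_mul' _ _ (by simp)]
  refine mul_le_mul_right ?_ _
  rw [lintegral_lintegral_swap (by
    refine Continuous.aemeasurable ?_
    simp only [Function.uncurry_def]
    fun_prop)]
  calc ∫⁻ t in Ioc (0:ℝ) 1, ∫⁻ x, ‖gradient φ (x + t • z)‖ₑ ^ 2
      = ∫⁻ t in Ioc (0:ℝ) 1, ∫⁻ x, ‖gradient φ x‖ₑ ^ 2 := by
        refine lintegral_congr fun t => ?_
        exact lintegral_add_right_eq_self (fun x => ‖gradient φ x‖ₑ ^ 2) (t • z)
    _ ≤ _ := by simp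

/-- Jensen on the ball, which is contained in the ball of radius 2δ about x. Enlarging to that ball
makes the bound independent of the centre c. -/
theorem enorm_sub_average_sq_le {φ : 𝔼 → ℝ} (hφ : Continuous φ) {x c : 𝔼} {δ : ℝ}
    (hx : dist x c < δ) :
    ‖φ x - (volume.real (Metric.ball c δ))⁻¹ * ∫ y in Metric.ball c δ, φ y‖ₑ ^ 2 ≤
      (volume (Metric.ball (0 : 𝔼) δ))⁻¹ *
        ∫⁻ z in Metric.ball (0 : 𝔼) (2 * δ), ‖φ (x + z) - φ x‖ₑ ^ 2 := by
  have hδ : 0 < δ := dist_nonneg.trans_lt hx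
  set B := Metric.ball c δ with hB
  have hVc : volume B = volume (Metric.ball (0 : 𝔼) δ) := by
    rw [hB, Measure.addHaar_ball_center]
  have hV0 : volume B ≠ 0 := (Metric.measure_ball_pos volume c hδ).ne'
  have hVt : volume B ≠ ⊤ := measure_ball_lt_top.ne
  have hVr : volume.real B ≠ 0 := by
    rw [measureReal_def]; exact (ENNReal.toReal_pos hV0 hVt).ne'
  have hintg : IntegrableOn φ B :=
    (hφ.continuousOn.integrableOn_compact (isCompact_closedBall c δ)).mono_set
      Metric.ball_subset_closedBall
  have e1 : φ x - (volume.real B)⁻¹ * ∫ y in B, φ y =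
      (volume.real B)⁻¹ * ∫ y in B, (φ x - φ y) := by
    rw [integral_sub (integrable_const_iff.2 (Or.inr (by
      rw [isFiniteMeasure_restrict]; exact hVt))) hintg, setIntegral_const, smul_eq_mul]
    field_simp
  have e2 : ‖(volume.real B)⁻¹‖ₑ = (volume B)⁻¹ := by
    rw [Real.enorm_of_nonneg (by positivity), ENNReal.ofReal_inv_of_pos (by positivity),
      measureReal_def, ENNReal.ofReal_toReal hVt]
  rw [e1, enorm_mul, mul_pow, e2, ← hVc]
  have e3 : ‖∫ y in B, (φ x - φ y)‖ₑ ^ 2 ≤ volume B * ∫⁻ y in B, ‖φ x - φ y‖ₑ ^ 2 := by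
    calc _ ≤ (∫⁻ y in B, ‖φ x - φ y‖ₑ) ^ 2 := by
          gcongr; exact enorm_integral_le_lintegral_enorm _
      _ ≤ _ := by
          refine (sq_lintegral_le _ (by fun_prop)).trans ?_
          simp
  have e4 : ∫⁻ y in B, ‖φ x - φ y‖ₑ ^ 2 ≤
      ∫⁻ z in Metric.ball (0 : 𝔼) (2 * δ), ‖φ (x + z) - φ x‖ₑ ^ 2 := by
    have hsub : B ⊆ Metric.ball x (2 * δ) := by
      intro y hy
      rw [hB, Metric.mem_ball] at hy
      rw [Metric.mem_ball]
      calc dist y x ≤ dist y c + dist c x := dist_triangle _ _ _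
        _ < 2 * δ := by rw [dist_comm c x]; linarith
    refine (lintegral_mono_set hsub).trans (le_of_eq ?_)
    rw [← lintegral_indicator Metric.isOpen_ball.measurableSet,
      ← lintegral_indicator Metric.isOpen_ball.measurableSet,
      ← lintegral_add_left_eq_self _ x]
    refine lintegral_congr fun z => ?_
    have : (x + z ∈ Metric.ball x (2 * δ)) ↔ z ∈ Metric.ball (0 : 𝔼) (2 * δ) := by
      simp [Metric.mem_ball, dist_eq_norm]
    by_cases hz : z ∈ Metric.ball (0 : 𝔼) (2 * δ)
    · rw [indicator_of_mem hz, indicator_of_mem (this.2 hz), ← enorm_neg, neg_sub]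
    · rw [indicator_of_notMem hz, indicator_of_notMem (fun h => hz (this.1 h))]
  calc _ ≤ (volume B)⁻¹ ^ 2 * (volume B * ∫⁻ y in B, ‖φ x - φ y‖ₑ ^ 2) := by gcongr
    _ = (volume B)⁻¹ * ((volume B)⁻¹ * volume B) * ∫⁻ y in B, ‖φ x - φ y‖ₑ ^ 2 := by ring
    _ = (volume B)⁻¹ * ∫⁻ y in B, ‖φ x - φ y‖ₑ ^ 2 := by
        rw [ENNReal.inv_mul_cancel hV0 hVt, mul_one]
    _ ≤ _ := by gcongr

/-- Integrate in x first and use the translation estimate with |z| < 2δ; 2^N is the ratio of the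
volumes of the two balls. -/
theorem lintegral_lintegral_translation_le {φ : 𝔼 → ℝ} (hφ : ContDiff ℝ ∞ φ) (Ω : Set 𝔼) {δ : ℝ}
    (hδ : 0 < δ) :
    ∫⁻ x in Ω, (volume (Metric.ball (0 : 𝔼) δ))⁻¹ *
        ∫⁻ z in Metric.ball (0 : 𝔼) (2 * δ), ‖φ (x + z) - φ x‖ₑ ^ 2 ≤
      ENNReal.ofReal (2 ^ N * (2 * δ) ^ 2) * ∫⁻ x, ‖gradient φ x‖ₑ ^ 2 := by
  have hV0 : volume (Metric.ball (0 : 𝔼) δ) ≠ 0 := (Metric.measure_ball_pos volume _ hδ).ne'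
  have hVt : volume (Metric.ball (0 : 𝔼) δ) ≠ ⊤ := measure_ball_lt_top.ne
  have hc := hφ.continuous
  have hV2 : volume (Metric.ball (0 : 𝔼) (2 * δ)) =
      ENNReal.ofReal (2 ^ N) * volume (Metric.ball (0 : 𝔼) δ) := by
    rw [Measure.addHaar_ball_mul_of_pos volume (0 : 𝔼) two_pos δ, finrank_euclideanSpace_fin]
  rw [lintegral_const_mul' _ _ (ENNReal.inv_ne_top.2 hV0), lintegral_lintegral_swap (by
    refine Continuous.aemeasurable ?_
    simp only [Function.uncurry_def]
    fun_prop)]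
  calc _ ≤ (volume (Metric.ball (0 : 𝔼) δ))⁻¹ * ∫⁻ z in Metric.ball (0 : 𝔼) (2 * δ),
        ENNReal.ofReal ((2 * δ) ^ 2) * ∫⁻ x, ‖gradient φ x‖ₑ ^ 2 := by
        refine mul_le_mul_right ?_ _
        refine setLIntegral_mono' Metric.isOpen_ball.measurableSet fun z hz => ?_
        refine (setLIntegral_le_lintegral _ _).trans
          ((lintegral_translation_sub_sq_le hφ z).trans ?_)
        gcongr
        rw [mem_ball_zero_iff] at hz
        rw [← ofReal_norm, ← ENNReal.ofReal_pow (norm_nonneg _)]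
        gcongr
    _ = (volume (Metric.ball (0 : 𝔼) δ))⁻¹ * volume (Metric.ball (0 : 𝔼) δ) *
        (ENNReal.ofReal (2 ^ N) * ENNReal.ofReal ((2 * δ) ^ 2)) *
          ∫⁻ x, ‖gradient φ x‖ₑ ^ 2 := by
        rw [setLIntegral_const, hV2]; ring
    _ = _ := by
        rw [ENNReal.inv_mul_cancel hV0 hVt, one_mul, ← ENNReal.ofReal_mul (by positivity)]

end Translation

theorem ofReal_norm_sq_Lp {X F : Type*} [MeasurableSpace X] [NormedAddCommGroup F]
    {ν : Measure X} (f : Lp F 2 ν) : ENNReal.ofReal (‖f‖ ^ 2) = ∫⁻ x, ‖f x‖ₑ ^ 2 ∂ν := by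
  rw [ENNReal.ofReal_pow (norm_nonneg _), ofReal_norm, Lp.enorm_def,
    eLpNorm_eq_lintegral_rpow_enorm_toReal (by simp) (by simp), ← ENNReal.rpow_natCast,
    ← ENNReal.rpow_mul]
  simp

/-! ### Passing from test functions to H¹₀(Ω). -/

section Sobolev

variable {N : ℕ} {Ω : Set (EuclideanSpace ℝ (Fin N))}

theorem span_testPairs_le :
    ((Submodule.span ℝ (testPairs Ω) : Submodule ℝ (L2 Ω × L2Vec Ω)) :
      Set (L2 Ω × L2Vec Ω)) ⊆ testPairs Ω := by
  intro p hp
  induction hp using Submodule.span_induction with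
  | mem x h => exact h
  | zero =>
    refine ⟨0, contDiff_const, HasCompactSupport.zero, by simp, ?_, ?_⟩
    · exact Lp.coeFn_zero _ _ _
    · have : gradient (0 : EuclideanSpace ℝ (Fin N) → ℝ) = 0 := by
        ext1 x; exact gradient_const x 0
      rw [this]; exact Lp.coeFn_zero _ _ _
  | add x y _ _ hx hy =>
    obtain ⟨φ, h1, h2, h3, h4, h5⟩ := hx
    obtain ⟨ψ, k1, k2, k3, k4, k5⟩ := hy
    refine ⟨φ + ψ, h1.add k1, h2.add k2, (tsupport_add φ ψ).trans (union_subset h3 k3), ?_, ?_⟩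
    · exact (Lp.coeFn_add x.1 y.1).trans (h4.add k4)
    · have : gradient (φ + ψ) = gradient φ + gradient ψ := by
        ext1 z
        simp only [gradient, Pi.add_apply]
        rw [fderiv_add ((h1.differentiable (by simp)) z) ((k1.differentiable (by simp)) z), map_add]
      rw [this]
      exact (Lp.coeFn_add x.2 y.2).trans (h5.add k5)
  | smul a x _ hx =>
    obtain ⟨φ, h1, h2, h3, h4, h5⟩ := hx
    refine ⟨a • φ, contDiff_const.smul h1, h2.smul_left (f := fun _ => a),
      (closure_mono (Function.support_const_smul_subset a φ)).trans h3, ?_, ?_⟩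
    · exact (Lp.coeFn_smul a x.1).trans (h4.const_smul a)
    · have : gradient (a • φ) = a • gradient φ := by
        ext1 z
        simp only [gradient, Pi.smul_apply]
        rw [fderiv_const_smul ((h1.differentiable (by simp)) z), map_smul]
      rw [this]
      exact (Lp.coeFn_smul a x.2).trans (h5.const_smul a)

/-- The test pairs already form a subspace (`span_testPairs_le`), so H¹₀ is their closure, and
inequalities continuous in (v, ∇v) need checking only on smooth functions. -/
theorem H10_induction {P : L2 Ω × L2Vec Ω → Prop} (hP : IsClosed {p | P p})
    (h : ∀ p ∈ testPairs Ω, P p) (v : H10 Ω) : P (v : L2 Ω × L2Vec Ω) := by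
  have h1 : closure ((Submodule.span ℝ (testPairs Ω) : Submodule ℝ (L2 Ω × L2Vec Ω)) :
      Set (L2 Ω × L2Vec Ω)) ⊆ {p | P p} :=
    closure_minimal (fun p hp => h p (span_testPairs_le hp)) hP
  exact h1 v.2

theorem lintegral_gradient_eq {φ : EuclideanSpace ℝ (Fin N) → ℝ} (hΩ : MeasurableSet Ω)
    (hs : tsupport φ ⊆ Ω) :
    ∫⁻ x, ‖gradient φ x‖ₑ ^ 2 = ∫⁻ x in Ω, ‖gradient φ x‖ₑ ^ 2 := by
  rw [← lintegral_indicator hΩ]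
  refine lintegral_congr fun x => ?_
  by_cases hx : x ∈ Ω
  · rw [indicator_of_mem hx]
  · rw [indicator_of_notMem hx]
    have : fderiv ℝ φ x = 0 := by
      have h1 : x ∉ tsupport (fderiv ℝ φ) := fun h => hx (hs (tsupport_fderiv_subset ℝ h))
      exact image_eq_zero_of_notMem_tsupport h1
    simp [gradient, this]

theorem ofReal_norm_sq_fst {p : L2 Ω × L2Vec Ω} {φ : EuclideanSpace ℝ (Fin N) → ℝ}
    (h : p.1 =ᵐ[volume.restrict Ω] φ) :
    ENNReal.ofReal (‖p.1‖ ^ 2) = ∫⁻ x in Ω, ‖φ x‖ₑ ^ 2 := by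
  rw [ofReal_norm_sq_Lp]
  exact lintegral_congr_ae (h.mono fun x hx => by simp only [hx])

theorem ofReal_norm_sq_snd {p : L2 Ω × L2Vec Ω} {φ : EuclideanSpace ℝ (Fin N) → ℝ}
    (hΩ : MeasurableSet Ω) (hs : tsupport φ ⊆ Ω)
    (h : p.2 =ᵐ[volume.restrict Ω] gradient φ) :
    ENNReal.ofReal (‖p.2‖ ^ 2) = ∫⁻ x, ‖gradient φ x‖ₑ ^ 2 := by
  rw [ofReal_norm_sq_Lp, lintegral_gradient_eq hΩ hs]
  exact lintegral_congr_ae (h.mono fun x hx => by simp only [hx])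

/-- The Poincaré inequality. -/
theorem exists_poincare (hN : 1 ≤ N) (hΩ_open : IsOpen Ω) (hΩ_bdd : Bornology.IsBounded Ω) :
    ∃ C : ℝ, 0 < C ∧ ∀ v : H10 Ω, ‖v.fn‖ ^ 2 ≤ C * ‖v.grad‖ ^ 2 := by
  obtain ⟨R, hR0, hR⟩ := hΩ_bdd.exists_pos_norm_lt
  -- A shift by 2R moves Ω off itself: x and x + z cannot both have norm below R. So φ(x + z) = 0 on
  -- Ω, and the translation estimate bounds φ itself.
  set z : EuclideanSpace ℝ (Fin N) := EuclideanSpace.single ⟨0, hN⟩ (2 * R) with hz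
  have hzn : ‖z‖ = 2 * R := by
    simp [hz, abs_of_pos hR0]
  refine ⟨(2 * R) ^ 2, by positivity, fun v => ?_⟩
  refine H10_induction (P := fun p => ‖p.1‖ ^ 2 ≤ (2 * R) ^ 2 * ‖p.2‖ ^ 2)
    (isClosed_le (by fun_prop) (by fun_prop)) ?_ v
  rintro p ⟨φ, h1, -, h3, h4, h5⟩
  rw [← ENNReal.ofReal_le_ofReal_iff (by positivity), ENNReal.ofReal_mul (by positivity),
    ofReal_norm_sq_fst h4, ofReal_norm_sq_snd hΩ_open.measurableSet h3 h5]
  have e : ‖z‖ₑ ^ 2 = ENNReal.ofReal ((2 * R) ^ 2) := by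
    rw [← ofReal_norm, hzn, ← ENNReal.ofReal_pow (by positivity)]
  rw [← e]
  refine le_trans ?_ (lintegral_translation_sub_sq_le h1 z)
  refine le_trans ?_ (setLIntegral_le_lintegral Ω _)
  refine setLIntegral_mono' hΩ_open.measurableSet fun x hx => ?_
  have : φ (x + z) = 0 := by
    refine image_eq_zero_of_notMem_tsupport fun h => ?_
    have h6 := hR _ (h3 h)
    have h7 := hR x hx
    have h8 : ‖z‖ ≤ ‖x + z‖ + ‖x‖ := by
      calc ‖z‖ = ‖(x + z) - x‖ := by simp
        _ ≤ _ := norm_sub_le _ _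
    linarith
  rw [this, zero_sub, enorm_neg]

/-- The Rellich inequality: up to finitely many functionals, the `L²` norm is small compared with
the norm of the gradient. -/
theorem exists_rellich (hΩ_open : IsOpen Ω) (hΩ_bdd : Bornology.IsBounded Ω) {ε : ℝ}
    (hε : 0 < ε) :
    ∃ (t : Finset (EuclideanSpace ℝ (Fin N))) (k : EuclideanSpace ℝ (Fin N) → L2 Ω), ∀ v : H10 Ω,
      ‖v.fn‖ ^ 2 ≤ ε * ‖v.grad‖ ^ 2 + ∑ c ∈ t, ⟪k c, v.fn⟫_ℝ ^ 2 := by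
  -- 2^N (2δ)² is the constant of the averaged translation estimate, and the factor 2 comes from
  -- (a+b)² ≤ 2a² + 2b².
  obtain ⟨δ, hδ, hδε⟩ : ∃ δ : ℝ, 0 < δ ∧ 2 * (2 ^ N * (2 * δ) ^ 2) ≤ ε := by
    refine ⟨√(ε / (8 * 2 ^ N)), by positivity, le_of_eq ?_⟩
    rw [mul_pow, Real.sq_sqrt (by positivity)]
    field_simp
    norm_num
  obtain ⟨t, htf, ht⟩ := Metric.totallyBounded_iff.1
    (hΩ_bdd.isCompact_closure.totallyBounded.subset subset_closure) δ hδ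
  have hΩm := hΩ_open.measurableSet
  have hΩt : volume Ω ≠ ⊤ := hΩ_bdd.measure_lt_top.ne
  have hBt : ∀ c : EuclideanSpace ℝ (Fin N), (volume.restrict Ω) (Metric.ball c δ) ≠ ⊤ := fun c =>
    ((Measure.restrict_apply_le _ _).trans_lt measure_ball_lt_top).ne
  have hBm : ∀ c : EuclideanSpace ℝ (Fin N), MeasurableSet (Metric.ball c δ) := fun c =>
    Metric.isOpen_ball.measurableSet
  -- The functionals are the averages over the covering balls, scaled so that their squares absorb
  -- the factor 2|Ω| left by integrating a constant over Ω.
  refine ⟨htf.toFinset, fun c => (√(2 * volume.real Ω) * (volume.real (Metric.ball c δ))⁻¹) •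
    indicatorConstLp 2 (hBm c) (hBt c) (1 : ℝ), fun v => ?_⟩
  refine H10_induction (P := fun p => ‖p.1‖ ^ 2 ≤ ε * ‖p.2‖ ^ 2 + ∑ c ∈ htf.toFinset,
    ⟪(√(2 * volume.real Ω) * (volume.real (Metric.ball c δ))⁻¹) •
    indicatorConstLp 2 (hBm c) (hBt c) (1 : ℝ), p.1⟫_ℝ ^ 2)
    (isClosed_le (by fun_prop) (by fun_prop)) ?_ v
  rintro p ⟨φ, h1, -, h3, h4, h5⟩
  set A : EuclideanSpace ℝ (Fin N) → ℝ := fun c =>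
    (volume.real (Metric.ball c δ))⁻¹ * ∫ y in Metric.ball c δ, φ y with hA
  have hin : ∀ c, ⟪(√(2 * volume.real Ω) * (volume.real (Metric.ball c δ))⁻¹) •
      indicatorConstLp 2 (hBm c) (hBt c) (1 : ℝ), p.1⟫_ℝ ^ 2 = 2 * volume.real Ω * A c ^ 2 := by
    intro c
    have e1 : ∫ x in Metric.ball c δ, p.1 x ∂(volume.restrict Ω) =
        ∫ y in Metric.ball c δ, φ y := by
      rw [integral_congr_ae (ae_restrict_of_ae h4), Measure.restrict_restrict (hBm c)]
      symm
      refine setIntegral_eq_of_subset_of_forall_sdiff_eq_zero (hBm c)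
        inter_subset_left ?_
      intro x hx
      refine image_eq_zero_of_notMem_tsupport fun h => hx.2 ⟨hx.1, h3 h⟩
    rw [real_inner_smul_left, L2.inner_indicatorConstLp_one, e1, mul_assoc, mul_pow,
      Real.sq_sqrt (by positivity)]
  simp_rw [hin]
  rw [← ENNReal.ofReal_le_ofReal_iff (by positivity), ENNReal.ofReal_add (by positivity)
    (by positivity), ENNReal.ofReal_mul hε.le,
    ofReal_norm_sq_fst h4, ofReal_norm_sq_snd hΩm h3 h5]
  set I : EuclideanSpace ℝ (Fin N) → ℝ≥0∞ := fun x =>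
    (volume (Metric.ball (0 : EuclideanSpace ℝ (Fin N)) δ))⁻¹ *
        ∫⁻ z in Metric.ball (0 : EuclideanSpace ℝ (Fin N)) (2 * δ), ‖φ (x + z) - φ x‖ₑ ^ 2 with hI
  -- The ball containing x depends on x; summing over all balls of the cover gives a bound whose
  -- second term is constant.
  have hpt : ∀ x ∈ Ω, ‖φ x‖ₑ ^ 2 ≤ 2 * I x + ∑ c ∈ htf.toFinset, 2 * ‖A c‖ₑ ^ 2 := by
    intro x hx
    obtain ⟨c, hc, hxc⟩ := mem_iUnion₂.1 (ht hx)
    have e1 := enorm_sub_average_sq_le h1.continuous (Metric.mem_ball.1 hxc)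
    have e2 : 2 * ‖A c‖ₑ ^ 2 ≤ ∑ c ∈ htf.toFinset, 2 * ‖A c‖ₑ ^ 2 :=
      Finset.single_le_sum (f := fun c => 2 * ‖A c‖ₑ ^ 2) (fun _ _ => zero_le)
        (htf.mem_toFinset.2 hc)
    have e3 : ‖φ x‖ₑ ≤ ‖φ x - A c‖ₑ + ‖A c‖ₑ := by
      calc ‖φ x‖ₑ = ‖(φ x - A c) + A c‖ₑ := by simp
        _ ≤ _ := enorm_add_le _ _
    have e4 := ENNReal.rpow_add_le_mul_rpow_add_rpow ‖φ x - A c‖ₑ ‖A c‖ₑ (p := 2) (by norm_num)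
    norm_num at e4
    calc ‖φ x‖ₑ ^ 2 ≤ (‖φ x - A c‖ₑ + ‖A c‖ₑ) ^ 2 := by gcongr
      _ ≤ 2 * (‖φ x - A c‖ₑ ^ 2 + ‖A c‖ₑ ^ 2) := by exact_mod_cast e4
      _ = 2 * ‖φ x - A c‖ₑ ^ 2 + 2 * ‖A c‖ₑ ^ 2 := by ring
      _ ≤ _ := by gcongr
  have hAe : ∀ c, ‖A c‖ₑ ^ 2 = ENNReal.ofReal (A c ^ 2) := fun c => by
    rw [← sq_abs, ENNReal.ofReal_pow (abs_nonneg _), ← Real.norm_eq_abs, ofReal_norm]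
  calc ∫⁻ x in Ω, ‖φ x‖ₑ ^ 2
      ≤ ∫⁻ x in Ω, (2 * I x + ∑ c ∈ htf.toFinset, 2 * ‖A c‖ₑ ^ 2) :=
        setLIntegral_mono' hΩm hpt
    _ = 2 * (∫⁻ x in Ω, I x) + volume Ω * ∑ c ∈ htf.toFinset, 2 * ‖A c‖ₑ ^ 2 := by
        rw [lintegral_add_right _ measurable_const, lintegral_const_mul' _ _ (by simp),
          setLIntegral_const, mul_comm (volume Ω)]
    _ ≤ ENNReal.ofReal ε * (∫⁻ x, ‖gradient φ x‖ₑ ^ 2) +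
        volume Ω * ∑ c ∈ htf.toFinset, 2 * ‖A c‖ₑ ^ 2 := by
        refine add_le_add_left ?_ _
        refine (mul_le_mul_right (lintegral_lintegral_translation_le h1 Ω hδ) 2).trans ?_
        have h2 : 2 * ENNReal.ofReal (2 ^ N * (2 * δ) ^ 2) ≤ ENNReal.ofReal ε := by
          refine le_trans (le_of_eq ?_) (ENNReal.ofReal_le_ofReal hδε)
          rw [ENNReal.ofReal_mul two_pos.le, ENNReal.ofReal_ofNat]
        rw [← mul_assoc]
        exact mul_le_mul_left h2 _
    _ = _ := by
        congr 1
        rw [ENNReal.ofReal_sum_of_nonneg (fun _ _ => by positivity), Finset.mul_sum]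
        refine Finset.sum_congr rfl fun c _ => ?_
        rw [hAe, ENNReal.ofReal_mul (by positivity), ENNReal.ofReal_mul (by norm_num),
          measureReal_def, ENNReal.ofReal_toReal hΩt]
        simp only [ENNReal.ofReal_ofNat]
        ring

end Sobolev

end RLWave
end

noncomputable section

namespace RLWave

/-! ### Existence of the Dirichlet eigenbasis -/

/-! ### Compactness and eigenvectors in abstract Hilbert spaces. -/

section Hilbert

variable {H K : Type*} [NormedAddCommGroup H] [InnerProductSpace ℝ H]
  [NormedAddCommGroup K] [InnerProductSpace ℝ K]

/-- Compose T with the projection onto the span of the k_c. On the orthogonal complement the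
functionals vanish, so there T has norm at most ε. -/
theorem exists_isCompactOperator_near {T : H →L[ℝ] K} {ι : Type*} {ε : ℝ} (hε : 0 < ε)
    {t : Finset ι} {k : ι → H}
    (h : ∀ v, ‖T v‖ ^ 2 ≤ ε ^ 2 * ‖v‖ ^ 2 + ∑ c ∈ t, ⟪k c, v⟫_ℝ ^ 2) :
    ∃ F : H →L[ℝ] K, IsCompactOperator F ∧ ‖F - T‖ ≤ ε := by
  set W : Submodule ℝ H := Submodule.span ℝ (k '' t) with hW
  have : FiniteDimensional ℝ W := FiniteDimensional.span_of_finite ℝ (t.finite_toSet.image k)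
  refine ⟨T ∘L W.subtypeL ∘L W.orthogonalProjectionOnto, ?_, ?_⟩
  · have : LocallyCompactSpace W := by
      have := FiniteDimensional.proper_real W
      infer_instance
    exact (isCompactOperator_of_locallyCompactSpace_dom W.orthogonalProjectionOnto).clm_comp
      (T ∘L W.subtypeL)
  · refine ContinuousLinearMap.opNorm_le_bound _ hε.le fun v => ?_
    set q : H := v - W.orthogonalProjectionOnto v with hq
    have e1 : ((T ∘L W.subtypeL ∘L W.orthogonalProjectionOnto) - T) v = -T q := by
      simp [hq]
    have hqW : q ∈ Wᗮ := W.sub_starProjection_mem_orthogonal v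
    have e2 : ∑ c ∈ t, ⟪k c, q⟫_ℝ ^ 2 = 0 := by
      refine Finset.sum_eq_zero fun c hc => ?_
      rw [hqW (k c) (Submodule.subset_span ⟨c, hc, rfl⟩)]
      simp
    have e3 := h q
    rw [e2, add_zero, ← mul_pow] at e3
    have e4 : ‖T q‖ ≤ ε * ‖q‖ := le_of_sq_le_sq e3 (by positivity)
    have e5 : ‖q‖ ≤ ‖v‖ := by
      have h1 : ‖v‖ ^ 2 = ‖(W.orthogonalProjectionOnto v : H)‖ ^ 2 + ‖q‖ ^ 2 := by
        have : ⟪(W.orthogonalProjectionOnto v : H), q⟫_ℝ = 0 := hqW _ (W.orthogonalProjectionOnto v).2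
        have h2 := norm_add_sq_real (W.orthogonalProjectionOnto v : H) q
        rw [this] at h2
        have h3 : (W.orthogonalProjectionOnto v : H) + q = v := by simp [hq]
        rw [h3] at h2
        linarith
      exact le_of_sq_le_sq (by nlinarith [sq_nonneg ‖(W.orthogonalProjectionOnto v : H)‖])
        (norm_nonneg _)
    rw [e1, norm_neg]
    exact e4.trans (by gcongr)

theorem isCompactOperator_of_rellich [CompleteSpace K] {T : H →L[ℝ] K} {ι : Type*}
    (h : ∀ ε : ℝ, 0 < ε → ∃ (t : Finset ι) (k : ι → H),
      ∀ v, ‖T v‖ ^ 2 ≤ ε ^ 2 * ‖v‖ ^ 2 + ∑ c ∈ t, ⟪k c, v⟫_ℝ ^ 2) :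
    IsCompactOperator T := by
  have h1 : ∀ n : ℕ, ∃ F : H →L[ℝ] K, IsCompactOperator F ∧ ‖F - T‖ ≤ 1 / ((n : ℝ) + 1) := by
    intro n
    obtain ⟨t, k, hk⟩ := h (1 / ((n : ℝ) + 1)) (by positivity)
    exact exists_isCompactOperator_near (by positivity) hk
  choose F hF hFT using h1
  have hlim : Tendsto F atTop (𝓝 T) := by
    rw [tendsto_iff_norm_sub_tendsto_zero]
    exact squeeze_zero (fun _ => norm_nonneg _) hFT tendsto_one_div_add_atTop_nhds_zero_nat
  exact isCompactOperator_of_tendsto hlim (Eventually.of_forall hF)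

/-- Orthonormal vectors are √2 apart, so balls of radius 1/2 about them are disjoint nonempty open
sets. -/
theorem countable_of_orthonormal [TopologicalSpace.SeparableSpace K] {J : Type*} {v : J → K}
    (hv : Orthonormal ℝ v) : Countable J := by
  refine Pairwise.countable_of_isOpen_disjoint (s := fun j => Metric.ball (v j) (1 / 2)) ?_
    (fun j => Metric.isOpen_ball) (fun j => ⟨v j, by simp⟩)
  intro i j hij
  refine Metric.ball_disjoint_ball ?_
  have h1 : ‖v i - v j‖ ^ 2 = 2 := by
    rw [norm_sub_sq_real, hv.1 i, hv.1 j, hv.2 hij]; norm_num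
  rw [dist_eq_norm]
  nlinarith [norm_nonneg (v i - v j)]

theorem infinite_of_orthonormal_dense (hK : ¬ FiniteDimensional ℝ K) {J : Type*} {v : J → K}
    (hd : (Submodule.span ℝ (range v)).topologicalClosure = ⊤) : Infinite J := by
  by_contra hJ
  rw [not_infinite_iff_finite] at hJ
  have : FiniteDimensional ℝ (Submodule.span ℝ (range v)) :=
    FiniteDimensional.span_of_finite ℝ (finite_range v)
  have hc : IsClosed ((Submodule.span ℝ (range v) : Submodule ℝ K) : Set K) :=
    Submodule.closed_of_finiteDimensional _
  rw [hc.submodule_topologicalClosure_eq] at hd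
  rw [hd] at this
  exact hK (Module.Finite.equiv Submodule.topEquiv)

/-- An orthonormal basis of eigenvectors of `T T*`, for `T` compact with dense range. -/
theorem exists_eigenbasis [CompleteSpace H] [CompleteSpace K]
    [TopologicalSpace.SeparableSpace K] (hK : ¬ FiniteDimensional ℝ K)
    {T : H →L[ℝ] K} (hT : IsCompactOperator T)
    (hinj : ∀ f : K, (∀ v, ⟪f, T v⟫_ℝ = 0) → f = 0) :
    ∃ (f : ℕ → K) (κ : ℕ → ℝ), Orthonormal ℝ f ∧
      (Submodule.span ℝ (range f)).topologicalClosure = ⊤ ∧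
      ∀ n, κ n ≠ 0 ∧ T (ContinuousLinearMap.adjoint T (f n)) = κ n • f n := by
  set S : K →L[ℝ] K := T ∘L ContinuousLinearMap.adjoint T with hS
  have hSc : IsCompactOperator S := hT.comp_clm (ContinuousLinearMap.adjoint T)
  have hSs : (S : K →ₗ[ℝ] K).IsSymmetric :=
    (ContinuousLinearMap.isPositive_self_comp_adjoint T).isSelfAdjoint.isSymmetric
  have hbot := ContinuousLinearMap.orthogonalComplement_iSup_eigenspaces_eq_bot hSc hSs
  have hcomp : ∀ c : ℝ, CompleteSpace (Module.End.eigenspace (S : K →ₗ[ℝ] K) c) := by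
    intro c
    refine IsClosed.completeSpace_coe (hs := ?_)
    have : ((Module.End.eigenspace (S : K →ₗ[ℝ] K) c : Submodule ℝ K) : Set K) =
        {x | S x = c • x} := by
      ext x; simp
    rw [this]
    exact isClosed_eq S.continuous (continuous_const_smul c)
  choose w b hb using fun c : ℝ =>
    exists_hilbertBasis ℝ (Module.End.eigenspace (S : K →ₗ[ℝ] K) c)
  set v : (Σ c : ℝ, w c) → K := fun a =>
    (Module.End.eigenspace (S : K →ₗ[ℝ] K) a.1).subtypeₗᵢ (b a.1 a.2) with hv
  have hvo : Orthonormal ℝ v :=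
    hSs.orthogonalFamily_eigenspaces.orthonormal_sigma_orthonormal
      (v_family := fun c => b c) fun c => (b c).orthonormal
  have hvd : (Submodule.span ℝ (range v)).topologicalClosure = ⊤ := by
    rw [Submodule.topologicalClosure_eq_top_iff, eq_bot_iff, ← hbot]
    intro x hx
    rw [Submodule.mem_orthogonal]
    intro u hu
    induction hu using Submodule.iSup_induction' with
    | mem c y hy =>
      have h1 := ((b c).hasSum_repr ⟨y, hy⟩).mapL
        ((innerSL ℝ x) ∘L (Module.End.eigenspace (S : K →ₗ[ℝ] K) c).subtypeL)
      have h2 : ∀ i, ((innerSL ℝ x) ∘L (Module.End.eigenspace (S : K →ₗ[ℝ] K) c).subtypeL)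
          ((b c).repr ⟨y, hy⟩ i • (b c) i) = 0 := by
        intro i
        have h3 : ⟪v ⟨c, i⟩, x⟫_ℝ = 0 := hx _ (Submodule.subset_span ⟨_, rfl⟩)
        have h4 : ⟪x, ((b c i : Module.End.eigenspace (S : K →ₗ[ℝ] K) c) : K)⟫_ℝ = 0 := by
          rw [real_inner_comm]; exact h3
        rw [map_smul]
        simp [h4]
      simp_rw [h2] at h1
      have h5 := h1.unique hasSum_zero
      rw [real_inner_comm]
      simpa using h5
    | zero => simp
    | add y z _ _ hy hz => rw [inner_add_left, hy, hz, add_zero]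
  -- The index set of the collected bases of the eigenspaces is countable and infinite, which
  -- permits an enumeration by ℕ.
  have : Countable (Σ c : ℝ, w c) := countable_of_orthonormal hvo
  have : Infinite (Σ c : ℝ, w c) := infinite_of_orthonormal_dense hK hvd
  obtain ⟨_⟩ := nonempty_denumerable (Σ c : ℝ, w c)
  set σ : ℕ ≃ (Σ c : ℝ, w c) := (Denumerable.eqv _).symm with hσ
  refine ⟨v ∘ σ, fun n => (σ n).1, hvo.comp σ σ.injective, ?_, fun n => ?_⟩
  · rw [σ.surjective.range_comp, hvd]
  · have hmem : v (σ n) ∈ Module.End.eigenspace (S : K →ₗ[ℝ] K) (σ n).1 := (b _ _).2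
    have hSv : S (v (σ n)) = (σ n).1 • v (σ n) := Module.End.mem_eigenspace_iff.1 hmem
    -- If TT*f = 0 then ‖T*f‖² = ⟨f, TT*f⟩ = 0, so f is orthogonal to the range of T and vanishes.
    refine ⟨fun h0 => ?_, hSv⟩
    beta_reduce at h0
    rw [h0, zero_smul] at hSv
    have h1 : ContinuousLinearMap.adjoint T (v (σ n)) = 0 := by
      rw [← inner_self_eq_zero (𝕜 := ℝ), ContinuousLinearMap.adjoint_inner_left]
      have : T (ContinuousLinearMap.adjoint T (v (σ n))) = 0 := hSv
      rw [this, inner_zero_right]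
    have h2 : v (σ n) = 0 := hinj _ fun u => by
      rw [← ContinuousLinearMap.adjoint_inner_left, h1, inner_zero_left]
    have h3 := hvo.1 (σ n)
    rw [h2, norm_zero] at h3
    exact zero_ne_one h3

end Hilbert

/-! ### The inclusion of H¹₀(Ω) into L²(Ω) and its eigenfunctions. -/

section Domain

variable {N : ℕ} {Ω : Set (EuclideanSpace ℝ (Fin N))}

/-- Indicators of infinitely many disjoint open annuli inside Ω. This ensures that the eigenbasis is
indexed by all of ℕ. -/
theorem not_finiteDimensional_L2 (hN : 1 ≤ N) (hΩ_open : IsOpen Ω) (hΩ_ne : Ω.Nonempty) :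
    ¬ FiniteDimensional ℝ (L2 Ω) := by
  intro hfin
  obtain ⟨x, hx⟩ := hΩ_ne
  obtain ⟨R, hR, hRΩ⟩ := Metric.isOpen_iff.1 hΩ_open x hx
  have : Nonempty (Fin N) := ⟨⟨0, hN⟩⟩
  set r : ℕ → ℝ := fun n => R / (n + 1) with hr
  have hrpos : ∀ n, 0 < r n := fun n => by positivity
  have hranti : ∀ m n, m < n → r n < r m := fun m n hmn => by
    have : (m : ℝ) < n := by exact_mod_cast hmn
    exact div_lt_div_of_pos_left hR (by positivity) (by linarith)
  set A : ℕ → Set (EuclideanSpace ℝ (Fin N)) := fun n =>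
    Metric.ball x (r n) \ Metric.closedBall x (r (n + 1)) with hA
  have hAo : ∀ n, IsOpen (A n) := fun n => Metric.isOpen_ball.sdiff Metric.isClosed_closedBall
  have hAsub : ∀ n, A n ⊆ Ω := fun n => sdiff_subset.trans ((Metric.ball_subset_ball (by
    rw [hr]; exact div_le_self hR.le (by linarith [n.cast_nonneg (α := ℝ)]))).trans hRΩ)
  have hAne : ∀ n, (A n).Nonempty := by
    intro n
    obtain ⟨y, hy⟩ := (NormedSpace.sphere_nonempty (x := x) (r := (r n + r (n + 1)) / 2)).2
      (by have := hrpos n; have := hrpos (n + 1); positivity)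
    have h1 := hranti n (n + 1) (Nat.lt_succ_self n)
    rw [Metric.mem_sphere] at hy
    refine ⟨y, ?_, ?_⟩
    · rw [Metric.mem_ball, hy]; linarith
    · rw [Metric.mem_closedBall, hy]; linarith
  have hAdisj : ∀ m n, m < n → Disjoint (A m) (A n) := by
    intro m n hmn
    rw [Set.disjoint_left]
    intro y hy hy'
    have h1 := Metric.mem_ball.1 hy'.1
    have h2 := hy.2
    rw [Metric.mem_closedBall, not_le] at h2
    have h3 : r n ≤ r (m + 1) := by
      rcases (Nat.succ_le_of_lt hmn).eq_or_lt with h | h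
      · rw [← h]
      · exact (hranti _ _ h).le
    linarith
  have hAt : ∀ n, (volume.restrict Ω) (A n) ≠ ⊤ := fun n =>
    (((Measure.restrict_apply_le _ _).trans (measure_mono sdiff_subset)).trans_lt
      measure_ball_lt_top).ne
  set g : ℕ → L2 Ω := fun n => indicatorConstLp 2 (hAo n).measurableSet (hAt n) (1 : ℝ) with hg
  have hgi : ∀ m n, ⟪g m, g n⟫_ℝ = (volume.restrict Ω).real (A m ∩ A n) := by
    intro m n
    rw [hg]
    simp only
    rw [L2.inner_indicatorConstLp_one, setIntegral_indicatorConstLp (hAo m).measurableSet]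
    simp [inter_comm]
  have hlin : LinearIndependent ℝ g := by
    refine linearIndependent_of_ne_zero_of_inner_eq_zero (𝕜 := ℝ) (fun n h0 => ?_) fun m n hmn => ?_
    · have h1 := hgi n n
      rw [h0, inner_zero_left, inter_self, measureReal_def, eq_comm, ENNReal.toReal_eq_zero_iff] at h1
      rcases h1 with h1 | h1
      · rw [Measure.restrict_apply (hAo n).measurableSet, inter_eq_self_of_subset_left (hAsub n)] at h1
        exact ((hAo n).measure_pos volume (hAne n)).ne' h1
      · exact hAt n h1
    · beta_reduce
      rw [hgi]
      have : A m ∩ A n = ∅ := by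
        rcases lt_or_gt_of_ne hmn with h | h
        · exact (hAdisj m n h).inter_eq
        · rw [inter_comm]; exact (hAdisj n m h).inter_eq
      simp [this]
  exact Module.Finite.not_linearIndependent_of_infinite g hlin

theorem exists_testPair {φ : EuclideanSpace ℝ (Fin N) → ℝ} (h1 : ContDiff ℝ ∞ φ)
    (h2 : HasCompactSupport φ) (h3 : tsupport φ ⊆ Ω) :
    ∃ v : H10 Ω, v.fn =ᵐ[volume.restrict Ω] φ := by
  have hm1 : MemLp φ 2 (volume.restrict Ω) := h1.continuous.memLp_of_hasCompactSupport h2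
  have hgs : HasCompactSupport (gradient φ) :=
    (h2.fderiv (𝕜 := ℝ)).comp_left (g := (InnerProductSpace.toDual ℝ _).symm) (map_zero _)
  have hm2 : MemLp (gradient φ) 2 (volume.restrict Ω) :=
    (continuous_gradient h1).memLp_of_hasCompactSupport hgs
  refine ⟨⟨(hm1.toLp φ, hm2.toLp _), ?_⟩, hm1.coeFn_toLp⟩
  refine Submodule.le_topologicalClosure _ (Submodule.subset_span ?_)
  exact ⟨φ, h1, h2, h3, hm1.coeFn_toLp, hm2.coeFn_toLp⟩

/-- H¹₀(Ω) is dense in L²(Ω) because it contains the test functions; this is the dense-range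
condition of `exists_eigenbasis`. -/
theorem eq_zero_of_inner_H10 (hΩ_open : IsOpen Ω) (hΩ_bdd : Bornology.IsBounded Ω) {f : L2 Ω}
    (h : ∀ v : H10 Ω, ⟪f, v.fn⟫_ℝ = 0) : f = 0 := by
  have hΩm := hΩ_open.measurableSet
  have : IsFiniteMeasure (volume.restrict Ω) := by
    rw [isFiniteMeasure_restrict]; exact hΩ_bdd.measure_lt_top.ne
  have hintg : IntegrableOn f Ω := (Lp.memLp f).integrable (by norm_num)
  have key := hΩ_open.ae_eq_zero_of_integral_contDiff_smul_eq_zero (f := f) (μ := volume)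
    hintg.locallyIntegrableOn fun φ h1 h2 h3 => by
      obtain ⟨v, hv⟩ := exists_testPair (Ω := Ω) h1 h2 h3
      have e := h v
      rw [L2.inner_def] at e
      rw [← setIntegral_eq_integral_of_forall_compl_eq_zero (s := Ω), ← e]
      · refine integral_congr_ae (hv.mono fun x hx => ?_)
        simp [hx]
      · intro x hx
        rw [image_eq_zero_of_notMem_tsupport fun h => hx (h3 h), zero_smul]
  rw [Lp.eq_zero_iff_ae_eq_zero]
  exact (ae_restrict_iff' hΩm).2 key

theorem exists_isDirichletEigenbasis (hN : 1 ≤ N) (hΩ_open : IsOpen Ω)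
    (hΩ_bdd : Bornology.IsBounded Ω) (hΩ_ne : Ω.Nonempty) :
    ∃ (e : ℕ → H10 Ω) (lam : ℕ → ℝ), IsDirichletEigenbasis Ω e lam := by
  -- `H10` carries the sup norm of the product. The ℓ² product norm gives the same space with the
  -- inner product ⟨v,w⟩ + ⟨∇v,∇w⟩.
  set L := WithLp.prodContinuousLinearEquiv 2 ℝ (L2 Ω) (L2Vec Ω) with hL
  set V : Submodule ℝ (WithLp 2 (L2 Ω × L2Vec Ω)) := (H10Sub Ω).comap L.toLinearMap with hV
  have hVc : IsClosed (V : Set (WithLp 2 (L2 Ω × L2Vec Ω))) :=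
    (Submodule.isClosed_topologicalClosure _).preimage L.continuous
  have : CompleteSpace V := hVc.completeSpace_coe
  set T : V →L[ℝ] L2 Ω := (ContinuousLinearMap.fst ℝ (L2 Ω) (L2Vec Ω)) ∘L
    (L : WithLp 2 (L2 Ω × L2Vec Ω) →L[ℝ] L2 Ω × L2Vec Ω) ∘L V.subtypeL with hT
  set toH : V → H10 Ω := fun v => ⟨L v, v.2⟩ with htoH
  have hTfn : ∀ v, T v = (toH v).fn := fun v => rfl
  have hinner : ∀ v w : V, ⟪v, w⟫_ℝ = ⟪(toH v).fn, (toH w).fn⟫_ℝ + ⟪(toH v).grad, (toH w).grad⟫_ℝ :=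
    fun v w => WithLp.prod_inner_apply (v : WithLp 2 (L2 Ω × L2Vec Ω)) w
  have hsurj : ∀ φ : H10 Ω, ∃ w : V, toH w = φ := fun φ =>
    ⟨⟨L.symm φ, by simp [hV]⟩, by simp [htoH]⟩
  have hcpt : IsCompactOperator T := by
    refine isCompactOperator_of_rellich (ι := EuclideanSpace ℝ (Fin N)) fun ε hε => ?_
    obtain ⟨t, k, hk⟩ := exists_rellich hΩ_open hΩ_bdd (pow_pos hε 2)
    refine ⟨t, fun c => ContinuousLinearMap.adjoint T (k c), fun v => ?_⟩
    simp_rw [ContinuousLinearMap.adjoint_inner_left]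
    refine (hk (toH v)).trans ?_
    have : ‖(toH v).grad‖ ^ 2 ≤ ‖v‖ ^ 2 := by
      rw [← real_inner_self_eq_norm_sq v, hinner, real_inner_self_eq_norm_sq,
        real_inner_self_eq_norm_sq]
      linarith [sq_nonneg ‖(toH v).fn‖]
    exact add_le_add_left (mul_le_mul_of_nonneg_left this (by positivity)) _
  have : Fact ((2 : ℝ≥0∞) ≠ ⊤) := ⟨by simp⟩
  have : TopologicalSpace.SeparableSpace (L2 Ω) :=
    TopologicalSpace.SecondCountableTopology.to_separableSpace
  obtain ⟨f, κ, hfo, hfd, hfκ⟩ := exists_eigenbasis (not_finiteDimensional_L2 hN hΩ_open hΩ_ne) hcpt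
    fun f hf => eq_zero_of_inner_H10 hΩ_open hΩ_bdd fun φ => by
      obtain ⟨w, hw⟩ := hsurj φ
      rw [← hw]; exact hf w
  -- TT*f = κf says that κ⁻¹T*f is a lift of f to H¹₀. Its pairing with w in the full H¹ product is
  -- κ⁻¹⟨f,w⟩; subtracting the L² part leaves the Dirichlet eigenvalue κ⁻¹ - 1.
  set g : ℕ → V := fun n => (κ n)⁻¹ • ContinuousLinearMap.adjoint T (f n) with hg
  have hgf : ∀ n, (toH (g n)).fn = f n := fun n => by
    rw [← hTfn, hg]
    simp only
    rw [map_smul, (hfκ n).2, smul_smul, inv_mul_cancel₀ (hfκ n).1, one_smul]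
  refine ⟨fun n => toH (g n), fun n => (κ n)⁻¹ - 1, ⟨?_, ?_, ?_⟩⟩
  · simp_rw [hgf]; exact hfo
  · simp_rw [hgf]; exact hfd
  · intro n φ
    obtain ⟨w, rfl⟩ := hsurj φ
    have h1 := hinner (g n) w
    rw [hgf] at h1 ⊢
    have h2 : ⟪g n, w⟫_ℝ = (κ n)⁻¹ * ⟪f n, (toH w).fn⟫_ℝ := by
      refine (real_inner_smul_left (F := V) _ _ _).trans ?_
      rw [ContinuousLinearMap.adjoint_inner_left, hTfn]
    linarith

end Domain

/-! ### A positive lower bound for the eigenvalues. -/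

section Eigenvalues

variable {N : ℕ} {Ω : Set (EuclideanSpace ℝ (Fin N))} {e : ℕ → H10 Ω} {lam : ℕ → ℝ}

/-- Poincaré at e_n reads 1 ≤ C‖∇e_n‖² = Cλ_n. -/
theorem IsDirichletEigenbasis.exists_le_lam (h : IsDirichletEigenbasis Ω e lam) (hN : 1 ≤ N)
    (hΩ_open : IsOpen Ω) (hΩ_bdd : Bornology.IsBounded Ω) :
    ∃ c : ℝ, 0 < c ∧ ∀ n, c ≤ lam n := by
  obtain ⟨C, hC, hP⟩ := exists_poincare hN hΩ_open hΩ_bdd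
  refine ⟨C⁻¹, by positivity, fun n => ?_⟩
  have h1 := h.eigen n (e n)
  rw [real_inner_self_eq_norm_sq, real_inner_self_eq_norm_sq, h.orthonormal.1 n] at h1
  have h2 := hP (e n)
  rw [h.orthonormal.1 n, h1] at h2
  rw [inv_le_iff_one_le_mul₀ hC]
  linarith

end Eigenvalues

end RLWave
end

noncomputable section

namespace RLWave

/-! ### Riemann–Liouville integrals of integrable functions -/

theorem integrableOn_sub_rpow_mul_sub_rpow {β γ : ℝ} (hβ : 0 < β) (hγ : 0 < γ) {s T : ℝ}
    (h : s < T) : IntegrableOn (fun t => (T - t) ^ (β - 1) * (t - s) ^ (γ - 1)) (Ioo s T) := by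
  have h1 := integrableOn_rpow_mul_sub_rpow hβ hγ (sub_pos.2 h)
  rw [← intervalIntegrable_iff_integrableOn_Ioo_of_le (sub_pos.2 h).le] at h1
  rw [← intervalIntegrable_iff_integrableOn_Ioo_of_le h.le]
  have := h1.comp_sub_right s
  simpa using this

theorem integral_sub_rpow_mul_sub_rpow {β γ : ℝ} (hβ : 0 < β) (hγ : 0 < γ) {s T : ℝ}
    (h : s < T) : ∫ t in Ioo s T, (T - t) ^ (β - 1) * (t - s) ^ (γ - 1) =
      (T - s) ^ (β + γ - 1) * (Real.Gamma β * Real.Gamma γ / Real.Gamma (β + γ)) := by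
  rw [← integral_rpow_mul_sub_rpow hβ hγ (sub_pos.2 h), ← integral_Ioc_eq_integral_Ioo,
    ← integral_Ioc_eq_integral_Ioo, ← intervalIntegral.integral_of_le h.le,
    ← intervalIntegral.integral_of_le (sub_pos.2 h).le]
  have := intervalIntegral.integral_comp_sub_right (a := s) (b := T)
    (fun r => (T - s - r) ^ (β - 1) * r ^ (γ - 1)) s
  simpa using this

section Volterra

variable {F : Type*} [NormedAddCommGroup F] [NormedSpace ℝ F]

/-- The integrand of the iterated integral `∫₀ᵀ (T-t)^{β-1} ∫₀ᵗ (t-s)^{γ-1} u(s) ds dt`. -/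
def volterra (T β γ : ℝ) (u : ℝ → F) (t s : ℝ) : F :=
  (Iio t).indicator (fun s => ((T - t) ^ (β - 1) * (t - s) ^ (γ - 1)) • u s) s

theorem volterra_swap (T β γ : ℝ) (u : ℝ → F) (t s : ℝ) :
    volterra T β γ u t s =
      (Ioi s).indicator (fun t => ((T - t) ^ (β - 1) * (t - s) ^ (γ - 1)) • u s) t := by
  simp only [volterra, indicator, mem_Iio, mem_Ioi]

theorem integral_volterra_right {T β γ : ℝ} {u : ℝ → F} {t : ℝ} (ht : t ∈ Ioo 0 T) :
    ∫ s in Ioo 0 T, volterra T β γ u t s =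
      (T - t) ^ (β - 1) • ∫ s in Ioo 0 t, (t - s) ^ (γ - 1) • u s := by
  unfold volterra
  rw [setIntegral_indicator measurableSet_Iio, Ioo_inter_Iio, inf_of_le_right ht.2.le,
    ← integral_smul]
  simp_rw [smul_smul]

theorem rlIntegral_congr_ae {T β : ℝ} {u v : ℝ → F} (h : u =ᵐ[volume.restrict (Ioo 0 T)] v)
    {t : ℝ} (ht : t ≤ T) : rlIntegral β u t = rlIntegral β v t := by
  unfold rlIntegral
  congr 1
  refine integral_congr_ae ?_
  filter_upwards [ae_restrict_of_ae_restrict_of_subset (Ioo_subset_Ioo_right ht) h] with s hs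
  rw [hs]

theorem rlIntegral_const_smul (β c : ℝ) (u : ℝ → F) (t : ℝ) :
    rlIntegral β (fun s => c • u s) t = c • rlIntegral β u t := by
  unfold rlIntegral
  simp_rw [smul_comm _ c]
  rw [integral_smul, smul_comm]

theorem integral_volterra_left {T β γ : ℝ} (hβ : 0 < β) (hγ : 0 < γ) {u : ℝ → F} {s : ℝ}
    [CompleteSpace F] (hs : s ∈ Ioo 0 T) : ∫ t in Ioo 0 T, volterra T β γ u t s =
      ((T - s) ^ (β + γ - 1) * (Real.Gamma β * Real.Gamma γ / Real.Gamma (β + γ))) • u s := by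
  simp_rw [volterra_swap]
  rw [setIntegral_indicator measurableSet_Ioi, Ioo_inter_Ioi, sup_of_le_right hs.1.le,
    integral_smul_const, integral_sub_rpow_mul_sub_rpow hβ hγ hs.2]

/-- Integrating in t first gives a multiple of (T-s)^{β+γ-1}‖u(s)‖. The power is bounded because β +
γ ≥ 1, so Fubini and the semigroup property hold at the given endpoint T and not merely almost
everywhere. -/
theorem integrable_volterra {T β γ : ℝ} (hβ : 0 < β) (hγ : 0 < γ) (hβγ : 1 ≤ β + γ)
    {u : ℝ → F} (hu : IntegrableOn u (Ioo 0 T)) :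
    Integrable (Function.uncurry (volterra T β γ u))
      ((volume.restrict (Ioo 0 T)).prod (volume.restrict (Ioo 0 T))) := by
  have hm : AEStronglyMeasurable (Function.uncurry (volterra T β γ u))
      ((volume.restrict (Ioo 0 T)).prod (volume.restrict (Ioo 0 T))) := by
    have : Function.uncurry (volterra T β γ u) = {p : ℝ × ℝ | p.2 < p.1}.indicator
        fun p => ((T - p.1) ^ (β - 1) * (p.1 - p.2) ^ (γ - 1)) • u p.2 := by
      ext p; simp [volterra, indicator, Function.uncurry]
    rw [this]
    refine AEStronglyMeasurable.indicator ?_ (measurableSet_lt measurable_snd measurable_fst)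
    refine AEStronglyMeasurable.smul ?_ hu.aestronglyMeasurable.comp_snd
    exact Measurable.aestronglyMeasurable (by fun_prop)
  rw [integrable_prod_iff' hm]
  have hnorm : ∀ t s, t ∈ Ioo 0 T → ‖volterra T β γ u t s‖ = volterra T β γ (fun s => ‖u s‖) t s := by
    intro t s ht
    unfold volterra
    by_cases hs : s ∈ Iio t
    · rw [indicator_of_mem hs, indicator_of_mem hs, norm_smul, Real.norm_of_nonneg, smul_eq_mul]
      exact mul_nonneg (Real.rpow_nonneg (sub_pos.2 ht.2).le _)
        (Real.rpow_nonneg (sub_pos.2 hs).le _)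
    · rw [indicator_of_notMem hs, indicator_of_notMem hs, norm_zero]
  constructor
  · filter_upwards [ae_restrict_mem measurableSet_Ioo] with s hs
    simp only [Function.uncurry, volterra_swap]
    rw [integrable_indicator_iff measurableSet_Ioi, IntegrableOn,
      Measure.restrict_restrict measurableSet_Ioi, inter_comm, Ioo_inter_Ioi,
      sup_of_le_right hs.1.le]
    exact (integrableOn_sub_rpow_mul_sub_rpow hβ hγ hs.2).smul_const _
  · have h1 : Integrable (fun s => ((T - s) ^ (β + γ - 1) *
        (Real.Gamma β * Real.Gamma γ / Real.Gamma (β + γ))) * ‖u s‖)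
        (volume.restrict (Ioo 0 T)) := by
      refine hu.norm.bdd_mul
        (c := T ^ (β + γ - 1) * (Real.Gamma β * Real.Gamma γ / Real.Gamma (β + γ))) ?_ ?_
      · exact Measurable.aestronglyMeasurable (by fun_prop)
      · filter_upwards [ae_restrict_mem measurableSet_Ioo] with s hs
        have hB : 0 ≤ Real.Gamma β * Real.Gamma γ / Real.Gamma (β + γ) := by
          have := Real.Gamma_pos_of_pos hβ
          have := Real.Gamma_pos_of_pos hγ
          have := Real.Gamma_pos_of_pos (add_pos hβ hγ)
          positivity
        have h2 : 0 ≤ T - s := (sub_pos.2 hs.2).le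
        rw [Real.norm_of_nonneg (mul_nonneg (Real.rpow_nonneg h2 _) hB)]
        refine mul_le_mul_of_nonneg_right ?_ hB
        exact Real.rpow_le_rpow h2 (by linarith [hs.1]) (by linarith)
    refine h1.congr ?_
    filter_upwards [ae_restrict_mem measurableSet_Ioo] with s hs
    rw [← smul_eq_mul, ← integral_volterra_left hβ hγ (u := fun s => ‖u s‖) hs]
    refine setIntegral_congr_fun measurableSet_Ioo fun t ht => ?_
    exact (hnorm t s ht).symm

theorem ae_integrableOn_sub_rpow_smul {T γ : ℝ} (hγ : 0 < γ) {u : ℝ → F}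
    (hu : IntegrableOn u (Ioo 0 T)) : ∀ᵐ t ∂(volume.restrict (Ioo 0 T)),
      IntegrableOn (fun s => (t - s) ^ (γ - 1) • u s) (Ioo 0 t) := by
  filter_upwards [(integrable_volterra one_pos hγ (by linarith) hu).prod_right_ae,
    ae_restrict_mem measurableSet_Ioo] with t h1 ht
  simp only [Function.uncurry, volterra] at h1
  rw [integrable_indicator_iff measurableSet_Iio, IntegrableOn,
    Measure.restrict_restrict measurableSet_Iio, inter_comm, Ioo_inter_Iio,
    inf_of_le_right ht.2.le] at h1
  simpa [IntegrableOn] using h1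

theorem integrableOn_rlIntegral {T γ : ℝ} (hγ : 0 < γ) {u : ℝ → F}
    (hu : IntegrableOn u (Ioo 0 T)) : IntegrableOn (rlIntegral γ u) (Ioo 0 T) := by
  have h1 := (integrable_volterra one_pos hγ (by linarith) hu).integral_prod_left
  refine (h1.smul (Real.Gamma γ)⁻¹).congr ?_
  filter_upwards [ae_restrict_mem measurableSet_Ioo] with t ht
  simp only [Pi.smul_apply, Function.uncurry]
  rw [integral_volterra_right ht]
  simp [rlIntegral]

variable [CompleteSpace F]

/-- The semigroup property of the Riemann–Liouville integrals. -/
theorem rlIntegral_rlIntegral {T β γ : ℝ} (hβ : 0 < β) (hγ : 0 < γ) (hβγ : 1 ≤ β + γ)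
    {u : ℝ → F} (hu : IntegrableOn u (Ioo 0 T)) :
    rlIntegral β (rlIntegral γ u) T = rlIntegral (β + γ) u T := by
  have h1 := integral_integral_swap (integrable_volterra hβ hγ hβγ hu)
  have h2 : ∫ t in Ioo 0 T, ∫ s in Ioo 0 T, volterra T β γ u t s =
      ∫ t in Ioo 0 T, (T - t) ^ (β - 1) • ∫ s in Ioo 0 t, (t - s) ^ (γ - 1) • u s :=
    setIntegral_congr_fun measurableSet_Ioo fun t ht => integral_volterra_right ht
  have h3 : ∫ s in Ioo 0 T, ∫ t in Ioo 0 T, volterra T β γ u t s = ∫ s in Ioo 0 T,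
      (Real.Gamma β * Real.Gamma γ / Real.Gamma (β + γ)) • (T - s) ^ (β + γ - 1) • u s :=
    setIntegral_congr_fun measurableSet_Ioo fun s hs => by
      rw [integral_volterra_left hβ hγ hs, smul_smul, mul_comm]
  rw [h2, h3, integral_smul] at h1
  unfold rlIntegral
  simp_rw [smul_comm _ (Real.Gamma γ)⁻¹]
  rw [integral_smul, h1, smul_smul, smul_smul]
  congr 1
  have := (Real.Gamma_pos_of_pos hβ).ne'
  have := (Real.Gamma_pos_of_pos hγ).ne'
  field_simp

/-! ### Weak derivatives -/

/-- Fubini on the triangle s < t: `volterra` with both exponents 1 is the indicator kernel, and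
integrating ψ' from s to T gives -ψ(s). The constant c drops out because ψ' has integral zero. -/
theorem hasWeakDeriv_of_eq_integral {T : ℝ} {f g : ℝ → F} {c : F}
    (hg : IntegrableOn g (Ioo 0 T))
    (hf : ∀ᵐ t ∂(volume.restrict (Ioo 0 T)), f t = c + ∫ s in Ioo 0 t, g s) :
    HasWeakDeriv T f g := by
  have hI : IntegrableOn (fun t => ∫ s in Ioo 0 t, g s) (Ioo 0 T) := by
    have := integrableOn_rlIntegral one_pos hg
    exact this.congr (ae_of_all _ fun t => rlIntegral_one g t)
  have hfi : IntegrableOn f (Ioo 0 T) := by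
    refine Integrable.congr (f := fun t => c + ∫ s in Ioo 0 t, g s) ?_ (hf.mono fun t h => h.symm)
    exact (integrable_const c).add hI
  refine ⟨hfi, hg, fun ψ h1 h2 h3 => ?_⟩
  have hψ0 : ψ 0 = 0 := image_eq_zero_of_notMem_tsupport fun h => by simpa using (h3 h)
  have hψT : ψ T = 0 := image_eq_zero_of_notMem_tsupport fun h => by simpa using (h3 h)
  have hd : Continuous (deriv ψ) := h1.continuous_deriv (by simp)
  obtain ⟨M, hM⟩ := (h2.deriv).exists_bound_of_continuous hd
  have hftc : ∀ a b : ℝ, ∫ t in a..b, deriv ψ t = ψ b - ψ a := fun a b =>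
    intervalIntegral.integral_deriv_eq_sub (fun x _ => h1.differentiable (by simp) x)
      (hd.intervalIntegrable _ _)
  have hintg := (integrable_volterra one_pos one_pos (by norm_num) hg).bdd_smul
    (φ := fun p : ℝ × ℝ => deriv ψ p.1) M
    (hd.comp continuous_fst).aestronglyMeasurable (ae_of_all _ fun p => hM p.1)
  have hsw := integral_integral_swap (f := fun t s => deriv ψ t • volterra T 1 1 g t s) hintg
  have hL : ∫ t in Ioo 0 T, ∫ s in Ioo 0 T, deriv ψ t • volterra T 1 1 g t s =
      ∫ t in Ioo 0 T, deriv ψ t • ∫ s in Ioo 0 t, g s := by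
    refine setIntegral_congr_fun measurableSet_Ioo fun t ht => ?_
    rw [integral_smul, integral_volterra_right ht]
    simp
  have hR : ∫ s in Ioo 0 T, ∫ t in Ioo 0 T, deriv ψ t • volterra T 1 1 g t s =
      ∫ s in Ioo 0 T, - (ψ s • g s) := by
    refine setIntegral_congr_fun measurableSet_Ioo fun s hs => ?_
    have : ∀ t, deriv ψ t • volterra T 1 1 g t s =
        (Ioi s).indicator (fun t => deriv ψ t • g s) t := fun t => by
      rw [volterra_swap]
      by_cases h : t ∈ Ioi s <;> simp [h]
    simp_rw [this]
    rw [setIntegral_indicator measurableSet_Ioi, Ioo_inter_Ioi, sup_of_le_right hs.1.le,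
      integral_smul_const, ← integral_Ioc_eq_integral_Ioo,
      ← intervalIntegral.integral_of_le hs.2.le, hftc, hψT, zero_sub, neg_smul]
  rw [hL, hR, integral_neg] at hsw
  rw [← hsw]
  have h0 : ∫ t in Ioo 0 T, deriv ψ t • c = 0 := by
    rw [integral_smul_const]
    rcases le_or_gt T 0 with hT | hT
    · simp [Ioo_eq_empty (not_lt.2 hT)]
    · rw [← integral_Ioc_eq_integral_Ioo, ← intervalIntegral.integral_of_le hT.le, hftc, hψT, hψ0]
      simp
  have hb1 : Integrable (fun t => deriv ψ t • c) (volume.restrict (Ioo 0 T)) :=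
    ((hd.integrable_of_hasCompactSupport h2.deriv).smul_const c).integrableOn
  have hb2 : Integrable (fun t => deriv ψ t • ∫ s in Ioo 0 t, g s) (volume.restrict (Ioo 0 T)) :=
    hI.bdd_smul M hd.aestronglyMeasurable (ae_of_all _ hM)
  rw [← zero_add (∫ t in Ioo 0 T, deriv ψ t • ∫ s in Ioo 0 t, g s), ← h0, ← integral_add hb1 hb2]
  refine integral_congr_ae (hf.mono fun t ht => ?_)
  beta_reduce
  rw [ht, smul_add]

end Volterra

end RLWave
end

noncomputable section

namespace RLWave

/-! ### Functions with vanishing weak derivative -/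

theorem integrable_test_smul {F : Type*} [NormedAddCommGroup F] [NormedSpace ℝ F] {ν : Measure ℝ}
    {f : ℝ → F} (hf : Integrable f ν) {ψ : ℝ → ℝ} (hc : Continuous ψ)
    (h : HasCompactSupport ψ) : Integrable (fun t => ψ t • f t) ν := by
  obtain ⟨M, hM⟩ := h.exists_bound_of_continuous hc
  exact hf.bdd_smul M hc.aestronglyMeasurable (ae_of_all _ hM)

theorem HasWeakDeriv.sub {F : Type*} [NormedAddCommGroup F] [NormedSpace ℝ F] {T : ℝ}
    {f g f' g' : ℝ → F} (hf : HasWeakDeriv T f f') (hg : HasWeakDeriv T g g') :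
    HasWeakDeriv T (fun t => f t - g t) (fun t => f' t - g' t) := by
  refine ⟨hf.1.sub hg.1, hf.2.1.sub hg.2.1, fun ψ h1 h2 h3 => ?_⟩
  have hd : Continuous (deriv ψ) := h1.continuous_deriv (by simp)
  simp_rw [smul_sub]
  rw [integral_sub (integrable_test_smul hf.1 hd h2.deriv) (integrable_test_smul hg.1 hd h2.deriv),
    integral_sub (integrable_test_smul hf.2.1 h1.continuous h2)
      (integrable_test_smul hg.2.1 h1.continuous h2),
    hf.2.2 ψ h1 h2 h3, hg.2.2 ψ h1 h2 h3]
  abel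

theorem ae_eq_zero_of_integral_test_smul_eq_zero {T : ℝ} {f : ℝ → ℝ}
    (hf : IntegrableOn f (Ioo 0 T))
    (h : ∀ ψ : ℝ → ℝ, ContDiff ℝ ∞ ψ → HasCompactSupport ψ → tsupport ψ ⊆ Ioo 0 T →
      ∫ t in Ioo 0 T, ψ t • f t = 0) : ∀ᵐ t ∂(volume.restrict (Ioo 0 T)), f t = 0 := by
  refine (ae_restrict_iff' measurableSet_Ioo).2 ?_
  refine isOpen_Ioo.ae_eq_zero_of_integral_contDiff_smul_eq_zero hf.locallyIntegrableOn ?_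
  intro ψ h1 h2 h3
  rw [← h ψ h1 h2 h3, setIntegral_eq_integral_of_forall_compl_eq_zero]
  intro x hx
  rw [image_eq_zero_of_notMem_tsupport fun h => hx (h3 h), zero_smul]

/-- A test function on `(0,T)` with vanishing integral is the derivative of a test function. -/
theorem exists_deriv_eq_of_integral_eq_zero {T : ℝ} {φ : ℝ → ℝ} (h1 : ContDiff ℝ ∞ φ)
    (h2 : HasCompactSupport φ) (h3 : tsupport φ ⊆ Ioo 0 T) (h0 : ∫ t in (0:ℝ)..T, φ t = 0) :
    ∃ ψ : ℝ → ℝ, ContDiff ℝ ∞ ψ ∧ HasCompactSupport ψ ∧ tsupport ψ ⊆ Ioo 0 T ∧ deriv ψ = φ := by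
  set ψ : ℝ → ℝ := fun t => ∫ s in (0:ℝ)..t, φ s with hψ
  have hc := h1.continuous
  have hder : ∀ t, HasDerivAt ψ (φ t) t := fun t =>
    intervalIntegral.integral_hasDerivAt_right (hc.intervalIntegrable _ _)
      (hc.stronglyMeasurableAtFilter _ _) hc.continuousAt
  have hdd : deriv ψ = φ := funext fun t => (hder t).deriv
  have hsm : ContDiff ℝ ∞ ψ :=
    contDiff_infty_iff_deriv.2 ⟨fun t => (hder t).differentiableAt, hdd ▸ h1⟩
  rcases le_or_gt T 0 with hT | hT
  · have he : φ = 0 := by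
      rw [← tsupport_eq_empty_iff]
      exact subset_eq_empty h3 (Ioo_eq_empty (not_lt.2 hT))
    refine ⟨0, contDiff_const, HasCompactSupport.zero, ?_, ?_⟩
    · simp
    · rw [he]; exact deriv_zero
  obtain ⟨a, b, ha, hb, hab⟩ : ∃ a b : ℝ, 0 < a ∧ b < T ∧ tsupport φ ⊆ Icc a b := by
    rcases (tsupport φ).eq_empty_or_nonempty with he | hne
    · exact ⟨T, 0, hT, hT, by simp [he]⟩
    · have hcp : IsCompact (tsupport φ) := h2
      exact ⟨_, _, (h3 (hcp.sInf_mem hne)).1, (h3 (hcp.sSup_mem hne)).2, fun x hx =>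
        ⟨csInf_le hcp.bddBelow hx, le_csSup hcp.bddAbove hx⟩⟩
  have hz : ∀ t, t ∉ Icc a b → φ t = 0 := fun t ht =>
    image_eq_zero_of_notMem_tsupport fun h => ht (hab h)
  have hl : ∀ t, t < a → ψ t = 0 := fun t ht => by
    refine intervalIntegral.integral_zero_ae (ae_of_all _ fun s hs => hz s fun hs' => ?_)
    have : s ≤ max 0 t := hs.2
    have := hs'.1
    rcases max_cases 0 t with h | h <;> linarith
  have hr : ∀ t, b < t → ψ t = 0 := fun t ht => by
    have e1 : ψ t = ψ T - ∫ s in t..T, φ s := by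
      rw [eq_sub_iff_add_eq]
      exact intervalIntegral.integral_add_adjacent_intervals (hc.intervalIntegrable _ _)
        (hc.intervalIntegrable _ _)
    have e2 : ∫ s in t..T, φ s = 0 := by
      refine intervalIntegral.integral_zero_ae (ae_of_all _ fun s hs => hz s fun hs' => ?_)
      have : min t T < s := hs.1
      have := hs'.2
      rcases min_cases t T with h | h <;> linarith
    rw [e1, e2]
    simpa using h0
  have hsupp : tsupport ψ ⊆ Icc a b := by
    refine closure_minimal (fun t ht => ?_) isClosed_Icc
    by_contra hn
    rw [mem_Icc, not_and_or, not_le, not_le] at hn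
    exact ht (hn.elim (hl t) (hr t))
  exact ⟨ψ, hsm, isCompact_Icc.of_isClosed_subset (isClosed_tsupport _) hsupp,
    hsupp.trans fun x hx => ⟨ha.trans_le hx.1, hx.2.trans_lt hb⟩, hdd⟩

/-- Du Bois-Reymond: fix a bump η of integral 1. For a test function φ, φ - (∫φ)η is the derivative
of a test function, so f pairs with φ as the constant ∫ηf does. -/
theorem exists_ae_eq_const_of_hasWeakDeriv_zero {T : ℝ} {f : ℝ → ℝ} (hT : 0 < T)
    (hf : HasWeakDeriv T f fun _ => 0) :
    ∃ k : ℝ, ∀ᵐ t ∂(volume.restrict (Ioo 0 T)), f t = k := by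
  obtain ⟨η, hη1, hη2, hη3, hη4⟩ : ∃ η : ℝ → ℝ, ContDiff ℝ ∞ η ∧ HasCompactSupport η ∧
      tsupport η ⊆ Ioo 0 T ∧ ∫ t in Ioo 0 T, η t = 1 := by
    let B : ContDiffBump (T / 2) := ⟨T / 8, T / 4, by positivity, by linarith⟩
    have hs : tsupport (B.normed volume) ⊆ Ioo 0 T := by
      rw [B.tsupport_normed_eq, Real.closedBall_eq_Icc]
      intro x hx
      constructor
      · have := hx.1; simp only [B] at this; linarith
      · have := hx.2; simp only [B] at this; linarith
    refine ⟨B.normed volume, B.contDiff_normed, B.hasCompactSupport_normed, hs, ?_⟩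
    rw [setIntegral_eq_integral_of_forall_compl_eq_zero, B.integral_normed]
    exact fun x hx => image_eq_zero_of_notMem_tsupport fun h => hx (hs h)
  refine ⟨∫ t in Ioo 0 T, η t • f t, ?_⟩
  set k := ∫ t in Ioo 0 T, η t • f t with hk
  have := ae_eq_zero_of_integral_test_smul_eq_zero (T := T) (f := fun t => f t - k)
    (hf.1.sub (integrable_const k)) fun φ h1 h2 h3 => by
      set m := ∫ t in Ioo 0 T, φ t with hm
      have iφ : Integrable φ (volume.restrict (Ioo 0 T)) :=
        (h1.continuous.integrable_of_hasCompactSupport h2).integrableOn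
      have iη : Integrable η (volume.restrict (Ioo 0 T)) :=
        (hη1.continuous.integrable_of_hasCompactSupport hη2).integrableOn
      have iφf : Integrable (fun t => φ t • f t) (volume.restrict (Ioo 0 T)) :=
        integrable_test_smul hf.1 h1.continuous h2
      have iηf : Integrable (fun t => η t • f t) (volume.restrict (Ioo 0 T)) :=
        integrable_test_smul hf.1 hη1.continuous hη2
      have iηfm : Integrable (fun t => m • η t • f t) (volume.restrict (Ioo 0 T)) := iηf.smul m
      have hsub' : tsupport (fun t => φ t - m * η t) ⊆ tsupport φ ∪ tsupport η := by
        refine closure_minimal (fun t ht => ?_) ((isClosed_tsupport _).union (isClosed_tsupport _))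
        by_contra hn
        rw [mem_union, not_or] at hn
        refine ht ?_
        simp [image_eq_zero_of_notMem_tsupport hn.1, image_eq_zero_of_notMem_tsupport hn.2]
      have hsub : tsupport (fun t => φ t - m * η t) ⊆ Ioo 0 T :=
        hsub'.trans (union_subset h3 hη3)
      have h0 : ∫ t in (0:ℝ)..T, (φ t - m * η t) = 0 := by
        rw [intervalIntegral.integral_of_le hT.le, integral_Ioc_eq_integral_Ioo,
          integral_sub iφ (iη.const_mul m), integral_const_mul, hη4, mul_one, sub_self]
      obtain ⟨ψ, p1, p2, p3, p4⟩ := exists_deriv_eq_of_integral_eq_zero (T := T)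
        (φ := fun t => φ t - m * η t) (h1.sub (contDiff_const.mul hη1))
        ((h2.isCompact.union hη2.isCompact).of_isClosed_subset (isClosed_tsupport _) hsub') hsub h0
      have e := hf.2.2 ψ p1 p2 p3
      rw [p4] at e
      simp only [smul_zero, integral_zero, neg_zero, sub_smul, mul_smul] at e
      rw [integral_sub iφf iηfm, integral_smul, ← hk] at e
      simp_rw [smul_sub]
      rw [integral_sub iφf (iφ.smul_const k), integral_smul_const, ← hm]
      exact e
  exact this.mono fun t ht => sub_eq_zero.1 ht

/-- Every interval (0,b) has positive measure. This makes limits through almost all t → 0+ unique.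
-/
instance : (𝓝[>] (0 : ℝ) ⊓ ae volume).NeBot := by
  rw [inf_neBot_iff]
  intro s hs s' hs'
  obtain ⟨b, hb, hbs⟩ := mem_nhdsGT_iff_exists_Ioo_subset.1 hs
  by_contra hne
  rw [not_nonempty_iff_eq_empty] at hne
  have : Ioo 0 b ⊆ s'ᶜ := fun x hx hx' => by
    have : x ∈ s ∩ s' := ⟨hbs hx, hx'⟩
    simp [hne] at this
  have h0 : volume (Ioo (0:ℝ) b) = 0 := measure_mono_null this (mem_ae_iff.1 hs')
  rw [Real.volume_Ioo] at h0
  simp at h0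
  exact absurd hb (not_lt.2 h0)

theorem tendsto_setIntegral_Ioo_zero {F : Type*} [NormedAddCommGroup F] [NormedSpace ℝ F]
    {T : ℝ} (hT : 0 < T) {g : ℝ → F} (hg : IntegrableOn g (Ioo 0 T)) :
    Tendsto (fun t => ∫ s in Ioo 0 t, g s) (𝓝[>] 0) (𝓝 0) := by
  have h1 : Continuous fun t => ∫ s in (0:ℝ)..t, (Ioo 0 T).indicator g s :=
    ((integrable_indicator_iff measurableSet_Ioo).2 hg).continuous_primitive 0
  have h2 := (h1.tendsto 0).mono_left (nhdsWithin_le_nhds (s := Ioi 0))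
  rw [intervalIntegral.integral_same] at h2
  refine h2.congr' ?_
  filter_upwards [Ioo_mem_nhdsGT hT] with t ht
  rw [intervalIntegral.integral_of_le ht.1.le, integral_Ioc_eq_integral_Ioo]
  refine setIntegral_congr_fun measurableSet_Ioo fun s hs => ?_
  exact indicator_of_mem (show s ∈ Ioo 0 T from ⟨hs.1, hs.2.trans ht.2⟩) _

theorem eventually_of_ae_restrict_Ioo {T : ℝ} (hT : 0 < T) {p : ℝ → Prop}
    (h : ∀ᵐ t ∂(volume.restrict (Ioo 0 T)), p t) : ∀ᶠ t in 𝓝[>] 0 ⊓ ae volume, p t := by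
  rw [ae_restrict_iff' measurableSet_Ioo] at h
  exact eventually_inf.2 ⟨_, Ioo_mem_nhdsGT hT, _, h, fun x hx => hx.2 hx.1⟩

/-- A function in `W^{1,1}(0,T)` is recovered from its initial value and its weak derivative. -/
theorem HasWeakDeriv.ae_eq_add_integral {T : ℝ} (hT : 0 < T) {f g : ℝ → ℝ} {c : ℝ}
    (h : HasWeakDeriv T f g) (hc : Tendsto f (𝓝[>] 0 ⊓ ae volume) (𝓝 c)) :
    ∀ᵐ t ∂(volume.restrict (Ioo 0 T)), f t = c + ∫ s in Ioo 0 t, g s := by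
  have h1 : HasWeakDeriv T (fun t => ∫ s in Ioo 0 t, g s) g :=
    hasWeakDeriv_of_eq_integral (c := 0) h.2.1 (ae_of_all _ fun t => (zero_add _).symm)
  have h2 := h.sub h1
  simp only [sub_self] at h2
  obtain ⟨k, hk⟩ := exists_ae_eq_const_of_hasWeakDeriv_zero hT h2
  have h3 := hc.sub ((tendsto_setIntegral_Ioo_zero hT h.2.1).mono_left
    (inf_le_left (b := ae volume)))
  rw [sub_zero] at h3
  have h4 : c = k := tendsto_nhds_unique h3
    (tendsto_const_nhds.congr' ((eventually_of_ae_restrict_Ioo hT hk).mono fun t ht => ht.symm))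
  exact hk.mono fun t ht => by rw [h4, ← ht]; ring

end RLWave
end

noncomputable section

namespace RLWave

/-! ### The scalar fractional equation -/

theorem setIntegral_Ioo_eq_intervalIntegral_indicator {T t : ℝ} (ht : 0 ≤ t) (htT : t ≤ T)
    (z : ℝ → ℝ) : ∫ s in Ioo 0 t, z s = ∫ s in (0:ℝ)..t, (Ioo 0 T).indicator z s := by
  rw [intervalIntegral.integral_of_le ht, integral_Ioc_eq_integral_Ioo]
  refine setIntegral_congr_fun measurableSet_Ioo fun s hs => ?_
  exact (indicator_of_mem (show s ∈ Ioo 0 T from ⟨hs.1, hs.2.trans_le htT⟩) _).symm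

theorem eq_zero_of_abs_le_mul_integral {T K : ℝ} {f : ℝ → ℝ} (hf : Continuous f)
    (h : ∀ t ∈ Ioc 0 T, |f t| ≤ K * ∫ s in (0:ℝ)..t, |f s|) : ∀ t ∈ Ioc 0 T, f t = 0 := by
  have hder : ∀ t, HasDerivAt (fun t => ∫ s in (0:ℝ)..t, |f s|) |f t| t := fun t =>
    intervalIntegral.integral_hasDerivAt_right (hf.abs.intervalIntegrable _ _)
      (hf.abs.stronglyMeasurableAtFilter _ _) hf.abs.continuousAt
  intro t ht
  have hz : ∀ x ∈ Icc 0 T, (∫ s in (0:ℝ)..x, |f s|) = 0 := by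
    refine eq_zero_of_abs_deriv_le_mul_abs_self_of_eq_zero_right (K := K)
      (f' := fun t => |f t|) (fun x _ => (hder x).continuousAt.continuousWithinAt)
      (fun x _ => (hder x).hasDerivWithinAt) intervalIntegral.integral_same ?_
    intro x hx
    have h0 : 0 ≤ ∫ s in (0:ℝ)..x, |f s| :=
      intervalIntegral.integral_nonneg hx.1 fun s _ => abs_nonneg _
    rw [Real.norm_of_nonneg (abs_nonneg _), Real.norm_of_nonneg h0]
    -- The integral inequality is assumed only for t > 0; at 0 it follows by continuity.
    rcases hx.1.eq_or_lt with rfl | hx0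
    · have hT : 0 < T := hx.2
      have hlim : Tendsto (fun t => K * ∫ s in (0:ℝ)..t, |f s|) (𝓝[>] 0) (𝓝 (K * 0)) := by
        have := ((hder 0).continuousAt.tendsto.mono_left
          (nhdsWithin_le_nhds (s := Ioi 0))).const_mul K
        rwa [intervalIntegral.integral_same] at this
      have hlim2 : Tendsto (fun t => |f t|) (𝓝[>] 0) (𝓝 |f 0|) :=
        hf.abs.continuousAt.tendsto.mono_left nhdsWithin_le_nhds
      rw [intervalIntegral.integral_same]
      refine le_of_tendsto_of_tendsto hlim2 hlim ?_
      filter_upwards [Ioc_mem_nhdsGT hT] with t ht using h t ht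
    · exact h x ⟨hx0, hx.2.le⟩
  have := h t ht
  rw [hz t ⟨ht.1.le, ht.2⟩, mul_zero] at this
  exact abs_nonpos_iff.1 this

/-- Applying I^{α-1} gives ζ = -λI^αζ for ζ = I¹z. As α > 1 the kernel is bounded, so Gronwall gives
ζ = 0, and z, the weak derivative of ζ, vanishes. Working with I¹z supplies continuity, since z
itself is only integrable. -/
theorem ae_eq_zero_of_rlIntegral_eq {α T lam : ℝ} (hα : 1 < α) (hα' : α < 2) {z : ℝ → ℝ}
    (hz : IntegrableOn z (Ioo 0 T))
    (h : ∀ᵐ t ∂(volume.restrict (Ioo 0 T)),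
      rlIntegral (2 - α) z t = -lam * rlIntegral 1 (rlIntegral 1 z) t) :
    ∀ᵐ t ∂(volume.restrict (Ioo 0 T)), z t = 0 := by
  have hmono : ∀ {t}, t ≤ T → Ioo 0 t ⊆ Ioo 0 T := fun ht => Ioo_subset_Ioo_right ht
  have hζ : IntegrableOn (rlIntegral 1 z) (Ioo 0 T) := integrableOn_rlIntegral one_pos hz
  have key : ∀ t ∈ Ioc 0 T, rlIntegral 1 z t = -lam * rlIntegral α (rlIntegral 1 z) t := by
    intro t ht
    have e1 := rlIntegral_rlIntegral (T := t) (β := α - 1) (γ := 2 - α) (by linarith)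
      (by linarith) (by linarith) (hz.mono_set (hmono ht.2))
    have e2 := rlIntegral_rlIntegral (T := t) (β := α - 1) (γ := 1) (by linarith)
      (by linarith) (by linarith) (hζ.mono_set (hmono ht.2))
    rw [show α - 1 + (2 - α) = 1 by ring] at e1
    rw [show α - 1 + 1 = α by ring] at e2
    rw [← e1, rlIntegral_congr_ae h ht.2]
    have := rlIntegral_const_smul (α - 1) (-lam) (rlIntegral 1 (rlIntegral 1 z)) t
    simp only [smul_eq_mul] at this
    rw [this, e2]
  set f : ℝ → ℝ := fun t => ∫ s in (0:ℝ)..t, (Ioo 0 T).indicator z s with hf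
  have hfc : Continuous f :=
    ((integrable_indicator_iff measurableSet_Ioo).2 hz).continuous_primitive 0
  have hfζ : ∀ t, 0 ≤ t → t ≤ T → rlIntegral 1 z t = f t := fun t h0 h1 => by
    rw [rlIntegral_one, setIntegral_Ioo_eq_intervalIntegral_indicator h0 h1]
  have hf0 := eq_zero_of_abs_le_mul_integral (T := T)
    (K := |lam| * ((Real.Gamma α)⁻¹ * T ^ (α - 1))) hfc fun t ht => by
      have hΓ : 0 < (Real.Gamma α)⁻¹ := inv_pos.2 (Real.Gamma_pos_of_pos (by linarith))
      rw [← hfζ t ht.1.le ht.2, key t ht, abs_mul, abs_neg, mul_assoc, mul_assoc]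
      refine mul_le_mul_of_nonneg_left ?_ (abs_nonneg _)
      rw [rlIntegral, smul_eq_mul, abs_mul, abs_of_pos hΓ]
      refine mul_le_mul_of_nonneg_left ?_ hΓ.le
      rw [intervalIntegral.integral_of_le ht.1.le, integral_Ioc_eq_integral_Ioo,
        ← integral_const_mul]
      rw [← Real.norm_eq_abs]
      refine (norm_integral_le_integral_norm _).trans ?_
      have i1 : IntegrableOn (fun s => T ^ (α - 1) * |f s|) (Ioo 0 t) :=
        ((hfc.abs.const_mul _).integrableOn_Icc).mono_set Ioo_subset_Icc_self
      refine integral_mono_of_nonneg (ae_of_all _ fun s => norm_nonneg _) i1 ?_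
      filter_upwards [ae_restrict_mem measurableSet_Ioo] with s hs
      have h1 : 0 ≤ t - s := by linarith [hs.2]
      rw [hfζ s hs.1.le (hs.2.le.trans ht.2), norm_smul,
        Real.norm_of_nonneg (Real.rpow_nonneg h1 _)]
      refine mul_le_mul_of_nonneg_right ?_ (abs_nonneg _)
      exact Real.rpow_le_rpow h1 (by linarith [hs.1, ht.2]) (by linarith)
  refine ae_eq_zero_of_integral_test_smul_eq_zero hz fun ψ h1 h2 h3 => ?_
  have hw : HasWeakDeriv T (fun _ => (0 : ℝ)) z := by
    refine hasWeakDeriv_of_eq_integral (c := 0) hz ?_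
    filter_upwards [ae_restrict_mem measurableSet_Ioo] with t ht
    rw [← rlIntegral_one, hfζ t ht.1.le ht.2.le, hf0 t ⟨ht.1, ht.2.le⟩, add_zero]
  have := hw.2.2 ψ h1 h2 h3
  simp only [smul_zero, integral_zero] at this
  linarith

theorem rlIntegral_lin {T β a b : ℝ} {f g : ℝ → ℝ}
    (hf : IntegrableOn (fun s => (T - s) ^ (β - 1) * f s) (Ioo 0 T))
    (hg : IntegrableOn (fun s => (T - s) ^ (β - 1) * g s) (Ioo 0 T)) :
    rlIntegral β (fun t => a * f t + b * g t) T = a * rlIntegral β f T + b * rlIntegral β g T := by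
  have : ∀ s, (T - s) ^ (β - 1) * (a * f s + b * g s) =
      a * ((T - s) ^ (β - 1) * f s) + b * ((T - s) ^ (β - 1) * g s) := fun s => by ring
  simp only [rlIntegral, smul_eq_mul, this]
  rw [integral_add (hf.const_mul a) (hg.const_mul b), integral_const_mul, integral_const_mul]
  ring

theorem rlIntegral_mlFun_lin {α β γ γ' : ℝ} (hα : 1 ≤ α) (hβ : 0 < β) (hγ : 0 < γ) (hγ' : 0 < γ')
    (lam a b : ℝ) {t : ℝ} (ht : 0 < t) :
    rlIntegral β (fun t => a * mlFun α γ lam t + b * mlFun α γ' lam t) t =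
      a * mlFun α (β + γ) lam t + b * mlFun α (β + γ') lam t := by
  rw [rlIntegral_lin (integrableOn_sub_rpow_mul_mlFun hα hβ hγ lam ht)
    (integrableOn_sub_rpow_mul_mlFun hα hβ hγ' lam ht), rlIntegral_mlFun hα hβ hγ lam ht,
    rlIntegral_mlFun hα hβ hγ' lam ht]

theorem rlIntegral_congr_of_forall {F : Type*} [NormedAddCommGroup F] [NormedSpace ℝ F]
    {β t : ℝ} {u v : ℝ → F} (h : ∀ s ∈ Ioo 0 t, u s = v s) :
    rlIntegral β u t = rlIntegral β v t :=
  rlIntegral_congr_ae ((ae_restrict_mem measurableSet_Ioo).mono fun s hs => h s hs) le_rfl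

/-- The solution of the scalar equation `D^α y = -λ y` with initial data `a`, `b`. -/
theorem ae_eq_mlFun_of_integral_equations {α T lam a b : ℝ} (hα : 1 < α) (hα' : α < 2)
    {y v : ℝ → ℝ} (hy : IntegrableOn y (Ioo 0 T))
    (h1 : ∀ᵐ t ∂(volume.restrict (Ioo 0 T)), rlIntegral (2 - α) y t = b + ∫ s in Ioo 0 t, v s)
    (h2 : ∀ᵐ t ∂(volume.restrict (Ioo 0 T)), v t = a + ∫ s in Ioo 0 t, -lam * y s) :
    ∀ᵐ t ∂(volume.restrict (Ioo 0 T)),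
      y t = a * mlFun α α lam t + b * mlFun α (α - 1) lam t := by
  set Y : ℝ → ℝ := fun t => a * mlFun α α lam t + b * mlFun α (α - 1) lam t with hY
  have hYi : IntegrableOn Y (Ioo 0 T) :=
    ((integrableOn_mlFun hα.le (by linarith) lam T).const_mul a).add
      ((integrableOn_mlFun hα.le (by linarith) lam T).const_mul b)
  have hsub : ∀ β t, IntegrableOn (fun s => (t - s) ^ (β - 1) • y s) (Ioo 0 t) →
      IntegrableOn (fun s => (t - s) ^ (β - 1) • Y s) (Ioo 0 t) →
      rlIntegral β (fun t => y t - Y t) t = rlIntegral β y t - rlIntegral β Y t := by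
    intro β t i1 i2
    simp only [rlIntegral, smul_sub]
    rw [integral_sub i1 i2, smul_sub]
  have hz : IntegrableOn (fun t => y t - Y t) (Ioo 0 T) := hy.sub hYi
  refine (ae_eq_zero_of_rlIntegral_eq (lam := lam) hα hα' hz ?_).mono
    fun t ht => sub_eq_zero.1 ht
  filter_upwards [ae_integrableOn_sub_rpow_smul (by linarith : 0 < 2 - α) hy,
    ae_integrableOn_sub_rpow_smul (by linarith : 0 < 2 - α) hYi, h1,
    ae_restrict_mem measurableSet_Ioo] with t i1 i2 e1 ht
  have hsT : ∀ {s}, s ≤ t → Ioo 0 s ⊆ Ioo 0 T := fun h => Ioo_subset_Ioo_right (h.trans ht.2.le)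
  have hone : ∀ s ≤ t, rlIntegral 1 (fun t => y t - Y t) s = rlIntegral 1 y s - rlIntegral 1 Y s := by
    intro s hs
    refine hsub 1 s ?_ ?_
    · simpa using hy.mono_set (hsT hs)
    · simpa using hYi.mono_set (hsT hs)
  have hIy : IntegrableOn (rlIntegral 1 y) (Ioo 0 t) :=
    (integrableOn_rlIntegral one_pos hy).mono_set (hsT le_rfl)
  have hIY : IntegrableOn (rlIntegral 1 Y) (Ioo 0 t) :=
    (integrableOn_rlIntegral one_pos hYi).mono_set (hsT le_rfl)
  have hII : rlIntegral 1 (rlIntegral 1 fun t => y t - Y t) t =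
      rlIntegral 1 (rlIntegral 1 y) t - rlIntegral 1 (rlIntegral 1 Y) t := by
    rw [rlIntegral_congr_of_forall fun s hs => hone s hs.2.le]
    simp only [rlIntegral_one _ t]
    exact integral_sub hIy hIY
  have hY1 : rlIntegral (2 - α) Y t = a * mlFun α 2 lam t + b * mlFun α 1 lam t := by
    rw [hY, rlIntegral_mlFun_lin hα.le (by linarith) (by linarith) (by linarith) _ _ _ ht.1]
    ring_nf
  have hY2 : rlIntegral 1 (rlIntegral 1 Y) t =
      a * mlFun α (α + 2) lam t + b * mlFun α (α + 1) lam t := by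
    rw [rlIntegral_congr_of_forall fun s hs => rlIntegral_mlFun_lin hα.le one_pos (by linarith)
      (by linarith) lam a b hs.1, rlIntegral_mlFun_lin hα.le one_pos (by linarith) (by linarith)
      _ _ _ ht.1]
    ring_nf
  -- Eliminating v leaves the single equation I^{2-α}y = b + at - λI¹I¹y.
  have hv : ∫ s in Ioo 0 t, v s = a * t - lam * rlIntegral 1 (rlIntegral 1 y) t := by
    have : ∫ s in Ioo 0 t, v s = ∫ s in Ioo 0 t, (a - lam * rlIntegral 1 y s) := by
      refine integral_congr_ae ?_
      filter_upwards [ae_restrict_of_ae_restrict_of_subset (hsT le_rfl) h2] with s hs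
      rw [hs, integral_const_mul, rlIntegral_one]
      ring
    rw [this, integral_sub (integrable_const a) (hIy.const_mul lam), integral_const_mul,
      rlIntegral_one (rlIntegral 1 y)]
    simp [ht.1.le, mul_comm]
  -- By the recursions f_2 = t - λf_{α+2} and f_1 = 1 - λf_{α+1}, Y solves the same equation; at + b
  -- cancels in the difference.
  rw [hsub _ _ i1 i2, hII, e1, hv, hY1, hY2, mlFun_eq_add hα.le two_pos lam ht.1,
    mlFun_eq_add hα.le one_pos lam ht.1]
  simp only [sub_self, Real.rpow_zero, Real.Gamma_one, Real.Gamma_two]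
  norm_num
  ring

end RLWave
end

noncomputable section

namespace RLWave

/-! ### Series of square integrable functions -/

/-- Sums exchange with integrals because |p_n f_n| ≤ p_n² + f_n², where Σ p_n² is a constant,
integrable against a finite measure. -/
theorem integrable_tsum_mul {X : Type*} [MeasurableSpace X] {ν : Measure X} [IsFiniteMeasure ν]
    {f : ℕ → X → ℝ} {p : ℕ → ℝ} (hf : ∀ n, AEMeasurable (f n) ν)
    (hs : ∫⁻ x, ∑' n, ENNReal.ofReal (f n x ^ 2) ∂ν < ⊤) (hp : Summable fun n => p n ^ 2) :
    Integrable (fun x => ∑' n, p n * f n x) ν ∧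
      (∀ᵐ x ∂ν, Summable fun n => p n * f n x) ∧
      HasSum (fun n => ∫ x, p n * f n x ∂ν) (∫ x, ∑' n, p n * f n x ∂ν) := by
  have hm : ∀ n, AEMeasurable (fun x => p n * f n x) ν := fun n => (hf n).const_mul _
  have hD : ∫⁻ x, ∑' n, ‖p n * f n x‖ₑ ∂ν < ⊤ := by
    have h1 : ∀ x, ∑' n, ‖p n * f n x‖ₑ ≤
        ∑' n, ENNReal.ofReal (p n ^ 2) + ∑' n, ENNReal.ofReal (f n x ^ 2) := by
      intro x
      rw [← ENNReal.tsum_add]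
      refine ENNReal.tsum_le_tsum fun n => ?_
      rw [← ENNReal.ofReal_add (sq_nonneg _) (sq_nonneg _), ← ofReal_norm]
      refine ENNReal.ofReal_le_ofReal ?_
      rw [Real.norm_eq_abs, abs_le]
      constructor <;> nlinarith [sq_nonneg (p n + f n x), sq_nonneg (p n - f n x),
        sq_nonneg (p n), sq_nonneg (f n x)]
    refine (lintegral_mono h1).trans_lt ?_
    rw [lintegral_add_left measurable_const, lintegral_const]
    refine ENNReal.add_lt_top.2 ⟨ENNReal.mul_lt_top ?_ (measure_lt_top _ _), hs⟩
    rw [← ENNReal.ofReal_tsum_of_nonneg (fun n => sq_nonneg _) hp]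
    exact ENNReal.ofReal_lt_top
  have hD' : ∑' n, ∫⁻ x, ‖p n * f n x‖ₑ ∂ν ≠ ⊤ := by
    rw [← lintegral_tsum fun n => (hm n).enorm]; exact hD.ne
  have hi : ∀ n, Integrable (fun x => p n * f n x) ν := fun n =>
    ⟨(hm n).aestronglyMeasurable, (ENNReal.le_tsum n).trans_lt (lt_top_iff_ne_top.2 hD')⟩
  refine ⟨⟨(AEMeasurable.tsum hm).aestronglyMeasurable, ?_⟩, ?_, ?_⟩
  · exact (lintegral_mono fun x => enorm_tsum_le_tsum_enorm).trans_lt hD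
  · filter_upwards [ae_lt_top' (AEMeasurable.tsum fun n => (hm n).enorm) hD.ne] with x hx
    have := ENNReal.summable_toReal hx.ne
    simp only [toReal_enorm] at this
    exact this.of_norm
  · refine hasSum_integral_of_summable_integral_norm hi ?_
    have := ENNReal.summable_toReal hD'
    refine this.congr fun n => ?_
    rw [integral_norm_eq_lintegral_enorm (hi n).1]

section Expansion

variable {N : ℕ} {Ω : Set (EuclideanSpace ℝ (Fin N))} {e : ℕ → H10 Ω} {lam : ℕ → ℝ}

/-! ### Expansion in eigenfunctions -/

/-- The inclusion of `H¹₀(Ω)` into `L²(Ω)`. -/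
def fnL (Ω : Set (EuclideanSpace ℝ (Fin N))) : H10 Ω →L[ℝ] L2 Ω :=
  ContinuousLinearMap.fst ℝ (L2 Ω) (L2Vec Ω) ∘L (H10Sub Ω).subtypeL

/-- The gradient as a bounded operator on `H¹₀(Ω)`. -/
def gradL (Ω : Set (EuclideanSpace ℝ (Fin N))) : H10 Ω →L[ℝ] L2Vec Ω :=
  ContinuousLinearMap.snd ℝ (L2 Ω) (L2Vec Ω) ∘L (H10Sub Ω).subtypeL

theorem fnL_apply (v : H10 Ω) : fnL Ω v = v.fn := rfl

theorem gradL_apply (v : H10 Ω) : gradL Ω v = v.grad := rfl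

instance : CompleteSpace (H10 Ω) :=
  (Submodule.isClosed_topologicalClosure _).completeSpace_coe

theorem IsDirichletEigenbasis.hasSum_inner_mul_inner (h : IsDirichletEigenbasis Ω e lam)
    (x y : L2 Ω) : HasSum (fun n => ⟪x, (e n).fn⟫_ℝ * ⟪y, (e n).fn⟫_ℝ) ⟪x, y⟫_ℝ := by
  have := (HilbertBasis.mk h.orthonormal h.complete.ge).hasSum_inner_mul_inner x y
  rw [HilbertBasis.coe_mk] at this
  simpa only [real_inner_comm y] using this

theorem IsDirichletEigenbasis.hasSum_inner_smul (h : IsDirichletEigenbasis Ω e lam)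
    (x : L2 Ω) : HasSum (fun n => ⟪x, (e n).fn⟫_ℝ • (e n).fn) x := by
  have := (HilbertBasis.mk h.orthonormal h.complete.ge).hasSum_repr x
  simp only [HilbertBasis.repr_apply_apply, HilbertBasis.coe_mk] at this
  simpa only [real_inner_comm] using this

theorem IsDirichletEigenbasis.ext_inner (h : IsDirichletEigenbasis Ω e lam) {x y : L2 Ω}
    (hxy : ∀ n, ⟪x, (e n).fn⟫_ℝ = ⟪y, (e n).fn⟫_ℝ) : x = y := by
  have h1 := h.hasSum_inner_smul x
  simp only [hxy] at h1
  exact h1.unique (h.hasSum_inner_smul y)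

theorem IsDirichletEigenbasis.inner_grad (h : IsDirichletEigenbasis Ω e lam) (n : ℕ) (v : H10 Ω) :
    ⟪v.grad, (e n).grad⟫_ℝ = lam n * ⟪v.fn, (e n).fn⟫_ℝ := by
  rw [real_inner_comm, h.eigen, real_inner_comm]

theorem integral_inner_const {X F : Type*} [MeasurableSpace X] {ν : Measure X}
    [NormedAddCommGroup F] [InnerProductSpace ℝ F] [CompleteSpace F] {f : X → F}
    (hf : Integrable f ν) (x : F) : ∫ t, ⟪f t, x⟫_ℝ ∂ν = ⟪∫ t, f t ∂ν, x⟫_ℝ := by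
  rw [real_inner_comm, ← integral_inner hf]
  simp_rw [real_inner_comm x]

theorem HasWeakDeriv.inner_const {F : Type*} [NormedAddCommGroup F] [InnerProductSpace ℝ F]
    [CompleteSpace F] {T : ℝ} {f g : ℝ → F} (hf : HasWeakDeriv T f g) (x : F) :
    HasWeakDeriv T (fun t => ⟪f t, x⟫_ℝ) (fun t => ⟪g t, x⟫_ℝ) := by
  refine ⟨hf.1.inner_const x, hf.2.1.inner_const x, fun ψ h1 h2 h3 => ?_⟩
  have hd : Continuous (deriv ψ) := h1.continuous_deriv (by simp)
  simp_rw [smul_eq_mul, ← real_inner_smul_left]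
  rw [integral_inner_const (integrable_test_smul hf.1 hd h2.deriv),
    integral_inner_const (integrable_test_smul hf.2.1 h1.continuous h2), hf.2.2 ψ h1 h2 h3,
    inner_neg_left]

theorem ae_inner_rlIntegral {F : Type*} [NormedAddCommGroup F] [InnerProductSpace ℝ F]
    [CompleteSpace F] {T γ : ℝ} (hγ : 0 < γ) {u : ℝ → F} (hu : IntegrableOn u (Ioo 0 T)) (x : F) :
    ∀ᵐ t ∂(volume.restrict (Ioo 0 T)),
      ⟪rlIntegral γ u t, x⟫_ℝ = rlIntegral γ (fun s => ⟪u s, x⟫_ℝ) t := by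
  filter_upwards [ae_integrableOn_sub_rpow_smul hγ hu] with t ht
  unfold rlIntegral
  rw [real_inner_smul_left, ← integral_inner_const ht]
  simp_rw [real_inner_smul_left, smul_eq_mul]

/-! ### Coefficients of a weak solution. -/

theorem seriesCoeff_eq (α : ℝ) (u₁ : L2 Ω) (u₂ : H10 Ω) (t : ℝ) (n : ℕ) :
    seriesCoeff e lam α u₁ u₂ t n = ⟪u₁, (e n).fn⟫_ℝ * mlFun α α (lam n) t +
      ⟪u₂.fn, (e n).fn⟫_ℝ * mlFun α (α - 1) (lam n) t := by
  unfold seriesCoeff mlFun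
  rw [show α - 1 - 1 = α - 2 by ring]
  ring

theorem IsWeakSolution.integrableOn {α T : ℝ} {u : ℝ → H10 Ω} {v : ℝ → L2 Ω}
    (hu : IsWeakSolution Ω α T u v) : IntegrableOn u (Ioo 0 T) :=
  hu.memLp.integrable (by norm_num)

theorem IsWeakSolution.integrableOn_fn {α T : ℝ} {u : ℝ → H10 Ω} {v : ℝ → L2 Ω}
    (hu : IsWeakSolution Ω α T u v) : IntegrableOn (fun t => (u t).fn) (Ioo 0 T) :=
  (fnL Ω).integrable_comp hu.integrableOn

/-- The coefficient `⟨v(t), e_n⟩` has weak derivative `-λ_n ⟨u(t), e_n⟩`. -/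
theorem IsWeakSolution.hasWeakDeriv_coeff (h : IsDirichletEigenbasis Ω e lam) {α T : ℝ}
    {u : ℝ → H10 Ω} {v : ℝ → L2 Ω} (hu : IsWeakSolution Ω α T u v) (n : ℕ) :
    HasWeakDeriv T (fun t => ⟪v t, (e n).fn⟫_ℝ) (fun t => -lam n * ⟪(u t).fn, (e n).fn⟫_ℝ) := by
  obtain ⟨g, hg, hgu⟩ := hu.weak (e n)
  have hae : g =ᵐ[volume.restrict (Ioo 0 T)] fun t => -lam n * ⟪(u t).fn, (e n).fn⟫_ℝ :=
    hgu.mono fun t ht => by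
      rw [h.inner_grad] at ht
      linarith
  refine ⟨hg.1, hg.2.1.congr hae, fun ψ h1 h2 h3 => ?_⟩
  rw [hg.2.2 ψ h1 h2 h3]
  congr 1
  exact integral_congr_ae (hae.mono fun t ht => by beta_reduce; rw [ht])

/-- Pairing with e_n and integrating both weak derivatives from their initial values gives the
scalar integral equations, which determine the coefficient. This contains uniqueness. -/
theorem IsWeakSolution.ae_coeff_eq (h : IsDirichletEigenbasis Ω e lam) {α T : ℝ} (hα : 1 < α)
    (hα' : α < 2) (hT : 0 < T) {u : ℝ → H10 Ω} {v : ℝ → L2 Ω} {u₁ : L2 Ω} {u₂ : H10 Ω}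
    (hu : IsWeakSolution Ω α T u v) (hi : HasInitialData α u v u₁ u₂) :
    ∀ᵐ t ∂(volume.restrict (Ioo 0 T)), ∀ n,
      ⟪(u t).fn, (e n).fn⟫_ℝ = seriesCoeff e lam α u₁ u₂ t n := by
  rw [ae_all_iff]
  intro n
  simp_rw [seriesCoeff_eq]
  refine ae_eq_mlFun_of_integral_equations (v := fun t => ⟪v t, (e n).fn⟫_ℝ) hα hα'
    (hu.integrableOn_fn.inner_const _) ?_ ?_
  · have h1 := (hu.hasDeriv.inner_const (e n).fn).ae_eq_add_integral hT
      (c := ⟪u₂.fn, (e n).fn⟫_ℝ) (hi.2.inner tendsto_const_nhds)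
    filter_upwards [h1, ae_inner_rlIntegral (γ := 2 - α) (by linarith) hu.integrableOn_fn (e n).fn] with t e1 e2
    rw [← e2, e1]
  · exact (hu.hasWeakDeriv_coeff h n).ae_eq_add_integral hT (hi.1 (e n))

theorem IsWeakSolution.ae_hasSum (h : IsDirichletEigenbasis Ω e lam) {α T : ℝ} (hα : 1 < α)
    (hα' : α < 2) (hT : 0 < T) {u : ℝ → H10 Ω} {v : ℝ → L2 Ω} {u₁ : L2 Ω} {u₂ : H10 Ω}
    (hu : IsWeakSolution Ω α T u v) (hi : HasInitialData α u v u₁ u₂) :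
    ∀ᵐ t ∂(volume.restrict (Ioo 0 T)),
      HasSum (fun n => seriesCoeff e lam α u₁ u₂ t n • (e n).fn) (u t).fn := by
  filter_upwards [hu.ae_coeff_eq h hα hα' hT hi] with t ht
  simp_rw [← ht]
  exact h.hasSum_inner_smul _

/-! ### The energy estimate for the series -/

theorem rpow_half_sq (x : ℝ≥0∞) : (x ^ (1 / 2 : ℝ)) ^ 2 = x := by
  rw [← ENNReal.rpow_natCast, ← ENNReal.rpow_mul]
  norm_num

theorem rpow_half_le {C : ℝ} {x a b : ℝ≥0∞} (h : x ≤ ENNReal.ofReal C * (a ^ 2 + b ^ 2))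
    (hC : 0 < C) : x ^ (1 / 2 : ℝ) ≤ ENNReal.ofReal (C ^ (1 / 2 : ℝ)) * (a + b) := by
  have h1 : x ≤ ENNReal.ofReal C * (a + b) ^ 2 := by
    refine h.trans (mul_le_mul_right ?_ _)
    rw [add_sq]
    exact add_le_add_left le_self_add _
  refine (ENNReal.rpow_le_rpow h1 (by norm_num)).trans ?_
  rw [ENNReal.mul_rpow_of_nonneg _ _ (by norm_num), ENNReal.ofReal_rpow_of_pos hC,
    ← ENNReal.rpow_natCast, ← ENNReal.rpow_mul]
  norm_num

theorem measurable_seriesCoeff {α : ℝ} (hα : 1 < α) (u₁ : L2 Ω) (u₂ : H10 Ω) (n : ℕ) (T : ℝ) :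
    AEMeasurable (fun t => seriesCoeff e lam α u₁ u₂ t n) (volume.restrict (Ioo 0 T)) := by
  simp_rw [seriesCoeff_eq]
  exact ((aemeasurable_mlFun hα.le (by linarith) _ T).const_mul _).add
    ((aemeasurable_mlFun hα.le (by linarith) _ T).const_mul _)

theorem exists_lintegral_tsum_seriesCoeff_le (h : IsDirichletEigenbasis Ω e lam)
    {α θ μ lam₀ : ℝ} (hα : 3 / 2 < α) (hα' : α < 2) (h₀ : 0 < lam₀) (hlam : ∀ n, lam₀ ≤ lam n)
    (hθ : 2 * (θ - μ) ≤ (2 * α - 3) / α) :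
    ∃ C : ℝ, 0 < C ∧ ∀ (T : ℝ) (u₁ : L2 Ω) (u₂ : H10 Ω),
      ∫⁻ t in Ioo 0 T, ∑' n, ENNReal.ofReal
          (lam n ^ (1 + 2 * θ) * seriesCoeff e lam α u₁ u₂ t n ^ 2) ≤
        ENNReal.ofReal C * (fracNorm e lam μ u₁ ^ 2 + gradFracNorm e lam μ u₂ ^ 2) := by
  have hpos : ∀ n, 0 < lam n := fun n => h₀.trans_le (hlam n)
  obtain ⟨C, hC, hest⟩ := exists_lintegral_solution_sq_le (θ := θ) (μ := μ) hα hα' h₀ hθ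
  refine ⟨C, hC, fun T u₁ u₂ => ?_⟩
  rw [lintegral_tsum fun n =>
    (((measurable_seriesCoeff (by linarith) u₁ u₂ n T).pow_const 2).const_mul _).ennreal_ofReal,
    gradFracNorm_eq h hpos, fracNorm, rpow_half_sq, rpow_half_sq, ← ENNReal.tsum_add,
    ← ENNReal.tsum_mul_left]
  refine ENNReal.tsum_le_tsum fun n => ?_
  simp_rw [seriesCoeff_eq]
  refine (hest (lam n) T _ _ (hlam n)).trans_eq ?_
  rw [ENNReal.ofReal_mul hC.le, ENNReal.ofReal_add]
  · congr 3
    rw [mul_pow, ← Real.rpow_natCast (lam n ^ μ), ← Real.rpow_mul (hpos n).le]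
    norm_num [mul_comm]
  · have := hpos n
    positivity
  · have := hpos n
    positivity

theorem fracNorm_lt_top {s : ℝ} {v : L2 Ω} (hv : v ∈ fracDomain e lam s) :
    fracNorm e lam s v < ⊤ := by
  have hv' : Summable fun n => (lam n ^ s * ⟪v, (e n).fn⟫_ℝ) ^ 2 := hv
  rw [fracNorm, ← ENNReal.ofReal_tsum_of_nonneg (fun n => sq_nonneg _) hv']
  exact ENNReal.rpow_lt_top_of_nonneg (by norm_num) ENNReal.ofReal_ne_top

/-- The norm of ∇u(t) is a weighted ℓ² norm of coefficients that are now explicit, so the scalar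
estimates sum by Tonelli. -/
theorem IsWeakSolution.timeL2Norm_gradFracNorm_le (h : IsDirichletEigenbasis Ω e lam)
    {α T θ μ lam₀ : ℝ} (hα : 3 / 2 < α) (hα' : α < 2) (hT : 0 < T) (h₀ : 0 < lam₀)
    (hlam : ∀ n, lam₀ ≤ lam n) (hθ : 2 * (θ - μ) ≤ (2 * α - 3) / α) :
    ∃ C : ℝ, 0 < C ∧ ∀ (u₁ : L2 Ω) (u₂ : H10 Ω) (u : ℝ → H10 Ω) (v : ℝ → L2 Ω),
      IsWeakSolution Ω α T u v → HasInitialData α u v u₁ u₂ →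
      timeL2Norm T (fun t => gradFracNorm e lam θ (u t)) ≤
        ENNReal.ofReal C * (fracNorm e lam μ u₁ + gradFracNorm e lam μ u₂) := by
  obtain ⟨C, hC, hest⟩ := exists_lintegral_tsum_seriesCoeff_le h hα hα' h₀ hlam hθ
  refine ⟨C ^ (1 / 2 : ℝ), by positivity, fun u₁ u₂ u v hu hi => ?_⟩
  refine rpow_half_le ?_ hC
  refine le_trans (le_of_eq ?_) (hest T u₁ u₂)
  refine lintegral_congr_ae ?_
  filter_upwards [hu.ae_coeff_eq h (by linarith) hα' hT hi] with t ht
  rw [gradFracNorm_eq h (fun n => h₀.trans_le (hlam n)), rpow_half_sq]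
  simp_rw [ht]

end Expansion

end RLWave
end

noncomputable section

namespace RLWave

variable {N : ℕ} {Ω : Set (EuclideanSpace ℝ (Fin N))} {e : ℕ → H10 Ω} {lam : ℕ → ℝ}

/-! ### Functionals on `D((-Δ)^θ)` given by their coefficients -/

theorem tsum_mul_le_sqrt_mul_sqrt {a b : ℕ → ℝ} (ha : Summable fun n => a n ^ 2)
    (hb : Summable fun n => b n ^ 2) :
    (Summable fun n => a n * b n) ∧
      |∑' n, a n * b n| ≤ √(∑' n, a n ^ 2) * √(∑' n, b n ^ 2) := by
  have h := Real.summable_and_inner_le_Lp_mul_Lq_tsum_of_nonneg (p := 2) (q := 2)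
    (f := fun n => |a n|) (g := fun n => |b n|) Real.HolderConjugate.two_two
    (fun n => abs_nonneg _) (fun n => abs_nonneg _) (by simpa using ha) (by simpa using hb)
  simp only [← abs_mul, Real.rpow_two, sq_abs, ← Real.sqrt_eq_rpow] at h
  refine ⟨h.1.of_abs, le_trans ?_ h.2⟩
  have := norm_tsum_le_tsum_norm (f := fun n => a n * b n) h.1
  exact this

theorem rpow_neg_mul_mul_rpow_mul {x : ℝ} (hx : 0 < x) (θ q p : ℝ) :
    x ^ (-θ) * q * (x ^ θ * p) = q * p := by
  rw [show x ^ (-θ) * q * (x ^ θ * p) = (x ^ (-θ) * x ^ θ) * (q * p) by ring,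
    ← Real.rpow_add hx, neg_add_cancel, Real.rpow_zero, one_mul]

theorem summable_mul_inner_of_mem_fracDomain (hpos : ∀ n, 0 < lam n) {θ : ℝ} {q : ℕ → ℝ}
    (hq : Summable fun n => (lam n ^ (-θ) * q n) ^ 2) {φ : L2 Ω} (hφ : φ ∈ fracDomain e lam θ) :
    Summable fun n => q n * ⟪φ, (e n).fn⟫_ℝ :=
  (tsum_mul_le_sqrt_mul_sqrt hq hφ).1.congr fun n => rpow_neg_mul_mul_rpow_mul (hpos n) _ _ _

/-- The functional `φ ↦ ∑ q_n ⟨φ, e_n⟩` on `D((-Δ)^θ)`, where `∑ λ_n^{-2θ} q_n² < ∞`. -/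
def coeffFunctional (e : ℕ → H10 Ω) (hpos : ∀ n, 0 < lam n) (θ : ℝ) (q : ℕ → ℝ)
    (hq : Summable fun n => (lam n ^ (-θ) * q n) ^ 2) : fracDomain e lam θ →ₗ[ℝ] ℝ where
  toFun φ := ∑' n, q n * ⟪(φ : L2 Ω), (e n).fn⟫_ℝ
  map_add' φ χ := by
    rw [← (summable_mul_inner_of_mem_fracDomain hpos hq φ.2).tsum_add
      (summable_mul_inner_of_mem_fracDomain hpos hq χ.2)]
    refine tsum_congr fun n => ?_
    rw [Submodule.coe_add, inner_add_left, mul_add]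
  map_smul' c φ := by
    rw [RingHom.id_apply, smul_eq_mul, ← tsum_mul_left]
    refine tsum_congr fun n => ?_
    rw [Submodule.coe_smul, real_inner_smul_left]
    ring

theorem isBoundedFunctional_coeffFunctional (hpos : ∀ n, 0 < lam n) {θ : ℝ} {q : ℕ → ℝ}
    (hq : Summable fun n => (lam n ^ (-θ) * q n) ^ 2) :
    IsBoundedFunctional e lam θ (coeffFunctional e hpos θ q hq) := by
  refine ⟨√(∑' n, (lam n ^ (-θ) * q n) ^ 2), fun φ => ?_⟩
  have hφ : Summable fun n => (lam n ^ θ * ⟪(φ : L2 Ω), (e n).fn⟫_ℝ) ^ 2 := φ.2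
  have h1 := (tsum_mul_le_sqrt_mul_sqrt hq hφ).2
  simp_rw [rpow_neg_mul_mul_rpow_mul (hpos _)] at h1
  rw [fracNorm, ← ENNReal.ofReal_tsum_of_nonneg (fun n => sq_nonneg _) hφ,
    ENNReal.ofReal_rpow_of_nonneg (tsum_nonneg fun n => sq_nonneg _) (by norm_num),
    ← Real.sqrt_eq_rpow, ← ENNReal.ofReal_mul (Real.sqrt_nonneg _)]
  exact ENNReal.ofReal_le_ofReal h1

theorem coeffFunctional_eigen (h : IsDirichletEigenbasis Ω e lam) (hpos : ∀ n, 0 < lam n) {θ : ℝ}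
    {q : ℕ → ℝ} (hq : Summable fun n => (lam n ^ (-θ) * q n) ^ 2) (n : ℕ) :
    coeffFunctional e hpos θ q hq ⟨(e n).fn, eigen_mem_fracDomain h θ n⟩ = q n := by
  change ∑' m, q m * ⟪(e n).fn, (e m).fn⟫_ℝ = q n
  rw [tsum_eq_single n]
  · rw [real_inner_self_eq_norm_sq, h.orthonormal.1 n]; simp
  · intro m hm
    rw [h.orthonormal.2 hm.symm, mul_zero]

/-! ### The derivative of order `α` -/

open Classical in
/-- The functional `Δu(t) = -∑ λ_n ⟨u(t), e_n⟩ ⟨·, e_n⟩` on `D((-Δ)^θ)`. -/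
def laplaceFunctional (e : ℕ → H10 Ω) (hpos : ∀ n, 0 < lam n) (θ : ℝ) (x : L2 Ω) :
    fracDomain e lam θ →ₗ[ℝ] ℝ :=
  -- The value 0 serves only off the convergence set; for x = u(t) in the estimates this is a null
  -- set of times.
  if hq : Summable fun n => (lam n ^ (-θ) * (-lam n * ⟪x, (e n).fn⟫_ℝ)) ^ 2 then
    coeffFunctional e hpos θ _ hq else 0

/-- 2 - 2θ = 1 + 2(1/2 - θ): the dual norm of Δu of order θ is the norm of ∇u of order 1/2 - θ,
which reduces (ii) to the estimate behind (i). -/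
theorem laplace_coeff_sq {x : ℝ} (hx : 0 < x) (θ y : ℝ) :
    (x ^ (-θ) * (-x * y)) ^ 2 = x ^ (1 + 2 * (1 / 2 - θ)) * y ^ 2 := by
  have : x ^ (1 + 2 * (1 / 2 - θ)) = (x ^ (-θ)) ^ 2 * x ^ 2 := by
    rw [← Real.rpow_natCast (x ^ (-θ)), ← Real.rpow_natCast x, ← Real.rpow_mul hx.le,
      ← Real.rpow_add hx]
    congr 1
    push_cast
    ring
  rw [this]
  ring

/-- An element φ of D((-Δ)^θ) need not lie in H¹₀, so the weak equation cannot be tested with it. It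
is tested with each e_n, and the resulting identities are summed against the coefficients of φ. -/
theorem isRLDerivInDual_laplaceFunctional (h : IsDirichletEigenbasis Ω e lam)
    (hpos : ∀ n, 0 < lam n) {α T θ : ℝ} {u : ℝ → H10 Ω} {v : ℝ → L2 Ω}
    (hu : IsWeakSolution Ω α T u v)
    (hfin : ∫⁻ t in Ioo 0 T, ∑' n, ENNReal.ofReal
      ((lam n ^ (-θ) * (-lam n * ⟪(u t).fn, (e n).fn⟫_ℝ)) ^ 2) < ⊤) :
    (∀ᵐ t ∂(volume.restrict (Ioo 0 T)),
      Summable fun n => (lam n ^ (-θ) * (-lam n * ⟪(u t).fn, (e n).fn⟫_ℝ)) ^ 2) ∧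
    IsRLDerivInDual e lam T θ v fun t => laplaceFunctional e hpos θ (u t).fn := by
  have hm : ∀ n, AEMeasurable (fun t => lam n ^ (-θ) * (-lam n * ⟪(u t).fn, (e n).fn⟫_ℝ))
      (volume.restrict (Ioo 0 T)) := fun n =>
    (((hu.integrableOn_fn.inner_const _).aestronglyMeasurable.aemeasurable).const_mul _).const_mul _
  have hsum : ∀ᵐ t ∂(volume.restrict (Ioo 0 T)),
      Summable fun n => (lam n ^ (-θ) * (-lam n * ⟪(u t).fn, (e n).fn⟫_ℝ)) ^ 2 := by
    filter_upwards [ae_lt_top' (AEMeasurable.tsum fun n => ((hm n).pow_const 2).ennreal_ofReal)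
      hfin.ne] with t ht
    have := ENNReal.summable_toReal ht.ne
    simpa only [ENNReal.toReal_ofReal (sq_nonneg _)] using this
  have hv : IntegrableOn v (Ioo 0 T) := hu.memLp_deriv.integrable (by norm_num)
  refine ⟨hsum, ?_, fun φ => ?_⟩
  · filter_upwards [hsum] with t ht
    rw [laplaceFunctional, dif_pos ht]
    exact isBoundedFunctional_coeffFunctional hpos ht
  have hw : ∀ᵐ t ∂(volume.restrict (Ioo 0 T)), laplaceFunctional e hpos θ (u t).fn φ =
      ∑' n, lam n ^ θ * ⟪(φ : L2 Ω), (e n).fn⟫_ℝ *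
        (lam n ^ (-θ) * (-lam n * ⟪(u t).fn, (e n).fn⟫_ℝ)) := by
    filter_upwards [hsum] with t ht
    rw [laplaceFunctional, dif_pos ht]
    refine tsum_congr fun n => ?_
    rw [mul_comm (lam n ^ θ * _), rpow_neg_mul_mul_rpow_mul (hpos n)]
  -- The factor λ_n^θ goes to φ and λ_n^{-θ} to Δu, so each of the two sequences is square summable.
  have hw' := (integrable_tsum_mul hm hfin φ.2).1.congr (hw.mono fun t ht => ht.symm)
  refine ⟨hv.inner_const _, hw', fun ψ h1 h2 h3 => ?_⟩
  have hd : Continuous (deriv ψ) := h1.continuous_deriv (by simp)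
  obtain ⟨M, hM⟩ := h2.exists_bound_of_continuous h1.continuous
  have hfinψ : ∫⁻ t in Ioo 0 T, ∑' n, ENNReal.ofReal
      ((ψ t * (lam n ^ (-θ) * (-lam n * ⟪(u t).fn, (e n).fn⟫_ℝ))) ^ 2) < ⊤ := by
    refine lt_of_le_of_lt ?_ (ENNReal.mul_lt_top (ENNReal.ofReal_lt_top (r := M ^ 2)) hfin)
    rw [← lintegral_const_mul' _ _ ENNReal.ofReal_ne_top]
    refine lintegral_mono fun t => ?_
    rw [← ENNReal.tsum_mul_left]
    refine ENNReal.tsum_le_tsum fun n => ?_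
    rw [← ENNReal.ofReal_mul (sq_nonneg _), mul_pow]
    refine ENNReal.ofReal_le_ofReal (mul_le_mul_of_nonneg_right ?_ (sq_nonneg _))
    exact sq_le_sq' (neg_le_of_abs_le (hM t)) (le_of_abs_le (hM t))
  have hS1 := (integrable_tsum_mul (fun n => h1.continuous.aemeasurable.mul (hm n)) hfinψ φ.2).2.2
  simp only [Pi.mul_apply] at hS1
  have hS2 := h.hasSum_inner_mul_inner (∫ t in Ioo 0 T, deriv ψ t • v t) φ
  have hcoef : ∀ n, ⟪∫ t in Ioo 0 T, deriv ψ t • v t, (e n).fn⟫_ℝ * ⟪(φ : L2 Ω), (e n).fn⟫_ℝ =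
      -∫ t in Ioo 0 T, lam n ^ θ * ⟪(φ : L2 Ω), (e n).fn⟫_ℝ *
        (ψ t * (lam n ^ (-θ) * (-lam n * ⟪(u t).fn, (e n).fn⟫_ℝ))) := by
    intro n
    have e1 := (hu.hasWeakDeriv_coeff h n).2.2 ψ h1 h2 h3
    rw [← integral_inner_const (integrable_test_smul hv hd h2.deriv)]
    simp_rw [real_inner_smul_left]
    simp only [smul_eq_mul] at e1
    rw [e1, neg_mul, ← integral_mul_const]
    congr 1
    refine integral_congr_ae (ae_of_all _ fun t => ?_)
    have := rpow_neg_mul_mul_rpow_mul (hpos n) θ (-lam n * ⟪(u t).fn, (e n).fn⟫_ℝ)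
      ⟪(φ : L2 Ω), (e n).fn⟫_ℝ
    linear_combination (-ψ t) * this
  simp_rw [hcoef] at hS2
  have e2 := hS2.unique hS1.neg
  rw [← integral_inner_const (integrable_test_smul hv hd h2.deriv)] at e2
  simp_rw [real_inner_smul_left] at e2
  simp_rw [smul_eq_mul]
  rw [e2]
  congr 1
  refine integral_congr_ae (hw.mono fun t ht => ?_)
  beta_reduce
  rw [ht, ← tsum_mul_left]
  refine tsum_congr fun n => ?_
  ring

theorem IsWeakSolution.exists_isRLDerivInDual (h : IsDirichletEigenbasis Ω e lam)
    {α T θ μ lam₀ : ℝ} (hα : 3 / 2 < α) (hα' : α < 2) (hT : 0 < T) (h₀ : 0 < lam₀)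
    (hlam : ∀ n, lam₀ ≤ lam n) (hθ : 2 * (1 / 2 - θ - μ) ≤ (2 * α - 3) / α) :
    ∃ C : ℝ, 0 < C ∧ ∀ (u₁ : L2 Ω) (u₂ : H10 Ω), u₁ ∈ fracDomain e lam μ →
      gradFracNorm e lam μ u₂ < ⊤ → ∀ (u : ℝ → H10 Ω) (v : ℝ → L2 Ω),
      IsWeakSolution Ω α T u v → HasInitialData α u v u₁ u₂ →
      ∃ w : ℝ → (fracDomain e lam θ →ₗ[ℝ] ℝ), IsRLDerivInDual e lam T θ v w ∧
        timeL2Norm T (fun t => fracDualNorm h θ (w t)) ≤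
          ENNReal.ofReal C * (fracNorm e lam μ u₁ + gradFracNorm e lam μ u₂) := by
  have hpos : ∀ n, 0 < lam n := fun n => h₀.trans_le (hlam n)
  obtain ⟨C, hC, hest⟩ := exists_lintegral_tsum_seriesCoeff_le h hα hα' h₀ hlam hθ
  refine ⟨C ^ (1 / 2 : ℝ), by positivity, fun u₁ u₂ h₁ h₂ u v hu hi => ?_⟩
  have hle : ∫⁻ t in Ioo 0 T, ∑' n, ENNReal.ofReal
      ((lam n ^ (-θ) * (-lam n * ⟪(u t).fn, (e n).fn⟫_ℝ)) ^ 2) ≤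
      ENNReal.ofReal C * (fracNorm e lam μ u₁ ^ 2 + gradFracNorm e lam μ u₂ ^ 2) := by
    refine le_trans (le_of_eq ?_) (hest T u₁ u₂)
    refine lintegral_congr_ae ?_
    filter_upwards [hu.ae_coeff_eq h (by linarith) hα' hT hi] with t ht
    simp_rw [laplace_coeff_sq (hpos _), ht]
  have hfin := hle.trans_lt (ENNReal.mul_lt_top ENNReal.ofReal_lt_top
    (ENNReal.add_lt_top.2 ⟨ENNReal.pow_lt_top (fracNorm_lt_top h₁), ENNReal.pow_lt_top h₂⟩))
  obtain ⟨hsum, hd⟩ := isRLDerivInDual_laplaceFunctional h hpos hu hfin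
  refine ⟨_, hd, rpow_half_le (le_trans (le_of_eq ?_) hle) hC⟩
  refine lintegral_congr_ae (hsum.mono fun t ht => ?_)
  beta_reduce
  rw [fracDualNorm, rpow_half_sq, laplaceFunctional, dif_pos ht]
  simp_rw [coeffFunctional_eigen h hpos ht]

end RLWave
end

noncomputable section

namespace RLWave

/-! ### Superpositions in Banach spaces -/

/-- Cauchy criterion. Only a quadratic bound on finite sums is required, which suits `H10`, whose
sup norm is not Hilbertian. -/
theorem summable_smul_of_norm_sum_sq_le {X : Type*} [NormedAddCommGroup X] [NormedSpace ℝ X]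
    [CompleteSpace X] {x : ℕ → X} {κ : ℕ → ℝ}
    (hx : ∀ (s : Finset ℕ) (c : ℕ → ℝ), ‖∑ n ∈ s, c n • x n‖ ^ 2 ≤ ∑ n ∈ s, κ n * c n ^ 2)
    {c : ℕ → ℝ} (hc : Summable fun n => κ n * c n ^ 2) : Summable fun n => c n • x n := by
  rw [summable_iff_vanishing_norm] at hc ⊢
  intro ε hε
  obtain ⟨s, hs⟩ := hc (ε ^ 2) (by positivity)
  refine ⟨s, fun t ht => ?_⟩
  have h1 := (hx t c).trans_lt ((le_abs_self _).trans_lt (hs t ht))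
  exact lt_of_pow_lt_pow_left₀ 2 hε.le h1

theorem exists_memLp_series {X : Type*} [NormedAddCommGroup X] [NormedSpace ℝ X]
    [CompleteSpace X] {ν : Measure ℝ} {x : ℕ → X} {κ : ℕ → ℝ} (hκ : ∀ n, 0 ≤ κ n)
    (hx : ∀ (s : Finset ℕ) (c : ℕ → ℝ), ‖∑ n ∈ s, c n • x n‖ ^ 2 ≤ ∑ n ∈ s, κ n * c n ^ 2)
    {c : ℕ → ℝ → ℝ} (hc : ∀ n, AEMeasurable (c n) ν)
    (hs : ∫⁻ t, ∑' n, ENNReal.ofReal (κ n * c n t ^ 2) ∂ν < ⊤) :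
    ∃ U : ℝ → X, MemLp U 2 ν ∧ ∀ᵐ t ∂ν, HasSum (fun n => c n t • x n) (U t) := by
  have hnn : ∀ t n, 0 ≤ κ n * c n t ^ 2 := fun t n => mul_nonneg (hκ n) (sq_nonneg _)
  have hsum : ∀ᵐ t ∂ν, Summable fun n => κ n * c n t ^ 2 := by
    filter_upwards [ae_lt_top' (AEMeasurable.tsum fun n =>
      (((hc n).pow_const 2).const_mul (κ n)).ennreal_ofReal) hs.ne] with t ht
    have := ENNReal.summable_toReal ht.ne
    simpa only [ENNReal.toReal_ofReal (hnn _ _)] using this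
  have hU : ∀ᵐ t ∂ν, HasSum (fun n => c n t • x n) (∑' n, c n t • x n) :=
    hsum.mono fun t ht => (summable_smul_of_norm_sum_sq_le hx ht).hasSum
  refine ⟨fun t => ∑' n, c n t • x n, ⟨?_, ?_⟩, hU⟩
  · refine aestronglyMeasurable_of_tendsto_ae (u := atTop)
      (f := fun k t => ∑ n ∈ Finset.range k, c n t • x n) ?_ ?_
    · intro k
      refine Finset.aestronglyMeasurable_fun_sum _ fun n _ => ?_
      exact (hc n).aestronglyMeasurable.smul_const _
    · exact hU.mono fun t ht => ht.tendsto_sum_nat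
  · rw [eLpNorm_lt_top_iff_lintegral_rpow_enorm_lt_top (by norm_num) (by norm_num)]
    refine lt_of_le_of_lt (lintegral_mono_ae ?_) hs
    filter_upwards [hsum, hU] with t h1 h2
    have h3 : ‖∑' n, c n t • x n‖ ^ 2 ≤ ∑' n, κ n * c n t ^ 2 := by
      refine le_of_tendsto ((h2.norm).pow 2) (Eventually.of_forall fun s => ?_)
      exact (hx s _).trans (h1.sum_le_tsum s fun n _ => hnn t n)
    rw [← ENNReal.ofReal_tsum_of_nonneg (hnn t) h1, ← ofReal_norm]
    simp only [ENNReal.toReal_ofNat, ENNReal.rpow_ofNat]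
    rw [← ENNReal.ofReal_pow (norm_nonneg _)]
    exact ENNReal.ofReal_le_ofReal h3

/-! ### Existence of the weak solution -/

variable {N : ℕ} {Ω : Set (EuclideanSpace ℝ (Fin N))} {e : ℕ → H10 Ω} {lam : ℕ → ℝ}

theorem IsDirichletEigenbasis.inner_of_hasSum (h : IsDirichletEigenbasis Ω e lam) {c : ℕ → ℝ}
    {x : L2 Ω} (hx : HasSum (fun n => c n • (e n).fn) x) (n : ℕ) : ⟪x, (e n).fn⟫_ℝ = c n := by
  have h1 := hx.mapL (innerSL ℝ (e n).fn)
  simp only [innerSL_apply_apply, real_inner_smul_right] at h1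
  have h2 : HasSum (fun m => c m * ⟪(e n).fn, (e m).fn⟫_ℝ) (c n) := by
    have := hasSum_single (f := fun m => c m * ⟪(e n).fn, (e m).fn⟫_ℝ) n fun m hm => by
      rw [h.orthonormal.2 hm.symm, mul_zero]
    simpa [real_inner_self_eq_norm_sq, h.orthonormal.1 n] using this
  rw [real_inner_comm]
  exact h1.unique h2

theorem sum_fn (s : Finset ℕ) (c : ℕ → ℝ) :
    (∑ n ∈ s, c n • e n : H10 Ω).fn = ∑ n ∈ s, c n • (e n).fn := by
  rw [← fnL_apply, map_sum]
  simp only [map_smul, fnL_apply]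

theorem IsDirichletEigenbasis.norm_sum_fn_sq (h : IsDirichletEigenbasis Ω e lam) (s : Finset ℕ)
    (c : ℕ → ℝ) : ‖∑ n ∈ s, c n • (e n).fn‖ ^ 2 = ∑ n ∈ s, 1 * c n ^ 2 := by
  rw [← real_inner_self_eq_norm_sq, h.orthonormal.inner_sum]
  simp [sq]

theorem inner_grad_sum (h : IsDirichletEigenbasis Ω e lam) (s : Finset ℕ) (c : ℕ → ℝ)
    (φ : H10 Ω) : ⟪φ.grad, (∑ n ∈ s, c n • e n : H10 Ω).grad⟫_ℝ =
      ∑ n ∈ s, lam n * (c n * ⟪φ.fn, (e n).fn⟫_ℝ) := by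
  rw [← gradL_apply (∑ n ∈ s, c n • e n), map_sum, inner_sum]
  refine Finset.sum_congr rfl fun n _ => ?_
  rw [map_smul, real_inner_smul_right, gradL_apply, h.inner_grad]
  ring

theorem norm_grad_sum_sq (h : IsDirichletEigenbasis Ω e lam) (s : Finset ℕ) (c : ℕ → ℝ) :
    ‖(∑ n ∈ s, c n • e n : H10 Ω).grad‖ ^ 2 = ∑ n ∈ s, lam n * c n ^ 2 := by
  rw [← real_inner_self_eq_norm_sq, inner_grad_sum h]
  refine Finset.sum_congr rfl fun n hn => ?_
  rw [sum_fn, real_inner_comm, h.orthonormal.inner_right_sum c hn]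
  ring

theorem IsDirichletEigenbasis.norm_sum_sq_le (h : IsDirichletEigenbasis Ω e lam) (s : Finset ℕ)
    (c : ℕ → ℝ) : ‖∑ n ∈ s, c n • e n‖ ^ 2 ≤ ∑ n ∈ s, (1 + lam n) * c n ^ 2 := by
  set w : H10 Ω := ∑ n ∈ s, c n • e n with hw
  -- The product norm is a maximum, bounded by the ℓ² sum, which is explicit since the e_n and the
  -- ∇e_n are both orthogonal families.
  have h1 : ‖w‖ = max ‖w.fn‖ ‖w.grad‖ := rfl
  have h2 : ‖w.fn‖ ^ 2 + ‖w.grad‖ ^ 2 = ∑ n ∈ s, (1 + lam n) * c n ^ 2 := by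
    rw [hw, sum_fn, h.norm_sum_fn_sq, norm_grad_sum_sq h, ← Finset.sum_add_distrib]
    exact Finset.sum_congr rfl fun n _ => by ring
  rw [← h2, h1]
  rcases max_cases ‖w.fn‖ ‖w.grad‖ with h | h <;> rw [h.1]
  · exact le_add_of_nonneg_right (sq_nonneg _)
  · exact le_add_of_nonneg_left (sq_nonneg _)

/-- Bessel's inequality for the gradient. -/
theorem IsDirichletEigenbasis.summable_lam_mul_sq (h : IsDirichletEigenbasis Ω e lam)
    (hpos : ∀ n, 0 < lam n) (φ : H10 Ω) : Summable fun n => lam n * ⟪φ.fn, (e n).fn⟫_ℝ ^ 2 := by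
  refine summable_of_sum_le (c := ‖φ.grad‖ ^ 2)
    (fun n => mul_nonneg (hpos n).le (sq_nonneg _)) fun s => ?_
  set c : ℕ → ℝ := fun n => ⟪φ.fn, (e n).fn⟫_ℝ with hc
  have h1 := inner_grad_sum h s c φ
  have h2 := norm_grad_sum_sq h s c
  have h3 : ⟪φ.grad, (∑ n ∈ s, c n • e n : H10 Ω).grad⟫_ℝ =
      ‖(∑ n ∈ s, c n • e n : H10 Ω).grad‖ ^ 2 := by
    rw [h1, h2]
    exact Finset.sum_congr rfl fun n _ => by rw [sq]
  have h4 := real_inner_le_norm φ.grad (∑ n ∈ s, c n • e n : H10 Ω).grad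
  rw [h3] at h4
  rw [← h2]
  nlinarith [sq_nonneg (‖φ.grad‖ - ‖(∑ n ∈ s, c n • e n : H10 Ω).grad‖)]

/-- The `n`-th coefficient of `D^{α-1}u`. -/
def derivCoeff (e : ℕ → H10 Ω) (lam : ℕ → ℝ) (α : ℝ) (u₁ : L2 Ω) (u₂ : H10 Ω) (n : ℕ) (t : ℝ) : ℝ :=
  ⟪u₁, (e n).fn⟫_ℝ * mlFun α 1 (lam n) t -
    ⟪u₂.fn, (e n).fn⟫_ℝ * (lam n * mlFun α α (lam n) t)

theorem integral_seriesCoeff {α : ℝ} (hα : 1 < α) (u₁ : L2 Ω) (u₂ : H10 Ω) (n : ℕ) {t : ℝ}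
    (ht : 0 < t) : derivCoeff e lam α u₁ u₂ n t =
      ⟪u₁, (e n).fn⟫_ℝ - lam n * ∫ s in Ioo 0 t, seriesCoeff e lam α u₁ u₂ s n := by
  simp_rw [seriesCoeff_eq]
  rw [← rlIntegral_one (fun s => _ * mlFun α α (lam n) s + _ * mlFun α (α - 1) (lam n) s),
    rlIntegral_mlFun_lin hα.le one_pos (by linarith) (by linarith) _ _ _ ht, derivCoeff,
    mlFun_eq_add hα.le one_pos _ ht]
  simp only [sub_self, Real.rpow_zero, Real.Gamma_one, add_sub_cancel, add_comm 1 α]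
  ring

/-- The converse of the scalar uniqueness: with `integral_seriesCoeff`, the explicit coefficients
satisfy both integral equations for every t > 0. -/
theorem rlIntegral_seriesCoeff {α : ℝ} (hα : 1 < α) (hα' : α < 2) (u₁ : L2 Ω) (u₂ : H10 Ω) (n : ℕ)
    {t : ℝ} (ht : 0 < t) : rlIntegral (2 - α) (fun s => seriesCoeff e lam α u₁ u₂ s n) t =
      ⟪u₂.fn, (e n).fn⟫_ℝ + ∫ s in Ioo 0 t, derivCoeff e lam α u₁ u₂ n s := by
  have h1 : ∫ s in Ioo 0 t, derivCoeff e lam α u₁ u₂ n s =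
      ⟪u₁, (e n).fn⟫_ℝ * mlFun α 2 (lam n) t +
        -(⟪u₂.fn, (e n).fn⟫_ℝ * lam n) * mlFun α (α + 1) (lam n) t := by
    have := rlIntegral_mlFun_lin (β := 1) hα.le one_pos one_pos (by linarith : 0 < α) (lam n)
      ⟪u₁, (e n).fn⟫_ℝ (-(⟪u₂.fn, (e n).fn⟫_ℝ * lam n)) ht
    rw [rlIntegral_one, one_add_one_eq_two, add_comm 1 α] at this
    rw [← this]
    refine integral_congr_ae (ae_of_all _ fun s => ?_)
    simp only [derivCoeff]
    ring
  simp_rw [seriesCoeff_eq]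
  rw [rlIntegral_mlFun_lin hα.le (by linarith) (by linarith) (by linarith) _ _ _ ht, h1,
    sub_add_cancel, show 2 - α + (α - 1) = 1 by ring, mlFun_eq_add hα.le one_pos _ ht]
  simp only [sub_self, Real.rpow_zero, Real.Gamma_one]
  ring

theorem lintegral_tsum_derivCoeff_lt_top (h : IsDirichletEigenbasis Ω e lam) {α lam₀ : ℝ}
    (hα : 3 / 2 < α) (hα' : α < 2) (h₀ : 0 < lam₀) (hlam : ∀ n, lam₀ ≤ lam n)
    (u₁ : L2 Ω) (u₂ : H10 Ω) (T : ℝ) :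
    ∫⁻ t in Ioo 0 T, ∑' n, ENNReal.ofReal (1 * derivCoeff e lam α u₁ u₂ n t ^ 2) < ⊤ := by
  obtain ⟨C, hC, hest⟩ := exists_lintegral_solution_deriv_sq_le hα hα' h₀
  have hm : ∀ n, AEMeasurable (derivCoeff e lam α u₁ u₂ n) (volume.restrict (Ioo 0 T)) := fun n =>
    ((aemeasurable_mlFun (by linarith) one_pos _ T).const_mul _).sub
      (((aemeasurable_mlFun (by linarith) (by linarith) _ T).const_mul _).const_mul _)
  rw [lintegral_tsum fun n => (((hm n).pow_const 2).const_mul _).ennreal_ofReal]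
  have hs : Summable fun n => C * (⟪u₁, (e n).fn⟫_ℝ ^ 2 + lam n * ⟪u₂.fn, (e n).fn⟫_ℝ ^ 2) := by
    refine Summable.mul_left _ (Summable.add ?_
      (h.summable_lam_mul_sq (fun n => h₀.trans_le (hlam n)) u₂))
    exact (h.hasSum_inner_mul_inner u₁ u₁).summable.congr fun n => (sq _).symm
  refine lt_of_le_of_lt (ENNReal.tsum_le_tsum fun n => ?_)
    (lt_top_iff_ne_top.2 hs.tsum_ofReal_ne_top)
  simp only [one_mul]
  exact hest (lam n) T _ _ (hlam n)

theorem lintegral_tsum_seriesCoeff_lt_top (h : IsDirichletEigenbasis Ω e lam) {α lam₀ : ℝ}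
    (hα : 3 / 2 < α) (hα' : α < 2) (h₀ : 0 < lam₀) (hlam : ∀ n, lam₀ ≤ lam n)
    (u₁ : L2 Ω) (u₂ : H10 Ω) (T : ℝ) :
    ∫⁻ t in Ioo 0 T, ∑' n, ENNReal.ofReal (lam n * seriesCoeff e lam α u₁ u₂ t n ^ 2) < ⊤ := by
  have hpos : ∀ n, 0 < lam n := fun n => h₀.trans_le (hlam n)
  -- The case θ = μ = 0 shows that data in L² × H¹₀ already give ∇u ∈ L²(0,T;L²).
  obtain ⟨C, hC, hest⟩ := exists_lintegral_tsum_seriesCoeff_le h (θ := 0) (μ := 0) hα hα' h₀ hlam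
    (by simp only [sub_zero, mul_zero]; exact div_nonneg (by linarith) (by linarith))
  have h1 : fracNorm e lam 0 u₁ < ⊤ := by
    refine fracNorm_lt_top ?_
    change Summable _
    refine (h.hasSum_inner_mul_inner u₁ u₁).summable.congr fun n => ?_
    rw [Real.rpow_zero, one_mul, sq]
  have h2 : gradFracNorm e lam 0 u₂ < ⊤ := by
    rw [gradFracNorm_eq h hpos]
    refine ENNReal.rpow_lt_top_of_nonneg (by norm_num) ?_
    simp only [mul_zero, add_zero, Real.rpow_one]
    exact (h.summable_lam_mul_sq hpos u₂).tsum_ofReal_ne_top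
  have h3 := (hest T u₁ u₂).trans_lt (ENNReal.mul_lt_top ENNReal.ofReal_lt_top
    (ENNReal.add_lt_top.2 ⟨ENNReal.pow_lt_top h1, ENNReal.pow_lt_top h2⟩))
  simpa only [mul_zero, add_zero, Real.rpow_one] using h3

theorem ae_inner_eq_add_integral (h : IsDirichletEigenbasis Ω e lam) {α T : ℝ}
    (hα : 1 < α) (hpos : ∀ n, 0 < lam n) {u₁ : L2 Ω} {u₂ : H10 Ω}
    (hfin : ∫⁻ t in Ioo 0 T, ∑' n, ENNReal.ofReal
      (lam n * seriesCoeff e lam α u₁ u₂ t n ^ 2) < ⊤)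
    {u : ℝ → H10 Ω} {v : ℝ → L2 Ω}
    (huS : ∀ᵐ t ∂(volume.restrict (Ioo 0 T)),
      HasSum (fun n => seriesCoeff e lam α u₁ u₂ t n • e n) (u t))
    (hvS : ∀ᵐ t ∂(volume.restrict (Ioo 0 T)),
      HasSum (fun n => derivCoeff e lam α u₁ u₂ n t • (e n).fn) (v t)) (φ : H10 Ω) :
    ∀ᵐ t ∂(volume.restrict (Ioo 0 T)),
      ⟪v t, φ.fn⟫_ℝ = ⟪u₁, φ.fn⟫_ℝ + ∫ s in Ioo 0 t, -⟪(u s).grad, φ.grad⟫_ℝ := by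
  filter_upwards [hvS, ae_restrict_mem measurableSet_Ioo] with t hvt ht
  have hsub : Ioo 0 t ⊆ Ioo 0 T := Ioo_subset_Ioo_right ht.2.le
  have hsq : ∀ n, √(lam n) * √(lam n) = lam n := fun n => Real.mul_self_sqrt (hpos n).le
  -- λ_n is split as √λ_n · √λ_n: one root makes the coefficients of φ ∈ H¹₀ square summable, the
  -- other those of u square summable and integrable in time.
  have hS := (integrable_tsum_mul (ν := volume.restrict (Ioo 0 t))
    (f := fun n s => √(lam n) * seriesCoeff e lam α u₁ u₂ s n)
    (p := fun n => √(lam n) * ⟪φ.fn, (e n).fn⟫_ℝ)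
    (fun n => (measurable_seriesCoeff hα u₁ u₂ n t).const_mul _)
    (lt_of_le_of_lt (lintegral_mono_set hsub) (by
      simpa only [mul_pow, Real.sq_sqrt (hpos _).le] using hfin))
    ((h.summable_lam_mul_sq hpos φ).congr fun n => by
      rw [mul_pow, Real.sq_sqrt (hpos n).le])).2.2
  have hI : ∫ s in Ioo 0 t, ∑' n, √(lam n) * ⟪φ.fn, (e n).fn⟫_ℝ *
      (√(lam n) * seriesCoeff e lam α u₁ u₂ s n) = ∫ s in Ioo 0 t, ⟪(u s).grad, φ.grad⟫_ℝ := by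
    refine integral_congr_ae ?_
    filter_upwards [ae_restrict_of_ae_restrict_of_subset hsub huS] with s hs
    have h1 := (hs.mapL (gradL Ω)).mapL (innerSL ℝ φ.grad)
    simp only [innerSL_apply_apply, map_smul, gradL_apply, smul_eq_mul, h.inner_grad] at h1
    rw [real_inner_comm, ← h1.tsum_eq]
    refine tsum_congr fun n => ?_
    linear_combination (⟪φ.fn, (e n).fn⟫_ℝ * seriesCoeff e lam α u₁ u₂ s n) * hsq n
  rw [hI] at hS
  have hT1 := h.hasSum_inner_mul_inner (v t) φ.fn
  simp_rw [h.inner_of_hasSum hvt] at hT1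
  have hT2 := (h.hasSum_inner_mul_inner u₁ φ.fn).sub hS
  rw [integral_neg, ← sub_eq_add_neg]
  have hfun : ∀ n, ⟪u₁, (e n).fn⟫_ℝ * ⟪φ.fn, (e n).fn⟫_ℝ -
      ∫ s in Ioo 0 t, √(lam n) * ⟪φ.fn, (e n).fn⟫_ℝ *
        (√(lam n) * seriesCoeff e lam α u₁ u₂ s n) =
      derivCoeff e lam α u₁ u₂ n t * ⟪φ.fn, (e n).fn⟫_ℝ := by
    intro n
    rw [integral_seriesCoeff hα u₁ u₂ n ht.1, integral_const_mul, integral_const_mul]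
    linear_combination
      (-⟪φ.fn, (e n).fn⟫_ℝ * ∫ s in Ioo 0 t, seriesCoeff e lam α u₁ u₂ s n) * hsq n
  simp_rw [hfun] at hT2
  exact hT1.unique hT2

/-- An identity in L²(Ω) is decided by its coefficients, each of which is the scalar identity. The
countably many exceptional null sets are merged before n is fixed. -/
theorem ae_rlIntegral_eq_add_integral (h : IsDirichletEigenbasis Ω e lam) {α T : ℝ}
    (hα : 1 < α) (hα' : α < 2) {u₁ : L2 Ω} {u₂ : H10 Ω} {u : ℝ → H10 Ω} {v : ℝ → L2 Ω}
    (hu : IntegrableOn (fun t => (u t).fn) (Ioo 0 T)) (hv : IntegrableOn v (Ioo 0 T))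
    (huS : ∀ᵐ t ∂(volume.restrict (Ioo 0 T)),
      HasSum (fun n => seriesCoeff e lam α u₁ u₂ t n • e n) (u t))
    (hvS : ∀ᵐ t ∂(volume.restrict (Ioo 0 T)),
      HasSum (fun n => derivCoeff e lam α u₁ u₂ n t • (e n).fn) (v t)) :
    ∀ᵐ t ∂(volume.restrict (Ioo 0 T)),
      rlIntegral (2 - α) (fun s => (u s).fn) t = u₂.fn + ∫ s in Ioo 0 t, v s := by
  have h1 : ∀ᵐ t ∂(volume.restrict (Ioo 0 T)), ∀ n, ⟪rlIntegral (2 - α) (fun s => (u s).fn) t,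
      (e n).fn⟫_ℝ = rlIntegral (2 - α) (fun s => ⟪(u s).fn, (e n).fn⟫_ℝ) t :=
    ae_all_iff.2 fun n => ae_inner_rlIntegral (by linarith) hu _
  filter_upwards [h1, ae_restrict_mem measurableSet_Ioo] with t h1t ht
  have hsub : Ioo 0 t ⊆ Ioo 0 T := Ioo_subset_Ioo_right ht.2.le
  refine h.ext_inner fun n => ?_
  have h2 : rlIntegral (2 - α) (fun s => ⟪(u s).fn, (e n).fn⟫_ℝ) t =
      rlIntegral (2 - α) (fun s => seriesCoeff e lam α u₁ u₂ s n) t :=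
    rlIntegral_congr_ae (huS.mono fun s hs => h.inner_of_hasSum (by
      have := hs.mapL (fnL Ω)
      simpa only [map_smul, fnL_apply] using this) n) ht.2.le
  rw [h1t, h2, rlIntegral_seriesCoeff hα hα' u₁ u₂ n ht.1, inner_add_left,
    ← integral_inner_const (hv.mono_set hsub)]
  congr 1
  refine integral_congr_ae ?_
  filter_upwards [ae_restrict_of_ae_restrict_of_subset hsub hvS] with s hs
  exact (h.inner_of_hasSum hs n).symm

theorem exists_isWeakSolution (h : IsDirichletEigenbasis Ω e lam) {α T lam₀ : ℝ}
    (hα : 3 / 2 < α) (hα' : α < 2) (hT : 0 < T) (h₀ : 0 < lam₀) (hlam : ∀ n, lam₀ ≤ lam n)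
    (u₁ : L2 Ω) (u₂ : H10 Ω) :
    ∃ (u : ℝ → H10 Ω) (v : ℝ → L2 Ω), IsWeakSolution Ω α T u v ∧ HasInitialData α u v u₁ u₂ := by
  have hpos : ∀ n, 0 < lam n := fun n => h₀.trans_le (hlam n)
  have hα1 : 1 < α := by linarith
  have hfin := lintegral_tsum_seriesCoeff_lt_top h hα hα' h₀ hlam u₁ u₂ T
  obtain ⟨u, hu, huS⟩ := exists_memLp_series (κ := fun n => 1 + lam n) (x := e)
    (fun n => by linarith [hpos n]) h.norm_sum_sq_le
    (c := fun n t => seriesCoeff e lam α u₁ u₂ t n)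
    (fun n => measurable_seriesCoeff hα1 u₁ u₂ n T) (by
      refine lt_of_le_of_lt ?_ (ENNReal.mul_lt_top (ENNReal.ofReal_lt_top (r := lam₀⁻¹ + 1)) hfin)
      rw [← lintegral_const_mul' _ _ ENNReal.ofReal_ne_top]
      refine lintegral_mono fun t => ?_
      rw [← ENNReal.tsum_mul_left]
      refine ENNReal.tsum_le_tsum fun n => ?_
      rw [← ENNReal.ofReal_mul (by positivity), ← mul_assoc]
      refine ENNReal.ofReal_le_ofReal (mul_le_mul_of_nonneg_right ?_ (sq_nonneg _))
      -- λ_n ≥ λ₀ bounds the weight 1 + λ_n of the full H¹ norm by (λ₀⁻¹ + 1)λ_n, so the gradient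
      -- estimate suffices.
      have : 1 ≤ lam₀⁻¹ * lam n := by
        rw [inv_mul_eq_div, le_div_iff₀ h₀, one_mul]
        exact hlam n
      linarith)
  obtain ⟨v, hv, hvS⟩ := exists_memLp_series (κ := fun _ => 1) (x := fun n => (e n).fn)
    (fun n => zero_le_one) (fun s c => (h.norm_sum_fn_sq s c).le)
    (c := derivCoeff e lam α u₁ u₂)
    (fun n => ((aemeasurable_mlFun hα1.le one_pos _ T).const_mul _).sub
      (((aemeasurable_mlFun hα1.le (by linarith) _ T).const_mul _).const_mul _))
    (lintegral_tsum_derivCoeff_lt_top h hα hα' h₀ hlam u₁ u₂ T)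
  have hui : IntegrableOn u (Ioo 0 T) := hu.integrable (by norm_num)
  have hvi : IntegrableOn v (Ioo 0 T) := hv.integrable (by norm_num)
  have hgi : ∀ φ : H10 Ω, IntegrableOn (fun t => -⟪(u t).grad, φ.grad⟫_ℝ) (Ioo 0 T) := fun φ =>
    (((gradL Ω).integrable_comp hui).inner_const φ.grad).neg
  have E1 := ae_inner_eq_add_integral h hα1 hpos hfin huS hvS
  have E2 := ae_rlIntegral_eq_add_integral h hα1 hα' ((fnL Ω).integrable_comp hui) hvi huS hvS
  refine ⟨u, v, ⟨hu, hv, hasWeakDeriv_of_eq_integral hvi E2, fun φ => ⟨_,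
    hasWeakDeriv_of_eq_integral (hgi φ) (E1 φ), ae_of_all _ fun t => neg_add_cancel _⟩⟩, ?_, ?_⟩
  · intro φ
    have := ((tendsto_setIntegral_Ioo_zero hT (hgi φ)).mono_left
      (inf_le_left (b := ae volume))).const_add ⟪u₁, φ.fn⟫_ℝ
    rw [add_zero] at this
    exact this.congr' ((eventually_of_ae_restrict_Ioo hT (E1 φ)).mono fun t ht => ht.symm)
  · have := ((tendsto_setIntegral_Ioo_zero hT hvi).mono_left
      (inf_le_left (b := ae volume))).const_add u₂.fn
    rw [add_zero] at this
    exact this.congr' ((eventually_of_ae_restrict_Ioo hT E2).mono fun t ht => ht.symm)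

end RLWave
end

/-! ### Assembly of the theorem. -/

theorem theorem4p1 {N : ℕ} (hN : 1 ≤ N) (Ω : Set (EuclideanSpace ℝ (Fin N)))
    (hΩ_open : IsOpen Ω) (hΩ_bdd : Bornology.IsBounded Ω) (hΩ_ne : Ω.Nonempty)
    (α T μ : ℝ) (hα : 3 / 2 < α) (hα' : α < 2) (hT : 0 < T) (hμ : 0 ≤ μ) :
    (∃ (e : ℕ → RLWave.H10 Ω) (lam : ℕ → ℝ), RLWave.IsDirichletEigenbasis Ω e lam) ∧
    ∀ (e : ℕ → RLWave.H10 Ω) (lam : ℕ → ℝ) (h : RLWave.IsDirichletEigenbasis Ω e lam),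
      -- there is a weak solution, and every weak solution is given by the series
      (∀ (u₁ : RLWave.L2 Ω) (u₂ : RLWave.H10 Ω),
        u₁ ∈ RLWave.fracDomain e lam μ → RLWave.gradFracNorm e lam μ u₂ < ⊤ →
        (∃ (u : ℝ → RLWave.H10 Ω) (v : ℝ → RLWave.L2 Ω),
          RLWave.IsWeakSolution Ω α T u v ∧ RLWave.HasInitialData α u v u₁ u₂) ∧
        ∀ (u : ℝ → RLWave.H10 Ω) (v : ℝ → RLWave.L2 Ω),
          RLWave.IsWeakSolution Ω α T u v → RLWave.HasInitialData α u v u₁ u₂ →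
          ∀ᵐ t ∂(volume.restrict (Ioo 0 T)),
            HasSum (fun n => RLWave.seriesCoeff e lam α u₁ u₂ t n • (e n).fn) (u t).fn) ∧
      -- (i)
      (∀ θ ∈ Ioo μ ((2 * α - 3) / (2 * α) + μ), ∃ C : ℝ, 0 < C ∧
        ∀ (u₁ : RLWave.L2 Ω) (u₂ : RLWave.H10 Ω),
        u₁ ∈ RLWave.fracDomain e lam μ → RLWave.gradFracNorm e lam μ u₂ < ⊤ →
        ∀ (u : ℝ → RLWave.H10 Ω) (v : ℝ → RLWave.L2 Ω),
          RLWave.IsWeakSolution Ω α T u v → RLWave.HasInitialData α u v u₁ u₂ →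
          RLWave.timeL2Norm T (fun t => RLWave.gradFracNorm e lam θ (u t)) ≤
            ENNReal.ofReal C *
              (RLWave.fracNorm e lam μ u₁ + RLWave.gradFracNorm e lam μ u₂)) ∧
      -- (ii)
      (∀ θ ∈ Ioo ((3 - α) / (2 * α) - μ) (1 / 2 - μ), ∃ C : ℝ, 0 < C ∧
        ∀ (u₁ : RLWave.L2 Ω) (u₂ : RLWave.H10 Ω),
        u₁ ∈ RLWave.fracDomain e lam μ → RLWave.gradFracNorm e lam μ u₂ < ⊤ →
        ∀ (u : ℝ → RLWave.H10 Ω) (v : ℝ → RLWave.L2 Ω),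
          RLWave.IsWeakSolution Ω α T u v → RLWave.HasInitialData α u v u₁ u₂ →
          ∃ w : ℝ → (RLWave.fracDomain e lam θ →ₗ[ℝ] ℝ),
            RLWave.IsRLDerivInDual e lam T θ v w ∧
            RLWave.timeL2Norm T (fun t => RLWave.fracDualNorm h θ (w t)) ≤
              ENNReal.ofReal C *
                (RLWave.fracNorm e lam μ u₁ + RLWave.gradFracNorm e lam μ u₂)) := by
  refine ⟨RLWave.exists_isDirichletEigenbasis hN hΩ_open hΩ_bdd hΩ_ne, fun e lam h => ?_⟩
  obtain ⟨lam₀, h₀, hlam⟩ := h.exists_le_lam hN hΩ_open hΩ_bdd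
  have hα1 : 1 < α := by linarith
  have hα0 : 0 < α := by linarith
  have hhalf : (2 * α - 3) / α = 2 * ((2 * α - 3) / (2 * α)) := by field_simp
  refine ⟨fun u₁ u₂ _ _ => ⟨RLWave.exists_isWeakSolution h hα hα' hT h₀ hlam u₁ u₂,
    fun u v hu hi => hu.ae_hasSum h hα1 hα' hT hi⟩, fun θ hθ => ?_, fun θ hθ => ?_⟩
  · obtain ⟨C, hC, hest⟩ := RLWave.IsWeakSolution.timeL2Norm_gradFracNorm_le h (θ := θ) (μ := μ)
      hα hα' hT h₀ hlam (by rw [hhalf]; linarith [hθ.2])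
    exact ⟨C, hC, fun u₁ u₂ _ _ => hest u₁ u₂⟩
  · refine RLWave.IsWeakSolution.exists_isRLDerivInDual h hα hα' hT h₀ hlam ?_
    -- The lower end of the range of θ in (ii) is the reflection θ ↦ 1/2 - θ of the upper end in
    -- (i).
    have h1 : (3 - α) / (2 * α) + (2 * α - 3) / (2 * α) = 1 / 2 := by field_simp; ring
    rw [hhalf]
    linarith [hθ.1]
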